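/- **Proposition (potentials in $L_0^{q,\infty}$ are admissible).** Let $d\ge 2$ and $m\ge 1$ be integers. *Notation.* For $\alpha\in\mathbb R$ let $S_\alpha=(1-\Delta)^{\alpha/2}$ on $\mathcal S'(\mathbb R^d)$. Put $p_d=\frac{2d+2}{d+3}$, $p_d'=\frac{2d+2}{d-1}$, $\theta=m-\frac d{d+1}$, and let $L^{p,r}$ be the Lorentz spaces, with $\|f\|_{L^{q,\infty}}=\sup_{t>0}t\,|\{|f|>t\}|^{1/q}$. Let $W_\alpha^{p,r}=\{u\in\mathcal S':S_\alpha u\in L^{p,r}\}$ with $\|u\|_{W_\alpha^{p,r}}=\|S_\alpha u\|_{L^{p,r}}$. With $D_0=\{|x|\le1\}$ and $D_j=\{2^{j-1}\le|x|\le2^j\}$ for $j\ge1$, let $B$, $B^*$ be the spaces of (measurable) functions $f:\mathbb R^d\to\mathbb C$ with finite norm $$\|f\|_B=\sum_{j\ge0}2^{j/2}\|f\|_{L^2(D_j)},\qquad \|f\|_{B^*}=\sup_{j\ge0}2^{-j/2}\|f\|_{L^2(D_j)}.$$ Let $$X=W_{-\theta}^{p_d,2}+S_m(B),\qquad X^*=W_{\theta}^{p_d',2}\cap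 S_{-m}(B^*),$$ with the usual sum and intersection norms. The pairing of $T=S_\theta F_1+S_mF_2\in X$ ($F_1\in L^{p_d,2}$, $F_2\in B$) with $g\in X^*$ is $\langle T,g\rangle=\int F_1\overline{S_\theta g}+\int F_2\overline{S_m g}$ (independent of the decomposition), and $\langle g,T\rangle=\overline{\langle T,g\rangle}$. For $N\ge0$ and $\gamma\in(0,1]$ let $\mu_{N,\gamma}(x)=\frac{(1+|x|^2)^N}{(1+\gamma|x|^2)^N}$. Let $L_0^{q,\infty}$ be the closure of $C_c^\infty(\mathbb R^d)$ with respect to $\|\cdot\|_{L^{q,\infty}}$. *Definition.* A linear operator $V:X^*\to X$ is an *admissible perturbation* of $(-\Delta)^m$ if 1. (P1) $V\in\mathcal B(X^*,X)$ and $\langle V\phi,\psi\rangle=\langle\phi,V\psi\rangle$ for all $\phi,\psi\in\mathcal S(\mathbb R^d)$; 2. (P2) for all $\varepsilon>0$ and $N\ge0$ there are $A_{N,\varepsilon},R_{N,\varepsilon}\in[1,\infty)$ such that for all $u\in X^*$ and $\gamma\in(0,1]$ $$\|\mu_{N,\gamma}Vu\|_X\le\varepsilon\|\mu_{N,\gamma}u\|_{X^*}+A_{N,\varepsilon}\|u\,1_{\{|x|\le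 R_{N,\varepsilon}\}}\|_{L^2};$$ 3. (P3) there are an integer $J\ge1$ and $A_j,B_j\in\mathcal B(X^*,L^2)$, $1\le j\le J$, with $\langle Vf,g\rangle=\sum_{j=1}^J\langle B_jf,A_jg\rangle$ for all $f,g\in X^*$. *Statement.* Let $q$ be a real number with $$\frac d{2m}\le q\le\frac{d+1}2\qquad\text{and}\qquad q>1,$$ and let $V:\mathbb R^d\to\mathbb R$ be a function in $L_0^{q,\infty}(\mathbb R^d)$. Then every $u\in X^*$ is a function, pointwise multiplication $u\mapsto Vu$ defines a linear operator from $X^*$ to $X$, and this operator is an admissible perturbation of $(-\Delta)^m$. -/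

import Mathlib

open MeasureTheory TemperedDistribution Set
open scoped SchwartzMap ENNReal NNReal ComplexConjugate

noncomputable section

namespace HighOrderSchrodinger

/-- Euclidean space `ℝ^d`. -/
abbrev E (d : ℕ) : Type := EuclideanSpace ℝ (Fin d)

/-! ### Lorentz spaces -/

/-- The distribution function `t ↦ |{x : |f x| > t}|`. -/
def distFun {d : ℕ} (f : E d → ℂ) (t : ℝ) : ℝ≥0∞ := volume {x | t < ‖f x‖}

/-- The quasi-norm of the Lorentz space `L^{p,r}`, for finite `p, r`:
`(r ∫_0^∞ t^{r-1} |{|f| > t}|^{r/p} dt)^{1/r}`, which is the same number as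
`((r/p) ∫_0^∞ (s^{1/p} f^*(s))^r ds/s)^{1/r}`. -/
def lorentzNorm {d : ℕ} (p r : ℝ) (f : E d → ℂ) : ℝ≥0∞ :=
  (ENNReal.ofReal r *
    ∫⁻ t in Ioi (0 : ℝ), ENNReal.ofReal (t ^ (r - 1)) * distFun f t ^ (r / p)) ^ (1 / r)

/-- The quasi-norm of the weak Lebesgue space `L^{q,∞}`: `sup_{t > 0} t |{|f| > t}|^{1/q}`. -/
def weakNorm {d : ℕ} (q : ℝ) (f : E d → ℂ) : ℝ≥0∞ :=
  ⨆ (t : ℝ) (_ : 0 < t), ENNReal.ofReal t * distFun f t ^ (1 / q)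

/-- `f ∈ L_0^{q,∞}`: `f` is a limit of functions in `C_c^∞` with respect to the
`L^{q,∞}` quasi-norm. -/
def MemWeakZero {d : ℕ} (q : ℝ) (f : E d → ℂ) : Prop :=
  AEStronglyMeasurable f volume ∧
    ∀ ε : ℝ≥0∞, 0 < ε → ∃ φ : E d → ℂ, ContDiff ℝ (⊤ : ℕ∞) φ ∧ HasCompactSupport φ ∧
      weakNorm q (fun x ↦ f x - φ x) < ε

/-! ### The Agmon–Hörmander spaces -/

/-- The dyadic shells: `D_0 = {|x| ≤ 1}` and `D_j = {2^{j-1} ≤ |x| ≤ 2^j}` for `j ≥ 1`. -/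
def shell (d : ℕ) : ℕ → Set (E d)
  | 0 => {x | ‖x‖ ≤ 1}
  | j + 1 => {x | (2 : ℝ) ^ j ≤ ‖x‖ ∧ ‖x‖ ≤ (2 : ℝ) ^ (j + 1)}

/-- The norm of `B`. -/
def normB {d : ℕ} (f : E d → ℂ) : ℝ≥0∞ :=
  ∑' j : ℕ, (2 : ℝ≥0∞) ^ ((j : ℝ) / 2) * eLpNorm f 2 (volume.restrict (shell d j))

/-- The norm of `B^*`. -/
def normBStar {d : ℕ} (f : E d → ℂ) : ℝ≥0∞ :=
  ⨆ j : ℕ, (2 : ℝ≥0∞) ^ (-((j : ℝ) / 2)) * eLpNorm f 2 (volume.restrict (shell d j))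

/-! ### Functions as tempered distributions -/

/-- The tempered distribution `T` is the function `f`: `T φ = ∫ φ f` for all Schwartz `φ`,
with absolutely convergent integrals. -/
def IsFun {d : ℕ} (T : 𝓢'(E d, ℂ)) (f : E d → ℂ) : Prop :=
  AEStronglyMeasurable f volume ∧
    ∀ φ : 𝓢(E d, ℂ), Integrable (fun x ↦ φ x * f x) ∧ T φ = ∫ x, φ x * f x

/-- The value of a function (quasi-)norm `N` on a tempered distribution: `N f` if the
distribution is a function `f` (which is then unique up to null sets), and `∞` otherwise. -/
def distNorm {d : ℕ} (N : (E d → ℂ) → ℝ≥0∞) (T : 𝓢'(E d, ℂ)) : ℝ≥0∞ :=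
  ⨅ (f : E d → ℂ) (_ : IsFun T f), N f

/-- The Bessel potential `S_α = (1 - Δ)^{α/2}`. With Mathlib's convention
`𝓕 f ξ = ∫ e^{-2 π i x·ξ} f x dx` its symbol is `(1 + |2 π ξ|²)^{α/2}`. -/
def S {d : ℕ} (α : ℝ) : 𝓢'(E d, ℂ) →L[ℂ] 𝓢'(E d, ℂ) :=
  fourierMultiplierCLM ℂ (fun ξ : E d ↦ (((1 + ‖(2 * Real.pi) • ξ‖ ^ 2) ^ (α / 2) : ℝ) : ℂ))

/-! ### The spaces `X` and `X^*` -/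

/-- The exponent `p_d = (2d+2)/(d+3)`. -/
def pd (d : ℕ) : ℝ := (2 * d + 2) / (d + 3)

/-- The exponent `p_d' = (2d+2)/(d-1)`. -/
def pd' (d : ℕ) : ℝ := (2 * d + 2) / ((d : ℝ) - 1)

/-- `θ_{m,d} = m - d/(d+1)`. -/
def theta (m d : ℕ) : ℝ := m - (d : ℝ) / (d + 1)

/-- The norm of `X = W_{-θ}^{p_d,2} + S_m(B)`. -/
def normX {d : ℕ} (m : ℕ) (T : 𝓢'(E d, ℂ)) : ℝ≥0∞ :=
  ⨅ (T₁ : 𝓢'(E d, ℂ)) (T₂ : 𝓢'(E d, ℂ)) (_ : T = T₁ + T₂),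
    distNorm (lorentzNorm (pd d) 2) (S (-theta m d) T₁) + distNorm normB (S (-(m : ℝ)) T₂)

/-- The norm of `X^* = W_θ^{p_d',2} ∩ S_{-m}(B^*)`. -/
def normXStar {d : ℕ} (m : ℕ) (T : 𝓢'(E d, ℂ)) : ℝ≥0∞ :=
  max (distNorm (lorentzNorm (pd' d) 2) (S (theta m d) T)) (distNorm normBStar (S (m : ℝ) T))

/-! #### Facts showing that `X` and `X^*` are vector spaces -/

lemma isFun_zero {d : ℕ} : IsFun (0 : 𝓢'(E d, ℂ)) 0 :=
  ⟨aestronglyMeasurable_zero, fun φ ↦ by simp⟩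

lemma IsFun.add {d : ℕ} {T U : 𝓢'(E d, ℂ)} {f g : E d → ℂ} (hf : IsFun T f) (hg : IsFun U g) :
    IsFun (T + U) (f + g) := by
  refine ⟨hf.1.add hg.1, fun φ ↦ ?_⟩
  have h1 := hf.2 φ
  have h2 := hg.2 φ
  have e : (fun x ↦ φ x * (f + g) x) = (fun x ↦ φ x * f x) + fun x ↦ φ x * g x := by
    ext x; simp [mul_add]
  refine ⟨by rw [e]; exact h1.1.add h2.1, ?_⟩
  rw [e]
  rw [integral_add' h1.1 h2.1, ← h1.2, ← h2.2]
  rfl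

lemma IsFun.smul {d : ℕ} {T : 𝓢'(E d, ℂ)} {f : E d → ℂ} (c : ℂ) (hf : IsFun T f) :
    IsFun (c • T) (c • f) := by
  refine ⟨hf.1.const_smul c, fun φ ↦ ?_⟩
  have h1 := hf.2 φ
  have e : (fun x ↦ φ x * (c • f) x) = fun x ↦ c * (φ x * f x) := by
    ext x; simp; ring
  refine ⟨by rw [e]; exact h1.1.const_mul c, ?_⟩
  rw [e, integral_const_mul, ← h1.2]
  rfl

lemma distNorm_lt_top {d : ℕ} {N : (E d → ℂ) → ℝ≥0∞} {T : 𝓢'(E d, ℂ)} :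
    distNorm N T < ∞ ↔ ∃ f, IsFun T f ∧ N f < ∞ := by
  simp [distNorm, iInf_lt_iff]

lemma distNorm_zero_lt {d : ℕ} {N : (E d → ℂ) → ℝ≥0∞} (hN : N 0 < ∞) :
    distNorm N (0 : 𝓢'(E d, ℂ)) < ∞ := distNorm_lt_top.2 ⟨0, isFun_zero, hN⟩

lemma distNorm_add_lt {d : ℕ} {N : (E d → ℂ) → ℝ≥0∞} {T U : 𝓢'(E d, ℂ)}
    (hN : ∀ f g, AEStronglyMeasurable f volume → AEStronglyMeasurable g volume →
      N f < ∞ → N g < ∞ → N (f + g) < ∞)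
    (hT : distNorm N T < ∞) (hU : distNorm N U < ∞) : distNorm N (T + U) < ∞ := by
  obtain ⟨f, hf, hf'⟩ := distNorm_lt_top.1 hT
  obtain ⟨g, hg, hg'⟩ := distNorm_lt_top.1 hU
  exact distNorm_lt_top.2 ⟨_, hf.add hg, hN f g hf.1 hg.1 hf' hg'⟩

lemma distNorm_smul_lt {d : ℕ} {N : (E d → ℂ) → ℝ≥0∞} {T : 𝓢'(E d, ℂ)} (c : ℂ)
    (hN : ∀ f, N f < ∞ → N (c • f) < ∞)
    (hT : distNorm N T < ∞) : distNorm N (c • T) < ∞ := by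
  obtain ⟨f, hf, hf'⟩ := distNorm_lt_top.1 hT
  exact distNorm_lt_top.2 ⟨_, hf.smul c, hN f hf'⟩

lemma normB_zero {d : ℕ} : normB (0 : E d → ℂ) < ∞ := by
  simp [normB]

lemma normB_add {d : ℕ} (f g : E d → ℂ) (hf : AEStronglyMeasurable f volume)
    (hg : AEStronglyMeasurable g volume) (h1 : normB f < ∞) (h2 : normB g < ∞) :
    normB (f + g) < ∞ := by
  refine lt_of_le_of_lt ?_ (ENNReal.add_lt_top.2 ⟨h1, h2⟩)
  rw [normB, normB, normB, ← ENNReal.tsum_add]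
  refine ENNReal.tsum_le_tsum fun j ↦ ?_
  rw [← mul_add]
  gcongr
  exact eLpNorm_add_le hf.restrict hg.restrict (by norm_num)

lemma normB_smul {d : ℕ} (c : ℂ) (f : E d → ℂ) (h : normB f < ∞) : normB (c • f) < ∞ := by
  have : normB (c • f) = ‖c‖ₑ * normB f := by
    rw [normB, normB, ← ENNReal.tsum_mul_left]
    refine tsum_congr fun j ↦ ?_
    rw [eLpNorm_const_smul]
    ring
  rw [this]
  exact ENNReal.mul_lt_top (by simp) h

lemma normBStar_zero {d : ℕ} : normBStar (0 : E d → ℂ) < ∞ := by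
  simp [normBStar]

lemma normBStar_add {d : ℕ} (f g : E d → ℂ) (hf : AEStronglyMeasurable f volume)
    (hg : AEStronglyMeasurable g volume) (h1 : normBStar f < ∞) (h2 : normBStar g < ∞) :
    normBStar (f + g) < ∞ := by
  refine lt_of_le_of_lt ?_ (ENNReal.add_lt_top.2 ⟨h1, h2⟩)
  refine iSup_le fun j ↦ ?_
  calc _ ≤ (2 : ℝ≥0∞) ^ (-((j : ℝ) / 2)) * (eLpNorm f 2 (volume.restrict (shell d j))
        + eLpNorm g 2 (volume.restrict (shell d j))) := by
          gcongr
          exact eLpNorm_add_le hf.restrict hg.restrict (by norm_num)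
    _ ≤ _ := by
      rw [mul_add]
      exact add_le_add
        (le_iSup (fun j : ℕ ↦ (2 : ℝ≥0∞) ^ (-((j : ℝ) / 2)) *
          eLpNorm f 2 (volume.restrict (shell d j))) j)
        (le_iSup (fun j : ℕ ↦ (2 : ℝ≥0∞) ^ (-((j : ℝ) / 2)) *
          eLpNorm g 2 (volume.restrict (shell d j))) j)

lemma normBStar_smul {d : ℕ} (c : ℂ) (f : E d → ℂ) (h : normBStar f < ∞) :
    normBStar (c • f) < ∞ := by
  refine lt_of_le_of_lt ?_ (ENNReal.mul_lt_top (a := ‖c‖ₑ) (by simp) h)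
  refine iSup_le fun j ↦ ?_
  rw [eLpNorm_const_smul, mul_left_comm]
  gcongr
  exact le_iSup (fun j : ℕ ↦ (2 : ℝ≥0∞) ^ (-((j : ℝ) / 2)) *
          eLpNorm f 2 (volume.restrict (shell d j))) j

lemma distFun_antitone {d : ℕ} (f : E d → ℂ) : Antitone (distFun f) := fun _ _ h ↦
  measure_mono fun _ hx ↦ lt_of_le_of_lt h hx

lemma lorentzNorm_lt_top {d : ℕ} {p r : ℝ} (hr : 0 < r) {f : E d → ℂ} :
    lorentzNorm p r f < ∞ ↔
      ∫⁻ t in Ioi (0 : ℝ), ENNReal.ofReal (t ^ (r - 1)) * distFun f t ^ (r / p) < ∞ := by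
  have h1 : 0 < 1 / r := by positivity
  rw [lorentzNorm, ENNReal.rpow_lt_top_iff_of_pos h1]
  constructor
  · intro h
    refine lt_top_iff_ne_top.2 fun h' ↦ ?_
    rw [h', ENNReal.mul_top (by simpa using hr)] at h
    exact lt_irrefl _ h
  · exact fun h ↦ ENNReal.mul_lt_top (by simp) h

lemma lorentz_scale {d : ℕ} {p r : ℝ} {f : E d → ℂ} (a : ℝ) (ha : 0 < a)
    (h : ∫⁻ t in Ioi (0 : ℝ), ENNReal.ofReal (t ^ (r - 1)) * distFun f t ^ (r / p) < ∞) :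
    ∫⁻ t in Ioi (0 : ℝ), ENNReal.ofReal (t ^ (r - 1)) * distFun f (a * t) ^ (r / p) < ∞ := by
  have him : (fun t : ℝ ↦ a * t) '' Ioi 0 = Ioi 0 := by
    rw [image_mul_left_Ioi ha, mul_zero]
  have key := lintegral_image_eq_lintegral_abs_deriv_mul (s := Ioi (0 : ℝ)) measurableSet_Ioi
    (f := fun t ↦ a * t) (f' := fun _ ↦ a)
    (fun x _ ↦ by simpa using ((hasDerivAt_id x).const_mul a).hasDerivWithinAt)
    (fun x _ y _ hxy ↦ mul_left_cancel₀ ha.ne' hxy)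
    (fun t ↦ ENNReal.ofReal (t ^ (r - 1)) * distFun f t ^ (r / p))
  rw [him] at key
  rw [key] at h
  have e : ∀ t ∈ Ioi (0 : ℝ), ENNReal.ofReal (t ^ (r - 1)) * distFun f (a * t) ^ (r / p) =
      ENNReal.ofReal (a ^ (-r)) * (ENNReal.ofReal |a| *
        (ENNReal.ofReal ((a * t) ^ (r - 1)) * distFun f (a * t) ^ (r / p))) := by
    intro t ht
    rw [← mul_assoc, ← mul_assoc, ← ENNReal.ofReal_mul (by positivity),
      ← ENNReal.ofReal_mul (by positivity), abs_of_pos ha, Real.mul_rpow ha.le (le_of_lt ht)]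
    congr 2
    have : a ^ (-r) * a * a ^ (r - 1) = 1 := by
      nth_rewrite 2 [← Real.rpow_one a]
      rw [← Real.rpow_add ha, ← Real.rpow_add ha]
      simp
    rw [← mul_assoc, this, one_mul]
  rw [setLIntegral_congr_fun measurableSet_Ioi e, lintegral_const_mul' _ _ (by simp)]
  exact ENNReal.mul_lt_top (by simp) h

lemma lorentzNorm_zero {d : ℕ} {p r : ℝ} (hp : 0 < p) (hr : 0 < r) :
    lorentzNorm p r (0 : E d → ℂ) < ∞ := by
  rw [lorentzNorm_lt_top hr]
  have : ∫⁻ t in Ioi (0 : ℝ), ENNReal.ofReal (t ^ (r - 1)) * distFun (0 : E d → ℂ) t ^ (r / p)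
      = ∫⁻ t in Ioi (0 : ℝ), 0 := by
    refine setLIntegral_congr_fun measurableSet_Ioi fun t ht ↦ ?_
    have h0 : distFun (0 : E d → ℂ) t = 0 := by
      have : {x : E d | t < ‖(0 : E d → ℂ) x‖} = ∅ := by
        ext x; simpa using (le_of_lt ht)
      rw [distFun, this, measure_empty]
    simp only [h0]
    rw [ENNReal.zero_rpow_of_pos (by positivity), mul_zero]
  rw [this]
  simp

lemma lorentzNorm_smul {d : ℕ} {p r : ℝ} (hp : 0 < p) (hr : 0 < r) (c : ℂ) (f : E d → ℂ)
    (h : lorentzNorm p r f < ∞) : lorentzNorm p r (c • f) < ∞ := by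
  by_cases hc : c = 0
  · rw [hc, zero_smul]
    exact lorentzNorm_zero hp hr
  have hc' : 0 < ‖c‖ := norm_pos_iff.2 hc
  rw [lorentzNorm_lt_top hr] at h ⊢
  convert! lorentz_scale ‖c‖⁻¹ (by positivity) h using 4 with t
  simp only [distFun]
  congr 2
  ext x
  simp only [Pi.smul_apply, smul_eq_mul, norm_mul, mem_ofPred_eq]
  rw [inv_mul_lt_iff₀ hc']

lemma distFun_add {d : ℕ} (f g : E d → ℂ) (t : ℝ) :
    distFun (f + g) t ≤ distFun f (2⁻¹ * t) + distFun g (2⁻¹ * t) := by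
  refine (measure_mono fun x hx ↦ ?_).trans (measure_union_le _ _)
  by_contra hcon
  simp only [mem_union, mem_ofPred_eq, not_or, not_lt] at hcon hx
  have := norm_add_le (f x) (g x)
  simp only [Pi.add_apply] at hx
  linarith

lemma rpow_add_le_two {s : ℝ} (hs : 0 ≤ s) (a b : ℝ≥0∞) :
    (a + b) ^ s ≤ (2 : ℝ≥0∞) ^ s * (a ^ s + b ^ s) := by
  calc (a + b) ^ s ≤ (2 * max a b) ^ s := by
        gcongr
        rw [two_mul]
        exact add_le_add (le_max_left _ _) (le_max_right _ _)
    _ = 2 ^ s * (max a b) ^ s := ENNReal.mul_rpow_of_nonneg _ _ hs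
    _ ≤ _ := by
        gcongr
        rcases le_total a b with hab | hab
        · rw [max_eq_right hab]; exact le_add_self
        · rw [max_eq_left hab]; exact le_self_add

lemma lorentzNorm_add {d : ℕ} {p r : ℝ} (hp : 0 < p) (hr : 0 < r) (f g : E d → ℂ)
    (h1 : lorentzNorm p r f < ∞) (h2 : lorentzNorm p r g < ∞) :
    lorentzNorm p r (f + g) < ∞ := by
  rw [lorentzNorm_lt_top hr] at h1 h2 ⊢
  have h1' := lorentz_scale 2⁻¹ (by norm_num) h1
  have h2' := lorentz_scale 2⁻¹ (by norm_num) h2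
  have hs : 0 ≤ r / p := by positivity
  refine lt_of_le_of_lt (b := (2 : ℝ≥0∞) ^ (r / p) *
    ((∫⁻ t in Ioi (0 : ℝ), ENNReal.ofReal (t ^ (r - 1)) * distFun f (2⁻¹ * t) ^ (r / p)) +
      ∫⁻ t in Ioi (0 : ℝ), ENNReal.ofReal (t ^ (r - 1)) * distFun g (2⁻¹ * t) ^ (r / p))) ?_ ?_
  · have hm : Measurable fun t : ℝ ↦
        ENNReal.ofReal (t ^ (r - 1)) * distFun f (2⁻¹ * t) ^ (r / p) := by
      have : Measurable (distFun f) := (distFun_antitone f).measurable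
      fun_prop
    have htop : (2 : ℝ≥0∞) ^ (r / p) ≠ ∞ := ENNReal.rpow_ne_top_of_nonneg hs (by simp)
    rw [← lintegral_add_left hm, ← lintegral_const_mul' _ _ htop]
    refine lintegral_mono fun t ↦ ?_
    calc _ ≤ ENNReal.ofReal (t ^ (r - 1)) *
          ((2 : ℝ≥0∞) ^ (r / p) * (distFun f (2⁻¹ * t) ^ (r / p) +
            distFun g (2⁻¹ * t) ^ (r / p))) := by
          gcongr
          refine le_trans ?_ (rpow_add_le_two hs _ _)
          gcongr
          exact distFun_add f g t
      _ = _ := by ring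
  · refine ENNReal.mul_lt_top (ENNReal.rpow_lt_top_of_nonneg hs (by simp)) ?_
    exact ENNReal.add_lt_top.2 ⟨h1', h2'⟩

lemma pd_pos (d : ℕ) : 0 < pd d := by
  unfold pd; positivity

lemma pd'_pos {d : ℕ} (hd : 2 ≤ d) : 0 < pd' d := by
  have : (2 : ℝ) ≤ d := by exact_mod_cast hd
  unfold pd'
  apply div_pos <;> linarith

lemma normX_lt_top {d m : ℕ} {T : 𝓢'(E d, ℂ)} : normX m T < ∞ ↔
    ∃ T₁ T₂, T = T₁ + T₂ ∧ distNorm (lorentzNorm (pd d) 2) (S (-theta m d) T₁) < ∞ ∧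
      distNorm normB (S (-(m : ℝ)) T₂) < ∞ := by
  simp only [normX, iInf_lt_iff, ENNReal.add_lt_top, exists_prop]

/-- The space `X = W_{-θ}^{p_d,2} + S_m(B)`: the tempered distributions of finite `X`-norm. -/
def X (d m : ℕ) : Submodule ℂ 𝓢'(E d, ℂ) where
  carrier := {T | normX m T < ∞}
  zero_mem' := by
    refine normX_lt_top.2 ⟨0, 0, by simp, ?_, ?_⟩
    · rw [map_zero]; exact distNorm_zero_lt (lorentzNorm_zero (pd_pos d) two_pos)
    · rw [map_zero]; exact distNorm_zero_lt normB_zero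
  add_mem' := by
    intro T U hT hU
    obtain ⟨T₁, T₂, rfl, h1, h2⟩ := normX_lt_top.1 hT
    obtain ⟨U₁, U₂, rfl, h3, h4⟩ := normX_lt_top.1 hU
    refine normX_lt_top.2 ⟨T₁ + U₁, T₂ + U₂, by abel, ?_, ?_⟩
    · rw [map_add]
      exact distNorm_add_lt (fun f g _ _ ↦ lorentzNorm_add (pd_pos d) two_pos f g) h1 h3
    · rw [map_add]
      exact distNorm_add_lt normB_add h2 h4
  smul_mem' := by
    intro c T hT
    obtain ⟨T₁, T₂, rfl, h1, h2⟩ := normX_lt_top.1 hT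
    refine normX_lt_top.2 ⟨c • T₁, c • T₂, by simp, ?_, ?_⟩
    · rw [map_smul]
      exact distNorm_smul_lt c (lorentzNorm_smul (pd_pos d) two_pos c) h1
    · rw [map_smul]
      exact distNorm_smul_lt c (normB_smul c) h2

lemma normXStar_lt_top {d m : ℕ} {T : 𝓢'(E d, ℂ)} : normXStar m T < ∞ ↔
    distNorm (lorentzNorm (pd' d) 2) (S (theta m d) T) < ∞ ∧
      distNorm normBStar (S (m : ℝ) T) < ∞ := max_lt_iff

/-- The space `X^* = W_θ^{p_d',2} ∩ S_{-m}(B^*)`: the tempered distributions of finite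
`X^*`-norm. -/
def XStar (d m : ℕ) (hd : 2 ≤ d) : Submodule ℂ 𝓢'(E d, ℂ) where
  carrier := {T | normXStar m T < ∞}
  zero_mem' := by
    refine normXStar_lt_top.2 ⟨?_, ?_⟩
    · rw [map_zero]; exact distNorm_zero_lt (lorentzNorm_zero (pd'_pos hd) two_pos)
    · rw [map_zero]; exact distNorm_zero_lt normBStar_zero
  add_mem' := by
    intro T U hT hU
    have hT' := normXStar_lt_top.1 hT
    have hU' := normXStar_lt_top.1 hU
    refine normXStar_lt_top.2 ⟨?_, ?_⟩
    · rw [map_add]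
      exact distNorm_add_lt (fun f g _ _ ↦ lorentzNorm_add (pd'_pos hd) two_pos f g) hT'.1 hU'.1
    · rw [map_add]
      exact distNorm_add_lt normBStar_add hT'.2 hU'.2
  smul_mem' := by
    intro c T hT
    have hT' := normXStar_lt_top.1 hT
    refine normXStar_lt_top.2 ⟨?_, ?_⟩
    · rw [map_smul]
      exact distNorm_smul_lt c (lorentzNorm_smul (pd'_pos hd) two_pos c) hT'.1
    · rw [map_smul]
      exact distNorm_smul_lt c (normBStar_smul c) hT'.2

lemma isFun_schwartz {d : ℕ} (φ : 𝓢(E d, ℂ)) : IsFun (φ : 𝓢'(E d, ℂ)) φ := by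
  refine ⟨φ.continuous.aestronglyMeasurable, fun ψ ↦ ⟨?_, ?_⟩⟩
  · obtain ⟨C, hC⟩ := φ.decay 0 0
    refine ψ.integrable.mul_bdd (c := C) φ.continuous.aestronglyMeasurable ?_
    filter_upwards with x
    simpa using hC.2 x
  · rw [SchwartzMap.coe_apply]
    rfl

lemma lorentzNorm_schwartz {d : ℕ} {p : ℝ} (hp : 2 < p) (φ : 𝓢(E d, ℂ)) :
    lorentzNorm p 2 φ < ∞ := by
  rw [lorentzNorm_lt_top two_pos]
  obtain ⟨C, hC0, hC⟩ := φ.decay 0 0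
  have hC' : ∀ x, ‖φ x‖ ≤ C := fun x ↦ by simpa using hC x
  set I : ℝ≥0∞ := ∫⁻ x, ‖φ x‖ₑ with hI
  have hIt : I < ∞ := φ.integrable.2
  have hs : 0 < 2 / p := by positivity
  have hs1 : 0 < 1 - 2 / p := by rw [sub_pos, div_lt_one (by linarith)]; exact hp
  have hbound : ∀ t ∈ Ioi (0 : ℝ),
      ENNReal.ofReal (t ^ ((2 : ℝ) - 1)) * distFun φ t ^ (2 / p) ≤
        (Ioo (0 : ℝ) C).indicator (fun _ ↦ ENNReal.ofReal (C ^ (1 - 2 / p)) * I ^ (2 / p)) t := by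
    intro t ht
    have ht : 0 < t := ht
    by_cases htC : t < C
    · rw [indicator_of_mem (show t ∈ Ioo 0 C from ⟨ht, htC⟩)]
      have hd1 : ENNReal.ofReal t * distFun φ t ≤ I := by
        refine le_trans ?_ (mul_meas_ge_le_lintegral₀
          (φ.continuous.enorm.aemeasurable (μ := volume)) (ENNReal.ofReal t))
        gcongr
        refine measure_mono fun x hx ↦ ?_
        rw [mem_ofPred_eq] at hx ⊢
        rw [← ofReal_norm]
        exact ENNReal.ofReal_le_ofReal hx.le
      calc _ = ENNReal.ofReal (t ^ (1 - 2 / p)) *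
            (ENNReal.ofReal t * distFun φ t) ^ (2 / p) := by
            rw [ENNReal.mul_rpow_of_nonneg _ _ hs.le, ENNReal.ofReal_rpow_of_pos ht, ← mul_assoc,
              ← ENNReal.ofReal_mul (by positivity), ← Real.rpow_add ht]
            congr 3
            ring
        _ ≤ _ := by gcongr
    · have h0 : distFun φ t = 0 := by
        have : {x : E d | t < ‖φ x‖} = ∅ := by
          ext x
          simpa using (hC' x).trans (not_lt.1 htC)
        rw [distFun, this, measure_empty]
      rw [h0, ENNReal.zero_rpow_of_pos hs, mul_zero]
      exact zero_le
  refine lt_of_le_of_lt (setLIntegral_mono' measurableSet_Ioi hbound) ?_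
  refine lt_of_le_of_lt (setLIntegral_le_lintegral _ _) ?_
  rw [lintegral_indicator_const measurableSet_Ioo, Real.volume_Ioo]
  exact ENNReal.mul_lt_top (ENNReal.mul_lt_top (by simp)
    (ENNReal.rpow_lt_top_of_nonneg hs.le hIt.ne)) (by simp)

lemma normBStar_schwartz {d : ℕ} (φ : 𝓢(E d, ℂ)) : normBStar φ < ∞ := by
  refine lt_of_le_of_lt (b := eLpNorm φ 2 volume) ?_ (φ.memLp 2 volume).2
  refine iSup_le fun j ↦ ?_
  calc _ ≤ 1 * eLpNorm φ 2 volume := by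
        gcongr
        · rw [ENNReal.rpow_neg, ENNReal.inv_le_one]
          calc (1 : ℝ≥0∞) = 1 ^ ((j : ℝ) / 2) := (ENNReal.one_rpow _).symm
            _ ≤ 2 ^ ((j : ℝ) / 2) := ENNReal.rpow_le_rpow (by norm_num) (by positivity)
        · exact Measure.restrict_le_self
    _ = _ := one_mul _

lemma two_lt_pd' {d : ℕ} (hd : 2 ≤ d) : 2 < pd' d := by
  have : (2 : ℝ) ≤ d := by exact_mod_cast hd
  unfold pd'
  rw [lt_div_iff₀ (by linarith)]
  linarith

lemma S_symbol_hasTemperateGrowth {d : ℕ} (α : ℝ) : Function.HasTemperateGrowth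
    (fun ξ : E d ↦ (((1 + ‖(2 * Real.pi) • ξ‖ ^ 2) ^ (α / 2) : ℝ) : ℂ)) := by
  have h : Function.HasTemperateGrowth (fun ξ : E d ↦ (2 * Real.pi) • ξ) :=
    ((2 * Real.pi) • ContinuousLinearMap.id ℝ (E d)).hasTemperateGrowth
  have h2 := (Function.hasTemperateGrowth_one_add_norm_sq_rpow (E d) (α / 2)).comp h
  exact Function.Complex.hasTemperateGrowth_ofReal.comp h2

lemma schwartz_mem_XStar {d : ℕ} (m : ℕ) (hd : 2 ≤ d) (φ : 𝓢(E d, ℂ)) :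
    (φ : 𝓢'(E d, ℂ)) ∈ XStar d m hd := by
  refine normXStar_lt_top.2 ⟨?_, ?_⟩ <;>
  rw [S, fourierMultiplierCLM_toTemperedDistributionCLM_eq (S_symbol_hasTemperateGrowth _)]
  · exact distNorm_lt_top.2 ⟨_, isFun_schwartz _, lorentzNorm_schwartz (two_lt_pd' hd) _⟩
  · exact distNorm_lt_top.2 ⟨_, isFun_schwartz _, normBStar_schwartz _⟩

/-- A Schwartz function as an element of `X^*`. -/
def ofSchwartz {d : ℕ} (m : ℕ) (hd : 2 ≤ d) (φ : 𝓢(E d, ℂ)) : XStar d m hd :=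
  ⟨φ, schwartz_mem_XStar m hd φ⟩

/-- `⟨T, g⟩ = c` for the (sesquilinear) duality of `T ∈ X` and `g ∈ X^*`: if
`T = S_θ F₁ + S_m F₂` with `F₁ ∈ L^{p_d,2}` and `F₂ ∈ B`, then
`c = ∫ F₁ conj(S_θ g) + ∫ F₂ conj(S_m g)`; such decompositions exist because `T ∈ X`, and every
one of them is required to give `c`. -/
def IsPairing {d m : ℕ} {hd : 2 ≤ d} (T : X d m) (g : XStar d m hd) (c : ℂ) : Prop :=
  ∀ (T₁ T₂ : 𝓢'(E d, ℂ)) (F₁ F₂ G₁ G₂ : E d → ℂ), (T : 𝓢'(E d, ℂ)) = T₁ + T₂ →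
    IsFun (S (-theta m d) T₁) F₁ → lorentzNorm (pd d) 2 F₁ < ∞ →
    IsFun (S (-(m : ℝ)) T₂) F₂ → normB F₂ < ∞ →
    IsFun (S (theta m d) (g : 𝓢'(E d, ℂ))) G₁ → IsFun (S (m : ℝ) (g : 𝓢'(E d, ℂ))) G₂ →
    (∫ x, F₁ x * conj (G₁ x)) + (∫ x, F₂ x * conj (G₂ x)) = c

/-! ### Admissible perturbations -/

/-- The weight `μ_{N,γ}(x) = (1 + |x|²)^N / (1 + γ |x|²)^N`. -/
def mu {d : ℕ} (N γ : ℝ) (x : E d) : ℝ := (1 + ‖x‖ ^ 2) ^ N / (1 + γ * ‖x‖ ^ 2) ^ N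

/-- The weight is a legitimate multiplier of tempered distributions. -/
lemma mu_hasTemperateGrowth {d : ℕ} (N : ℝ) {γ : ℝ} (hγ : 0 < γ) :
    Function.HasTemperateGrowth (fun x : E d ↦ (mu N γ x : ℂ)) := by
  have h : Function.HasTemperateGrowth (fun x : E d ↦ Real.sqrt γ • x) :=
    (Real.sqrt γ • ContinuousLinearMap.id ℝ (E d)).hasTemperateGrowth
  have h1 := Function.hasTemperateGrowth_one_add_norm_sq_rpow (E d) N
  have h2 := (Function.hasTemperateGrowth_one_add_norm_sq_rpow (E d) (-N)).comp h
  have e : (fun x : E d ↦ mu N γ x) = fun x : E d ↦ (1 + ‖x‖ ^ 2) ^ N *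
      (1 + ‖Real.sqrt γ • x‖ ^ 2) ^ (-N) := by
    ext x
    simp only [mu, norm_smul, Real.norm_eq_abs, mul_pow, sq_abs, Real.sq_sqrt hγ.le]
    rw [Real.rpow_neg (by positivity), div_eq_mul_inv]
  have h3 : Function.HasTemperateGrowth (fun x : E d ↦ mu N γ x) := by
    rw [e]
    exact h1.mul h2
  exact Function.Complex.hasTemperateGrowth_ofReal.comp h3

/-- Multiplication of a tempered distribution by the weight `μ_{N,γ}`. -/
def mulMu {d : ℕ} (N γ : ℝ) : 𝓢'(E d, ℂ) →L[ℂ] 𝓢'(E d, ℂ) :=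
  smulLeftCLM ℂ (fun x : E d ↦ (mu N γ x : ℂ))

/-- The complex Hilbert space `L²(ℝ^d)`. -/
abbrev L2 (d : ℕ) : Type := Lp ℂ 2 (volume : Measure (E d))

/-- An operator `V : X^* → X` is an admissible perturbation of `(-Δ)^m`. -/
structure IsAdmissible {d m : ℕ} {hd : 2 ≤ d} (V : XStar d m hd →ₗ[ℂ] X d m) : Prop where
  /-- `V ∈ 𝓑(X^*, X)` -/
  bounded : ∃ C : ℝ≥0, ∀ u, normX m (V u : 𝓢'(E d, ℂ)) ≤ C * normXStar m (u : 𝓢'(E d, ℂ))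
  /-- `⟨V φ, ψ⟩ = ⟨φ, V ψ⟩` on Schwartz functions, where `⟨φ, V ψ⟩` is the complex conjugate
  of `⟨V ψ, φ⟩` -/
  symmetric : ∀ φ ψ : 𝓢(E d, ℂ), ∃ c : ℂ,
    IsPairing (V (ofSchwartz m hd φ)) (ofSchwartz m hd ψ) c ∧
    IsPairing (V (ofSchwartz m hd ψ)) (ofSchwartz m hd φ) (conj c)
  /-- `‖μ_{N,γ} V u‖_X ≤ ε ‖μ_{N,γ} u‖_{X^*} + A ‖u 1_{|x| ≤ R}‖_{L²}` -/
  weighted : ∀ ε N : ℝ, 0 < ε → 0 ≤ N → ∃ A R : ℝ, 1 ≤ A ∧ 1 ≤ R ∧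
    ∀ (u : XStar d m hd) (γ : ℝ), 0 < γ → γ ≤ 1 →
      normX m (mulMu N γ (V u : 𝓢'(E d, ℂ))) ≤
        ENNReal.ofReal ε * normXStar m (mulMu N γ (u : 𝓢'(E d, ℂ))) +
        ENNReal.ofReal A *
          distNorm (fun f ↦ eLpNorm f 2 (volume.restrict {x | ‖x‖ ≤ R})) (u : 𝓢'(E d, ℂ))
  /-- `⟨V f, g⟩ = ∑_j ⟨B_j f, A_j g⟩` with bounded operators `A_j, B_j : X^* → L²`; the inner
  product of Mathlib is linear in its second argument -/
  factorization : ∃ (J : ℕ) (A B : Fin J → XStar d m hd →ₗ[ℂ] L2 d), 1 ≤ J ∧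
    (∃ C : ℝ≥0, ∀ j u, ‖A j u‖ₑ ≤ C * normXStar m (u : 𝓢'(E d, ℂ)) ∧
      ‖B j u‖ₑ ≤ C * normXStar m (u : 𝓢'(E d, ℂ))) ∧
    ∀ f g : XStar d m hd, IsPairing (V f) g (∑ j, inner ℂ (A j g) (B j f))

/-- A potential `V` (a real function on `ℝ^d`) is an admissible perturbation of `(-Δ)^m`: every
`u ∈ X^*` is a function, `u ↦ V u` (pointwise multiplication) is an operator from `X^*` to `X`,
and this operator is admissible. -/
def IsAdmissiblePotential {d : ℕ} (m : ℕ) (hd : 2 ≤ d) (V : E d → ℝ) : Prop :=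
  ∃ M : XStar d m hd →ₗ[ℂ] X d m,
    (∀ u : XStar d m hd, ∃ f : E d → ℂ, IsFun (u : 𝓢'(E d, ℂ)) f ∧
      IsFun (M u : 𝓢'(E d, ℂ)) (fun x ↦ (V x : ℂ) * f x)) ∧
    IsAdmissible M

end HighOrderSchrodinger

end

/-! Put c = 1/(2q), so that V lies in L^{1/(2c),∞}, and label Lorentz spaces by reciprocal
exponents: up to a constant, `lor volume a` is the square of the L^{1/a,2} quasi-norm. The
hypotheses on q become 1/(d+1) ≤ c ≤ m/d and c < 1/2 (`Exponents`), and boundedness is a count of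
exponents. An element u of X^* is S_{-θ}G with G in L^{p_d',2} and 1/p_d' = 1/2 - 1/(d+1).
Fractional integration with gain κ = c - 1/(d+1), which is allowed since 0 ≤ κ ≤ θ/d, puts u at the
exponent 1/2 - c > 0 (`exists_fun_of_normXStar`). Multiplication by V adds 2c (`lor_mul_le`). A
second application of S_{-θ} with the same gain turns 1/2 + c into 1/2 + 1/(d+1) = 1/p_d. So Vu
already lies in the summand W_{-θ}^{p_d,2} of X (`exists_normX_le`).

The fractional integration rests on a probabilistic form of the Bessel kernel: S_{-α} is convolution
with a Gamma mixture ν of Gaussians, and ν(A) ≤ C|A|^κ (`besselMeasure_le_rpow`). No pointwise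
kernel estimate is needed. The bound on sets gives a rearrangement inequality for the convolution
(`rearr_conv_le`), and a Hardy inequality turns it into a Lorentz bound (`lor_conv_le`).

For (P2), V is split as (V - φ) + φ, where φ is bounded with bounded support and V - φ is small in
L^{q,∞}; this is where the closure of C_c^∞ enters. The first term acts on μu with small norm. The
second sees only u on a ball, where μ is bounded uniformly in γ, and it maps L² into the exponent
1/2 + c (`weighted_of_approx`). For (P3), V is written as a product of two functions of modulus
|V|^{1/2}. Each lies in L^{1/c,∞}, hence maps the exponent 1/2 - c to 1/2, that is, into L²
(`exists_factor`).

The pairing has to be the integral of Vf times the conjugate of g for every decomposition of Vf in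
X, including those with a part in S_m(B). This reduces to ∫ H conj(G₁) = ∫ S_{-β}H conj(S_β G₁) with
β = d/(d+1), where the left side converges by Lorentz duality and the right side by the duality of B
and B^*. Both sides are values at 0 of correlation functions that are continuous there and have
equal averages against bumps (`integral_mul_conj_eq`, `isPairing_of_isFun`). -/

namespace HighOrderSchrodinger

/-! ### Decreasing rearrangements -/

section Rearrangement

variable {α : Type*} [MeasurableSpace α] {μ : Measure α}

/-- The decreasing rearrangement of a nonnegative function. -/
noncomputable def rearr (μ : Measure α) (f : α → ℝ≥0∞) (τ : ℝ≥0∞) : ℝ≥0∞ :=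
  sInf {s | μ {x | s < f x} ≤ τ}

/-- The infimum defining `rearr` is attained: along levels decreasing strictly to it the superlevel
sets increase to the one in question, and measures are continuous along increasing unions. No
measurability of `f` is needed. -/
lemma measure_rearr_lt_le (f : α → ℝ≥0∞) (τ : ℝ≥0∞) : μ {x | rearr μ f τ < f x} ≤ τ := by
  by_cases h : rearr μ f τ = ∞
  · simp [h]
  obtain ⟨u, hu, hlt, hlim⟩ := exists_seq_strictAnti_tendsto' (lt_top_iff_ne_top.2 h)
  have e : {x | rearr μ f τ < f x} = ⋃ n, {x | u n < f x} := by
    ext x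
    simp only [mem_ofPred_eq, mem_iUnion]
    constructor
    · intro hx
      exact ((hlim.eventually (gt_mem_nhds hx))).exists
    · rintro ⟨n, hn⟩
      exact (hlt n).1.trans hn
  rw [e]
  have hm : Monotone fun n ↦ {x | u n < f x} := by
    intro n k hnk x hx
    exact lt_of_le_of_lt (hu.antitone hnk) hx
  rw [hm.measure_iUnion]
  refine iSup_le fun n ↦ ?_
  obtain ⟨s, hs, hs'⟩ := sInf_lt_iff.1 (hlt n).1
  refine le_trans (measure_mono fun x hx ↦ ?_) hs
  exact hs'.trans hx

/-- The Galois connection between rearrangement and distribution function, from which the properties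
of `rearr` are read off. -/
lemma lt_rearr_iff {f : α → ℝ≥0∞} {s τ : ℝ≥0∞} : s < rearr μ f τ ↔ τ < μ {x | s < f x} := by
  constructor
  · intro h
    by_contra hcon
    exact absurd (csInf_le' (show s ∈ {s | μ {x | s < f x} ≤ τ} from not_lt.1 hcon)) (not_le.2 h)
  · intro h
    by_contra hcon
    refine absurd h (not_lt.2 ((measure_mono fun x hx ↦ ?_).trans (measure_rearr_lt_le f τ)))
    exact lt_of_le_of_lt (not_lt.1 hcon) hx

lemma rearr_le_iff {f : α → ℝ≥0∞} {s τ : ℝ≥0∞} : rearr μ f τ ≤ s ↔ μ {x | s < f x} ≤ τ := by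
  rw [← not_lt, ← not_lt, lt_rearr_iff]

lemma rearr_antitone (f : α → ℝ≥0∞) : Antitone (rearr μ f) := fun _ _ h ↦
  rearr_le_iff.2 ((measure_rearr_lt_le f _).trans h)

lemma rearr_mono {f g : α → ℝ≥0∞} (h : f ≤ᵐ[μ] g) (τ : ℝ≥0∞) : rearr μ f τ ≤ rearr μ g τ := by
  refine rearr_le_iff.2 (le_trans ?_ (measure_rearr_lt_le (μ := μ) g τ))
  refine measure_mono_ae ?_
  filter_upwards [h] with x hx hx'
  exact lt_of_lt_of_le hx' hx

lemma rearr_congr {f g : α → ℝ≥0∞} (h : f =ᵐ[μ] g) : rearr μ f = rearr μ g :=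
  funext fun τ ↦ le_antisymm (rearr_mono h.le τ) (rearr_mono h.symm.le τ)

/-- Where a sum exceeds a + b, one of the summands exceeds its share, so the exceptional sets of
measure σ and τ add up. The product version below has the same proof. -/
lemma rearr_add_le (f g : α → ℝ≥0∞) (σ τ : ℝ≥0∞) :
    rearr μ (f + g) (σ + τ) ≤ rearr μ f σ + rearr μ g τ := by
  refine rearr_le_iff.2 ?_
  refine le_trans (le_trans (measure_mono fun x hx ↦ ?_) (measure_union_le _ _))
    (add_le_add (measure_rearr_lt_le f σ) (measure_rearr_lt_le g τ))
  by_contra hcon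
  simp only [mem_union, mem_ofPred_eq, not_or, not_lt] at hcon hx
  exact absurd hx (not_lt.2 (add_le_add hcon.1 hcon.2))

lemma rearr_mul_le (f g : α → ℝ≥0∞) (σ τ : ℝ≥0∞) :
    rearr μ (f * g) (σ + τ) ≤ rearr μ f σ * rearr μ g τ := by
  refine rearr_le_iff.2 ?_
  refine le_trans (le_trans (measure_mono fun x hx ↦ ?_) (measure_union_le _ _))
    (add_le_add (measure_rearr_lt_le f σ) (measure_rearr_lt_le g τ))
  by_contra hcon
  simp only [mem_union, mem_ofPred_eq, not_or, not_lt] at hcon hx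
  exact absurd hx (not_lt.2 (mul_le_mul' hcon.1 hcon.2))

lemma rearr_rpow {c : ℝ} (hc : 0 < c) (f : α → ℝ≥0∞) (τ : ℝ≥0∞) :
    rearr μ (fun x ↦ f x ^ c) τ = rearr μ f τ ^ c := by
  refine eq_of_forall_lt_iff fun s ↦ ?_
  rw [lt_rearr_iff, ← ENNReal.rpow_inv_lt_iff hc, lt_rearr_iff]
  simp_rw [ENNReal.rpow_inv_lt_iff hc]

lemma rearr_le_of_forall_le {f : α → ℝ≥0∞} {M : ℝ≥0∞} (h : ∀ x, f x ≤ M) (τ : ℝ≥0∞) :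
    rearr μ f τ ≤ M := by
  refine rearr_le_iff.2 ?_
  have : {x | M < f x} = ∅ := by
    ext x; simpa using h x
  simp [this]

/-- Markov's inequality at each level below the rearrangement. -/
lemma mul_rearr_le_lintegral {f : α → ℝ≥0∞} (hf : AEMeasurable f μ) (τ : ℝ≥0∞) :
    τ * rearr μ f τ ≤ ∫⁻ x, f x ∂μ := by
  refine ENNReal.mul_le_of_forall_lt fun a ha b hb ↦ ?_
  have h := lt_rearr_iff.1 hb
  calc a * b ≤ b * μ {x | b ≤ f x} := by
        rw [mul_comm]
        gcongr
        exact (ha.trans h).le.trans (measure_mono fun x (hx : b < f x) ↦ hx.le)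
    _ ≤ _ := mul_meas_ge_le_lintegral₀ hf b

lemma measurable_rearr_ofReal (f : α → ℝ≥0∞) :
    Measurable fun τ : ℝ ↦ rearr μ f (ENNReal.ofReal τ) :=
  (rearr_antitone f).measurable.comp ENNReal.measurable_ofReal

/-! ### Layer cake formulas -/

/-- Layer cake for a single number, with `A = ∞` included; the layer cake formulas for functions
follow by Tonelli. -/
lemma lintegral_rpow_lt {c : ℝ} (hc : 0 < c) (A : ℝ≥0∞) :
    ENNReal.ofReal c * ∫⁻ t in Ioi (0 : ℝ),
      {t : ℝ | ENNReal.ofReal t < A}.indicator (fun t ↦ ENNReal.ofReal (t ^ (c - 1))) t =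
        A ^ c := by
  have key : ∀ B : ℝ, 0 ≤ B → ENNReal.ofReal c * ∫⁻ t in Ioc (0 : ℝ) B,
      ENNReal.ofReal (t ^ (c - 1)) = ENNReal.ofReal B ^ c := by
    intro B hB
    rw [← ofReal_integral_eq_lintegral_ofReal, ← ENNReal.ofReal_mul hc.le,
      ← intervalIntegral.integral_of_le hB, integral_rpow (Or.inl (by linarith))]
    · rw [ENNReal.ofReal_rpow_of_nonneg hB hc.le]
      congr 1
      rw [sub_add_cancel, Real.zero_rpow hc.ne']
      field_simp
      ring
    · rw [← IntegrableOn, ← intervalIntegrable_iff_integrableOn_Ioc_of_le hB]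
      exact intervalIntegral.intervalIntegrable_rpow' (by linarith)
    · filter_upwards [ae_restrict_mem measurableSet_Ioc] with t ht
      exact Real.rpow_nonneg ht.1.le _
  rcases eq_or_ne A ∞ with rfl | hA
  · rw [ENNReal.top_rpow_of_pos hc]
    refine ENNReal.eq_top_of_forall_nnreal_le fun r ↦ ?_
    have := key ((r : ℝ) ^ (1 / c)) (by positivity)
    rw [ENNReal.ofReal_rpow_of_nonneg (by positivity) hc.le, ← Real.rpow_mul r.coe_nonneg,
      one_div_mul_cancel hc.ne', Real.rpow_one] at this
    rw [ENNReal.ofReal_coe_nnreal] at this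
    rw [← this]
    have e : {t : ℝ | ENNReal.ofReal t < ∞} = univ := by ext; simp
    rw [e, indicator_univ]
    exact mul_le_mul_right (lintegral_mono_set Ioc_subset_Ioi_self) _
  · have h := key A.toReal ENNReal.toReal_nonneg
    rw [ENNReal.ofReal_toReal hA] at h
    rw [← h]
    congr 1
    have hm : MeasurableSet {t : ℝ | ENNReal.ofReal t < A} :=
      measurableSet_lt ENNReal.measurable_ofReal measurable_const
    rw [setLIntegral_indicator hm]
    rw [← setLIntegral_congr (Ioo_ae_eq_Ioc (a := (0 : ℝ)) (b := A.toReal))]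
    congr 2
    ext t
    simp only [mem_inter_iff, mem_ofPred_eq, mem_Ioi, mem_Ioo]
    constructor
    · rintro ⟨h1, h2⟩
      exact ⟨h2, (ENNReal.ofReal_lt_iff_lt_toReal h2.le hA).1 h1⟩
    · rintro ⟨h1, h2⟩
      exact ⟨(ENNReal.ofReal_lt_iff_lt_toReal h1.le hA).2 h2, h1⟩

lemma lintegral_mul_rpow_eq [SFinite μ] {w g : α → ℝ≥0∞} (hw : AEMeasurable w μ)
    (hg : AEMeasurable g μ) {c : ℝ} (hc : 0 < c) :
    ∫⁻ x, w x * g x ^ c ∂μ = ENNReal.ofReal c * ∫⁻ t in Ioi (0 : ℝ),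
      ENNReal.ofReal (t ^ (c - 1)) * ∫⁻ x, {x | ENNReal.ofReal t < g x}.indicator w x ∂μ := by
  -- Tonelli needs joint measurability in (x, t), so `w` and `g` are first replaced by measurable
  -- representatives.
  wlog h : Measurable w ∧ Measurable g generalizing w g
  · rw [lintegral_congr_ae (g := fun x ↦ hw.mk w x * hg.mk g x ^ c)
      (by filter_upwards [hw.ae_eq_mk, hg.ae_eq_mk] with x h1 h2; rw [h1, h2]),
      this hw.measurable_mk.aemeasurable hg.measurable_mk.aemeasurable
      ⟨hw.measurable_mk, hg.measurable_mk⟩]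
    congr 1
    refine lintegral_congr fun t ↦ ?_
    congr 1
    refine lintegral_congr_ae ?_
    filter_upwards [hw.ae_eq_mk, hg.ae_eq_mk] with x h1 h2
    by_cases hx : ENNReal.ofReal t < g x
    · rw [indicator_of_mem (s := {x | ENNReal.ofReal t < g x}) hx,
        indicator_of_mem (by rwa [h2] at hx), h1]
    · rw [indicator_of_notMem (s := {x | ENNReal.ofReal t < g x}) hx,
        indicator_of_notMem (by rwa [h2] at hx)]
  obtain ⟨hw, hg⟩ := h
  have e : ∀ x, w x * g x ^ c = ENNReal.ofReal c * ∫⁻ t in Ioi (0 : ℝ),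
      ENNReal.ofReal (t ^ (c - 1)) * {x | ENNReal.ofReal t < g x}.indicator w x := by
    intro x
    rw [← lintegral_rpow_lt hc (g x), mul_left_comm, ← lintegral_const_mul]
    · congr 1
      refine lintegral_congr fun t ↦ ?_
      simp only [indicator, mem_ofPred_eq]
      split_ifs
      · rw [mul_comm]
      · simp
    · refine Measurable.indicator (by fun_prop) ?_
      exact measurableSet_lt ENNReal.measurable_ofReal measurable_const
  have hm : Measurable (Function.uncurry fun (x : α) (t : ℝ) ↦
      ENNReal.ofReal (t ^ (c - 1)) * {x | ENNReal.ofReal t < g x}.indicator w x) := by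
    have : (Function.uncurry fun (x : α) (t : ℝ) ↦
      ENNReal.ofReal (t ^ (c - 1)) * {x | ENNReal.ofReal t < g x}.indicator w x) =
      fun z : α × ℝ ↦ ENNReal.ofReal (z.2 ^ (c - 1)) *
        {z : α × ℝ | ENNReal.ofReal z.2 < g z.1}.indicator (fun z ↦ w z.1) z := by
      ext ⟨x, t⟩
      simp [Function.uncurry, indicator]
    rw [this]
    refine Measurable.mul (by fun_prop) (Measurable.indicator (by fun_prop) ?_)
    exact measurableSet_lt (by fun_prop) (by fun_prop)
  simp_rw [e]
  rw [lintegral_const_mul' _ _ (by simp), lintegral_lintegral_swap hm.aemeasurable]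
  congr 1
  refine lintegral_congr fun t ↦ ?_
  rw [lintegral_const_mul']
  simp

lemma lintegral_rpow_eq [SFinite μ] {g : α → ℝ≥0∞} (hg : AEMeasurable g μ) {c : ℝ} (hc : 0 < c) :
    ∫⁻ x, g x ^ c ∂μ = ENNReal.ofReal c * ∫⁻ t in Ioi (0 : ℝ),
      ENNReal.ofReal (t ^ (c - 1)) * μ {x | ENNReal.ofReal t < g x} := by
  have h := lintegral_mul_rpow_eq (w := fun _ ↦ 1) (by fun_prop) hg hc
  simp only [one_mul] at h
  rw [h]
  congr 1
  refine lintegral_congr fun t ↦ ?_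
  congr 1
  rw [lintegral_indicator_const₀, one_mul]
  exact nullMeasurableSet_lt aemeasurable_const hg

/-- By `lt_rearr_iff` the region below the graph of the rearrangement is that below the graph of the
distribution function with the axes exchanged; both sides integrate the same weight over it. Only
the rearrangement has to be measurable, and it is antitone. -/
lemma lintegral_rpow_mul_rearr (f : α → ℝ≥0∞) {b c : ℝ} (hb : 0 < b) (hc : 0 < c) :
    ENNReal.ofReal b * ∫⁻ τ in Ioi (0 : ℝ),
        ENNReal.ofReal (τ ^ (b - 1)) * rearr μ f (ENNReal.ofReal τ) ^ c =
      ENNReal.ofReal c * ∫⁻ t in Ioi (0 : ℝ),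
        ENNReal.ofReal (t ^ (c - 1)) * μ {x | ENNReal.ofReal t < f x} ^ b := by
  rw [lintegral_mul_rpow_eq (by fun_prop) (measurable_rearr_ofReal f).aemeasurable hc,
    mul_left_comm]
  congr 1
  rw [← lintegral_const_mul' _ _ (by simp)]
  refine lintegral_congr fun t ↦ ?_
  rw [mul_left_comm]
  congr 1
  simp_rw [lt_rearr_iff]
  exact lintegral_rpow_lt hb _

lemma lintegral_rearr [SFinite μ] {f : α → ℝ≥0∞} (hf : AEMeasurable f μ) :
    ∫⁻ τ in Ioi (0 : ℝ), rearr μ f (ENNReal.ofReal τ) = ∫⁻ x, f x ∂μ := by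
  have h1 := lintegral_rpow_mul_rearr (μ := μ) f one_pos one_pos
  have h2 := lintegral_rpow_eq hf one_pos
  simp only [ENNReal.rpow_one] at h1 h2
  rw [← h1] at h2
  simpa using h2.symm

end Rearrangement

/-! ### Lorentz integrals -/

section Lorentz

variable {α : Type*} [MeasurableSpace α] {μ : Measure α}

lemma lintegral_Ioi_comp_mul (g : ℝ → ℝ≥0∞) {c : ℝ} (hc : 0 < c) :
    ∫⁻ t in Ioi (0 : ℝ), g t = ENNReal.ofReal c * ∫⁻ t in Ioi (0 : ℝ), g (c * t) := by
  have him : (fun t : ℝ ↦ c * t) '' Ioi 0 = Ioi 0 := by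
    rw [image_mul_left_Ioi hc, mul_zero]
  have key := lintegral_image_eq_lintegral_abs_deriv_mul (s := Ioi (0 : ℝ)) measurableSet_Ioi
    (f := fun t ↦ c * t) (f' := fun _ ↦ c)
    (fun x _ ↦ by simpa using ((hasDerivAt_id x).const_mul c).hasDerivWithinAt)
    (fun x _ y _ hxy ↦ mul_left_cancel₀ hc.ne' hxy) g
  rw [him, lintegral_const_mul' _ _ (by simp), abs_of_pos hc] at key
  exact key

/-- `lor μ a f` is, up to a constant, the square of the `L^{1/a,2}` quasi-norm of `f`. -/
noncomputable def lor (μ : Measure α) (a : ℝ) (f : α → ℝ≥0∞) : ℝ≥0∞ :=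
  ∫⁻ τ in Ioi (0 : ℝ), ENNReal.ofReal (τ ^ (2 * a - 1)) * rearr μ f (ENNReal.ofReal τ) ^ 2

lemma lor_mono {f g : α → ℝ≥0∞} (h : f ≤ᵐ[μ] g) (a : ℝ) : lor μ a f ≤ lor μ a g :=
  lintegral_mono fun _ ↦ by gcongr; exact rearr_mono h _

lemma lor_congr {f g : α → ℝ≥0∞} (h : f =ᵐ[μ] g) (a : ℝ) : lor μ a f = lor μ a g := by
  rw [lor, rearr_congr h, lor]

/-- The substitution τ ↦ 2τ, made so that `rearr_add_le` and `rearr_mul_le` can be applied with σ =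
τ. -/
lemma lor_eq_double (a : ℝ) (f : α → ℝ≥0∞) : lor μ a f = ENNReal.ofReal (2 ^ (2 * a)) *
    ∫⁻ τ in Ioi (0 : ℝ), ENNReal.ofReal (τ ^ (2 * a - 1)) *
      rearr μ f (ENNReal.ofReal τ + ENNReal.ofReal τ) ^ 2 := by
  rw [lor, lintegral_Ioi_comp_mul _ two_pos, ← lintegral_const_mul' _ _ (by simp),
    ← lintegral_const_mul' _ _ (by simp)]
  refine setLIntegral_congr_fun measurableSet_Ioi fun τ (hτ : 0 < τ) ↦ ?_
  rw [← ENNReal.ofReal_add hτ.le hτ.le, ← two_mul, ← mul_assoc, ← mul_assoc,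
    ← ENNReal.ofReal_mul (by positivity), ← ENNReal.ofReal_mul (by positivity),
    Real.mul_rpow two_pos.le hτ.le, ← mul_assoc]
  congr 3
  rw [Real.rpow_sub_one two_ne_zero]
  field_simp

lemma add_sq_le_two (x y : ℝ≥0∞) : (x + y) ^ 2 ≤ 2 * (x ^ 2 + y ^ 2) := by
  have h := ENNReal.rpow_add_le_mul_rpow_add_rpow x y one_le_two
  norm_num at h
  exact h

lemma lor_add_le (a : ℝ) (f g : α → ℝ≥0∞) :
    lor μ a (f + g) ≤ ENNReal.ofReal (2 ^ (2 * a)) * 2 * (lor μ a f + lor μ a g) := by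
  rw [lor_eq_double, mul_assoc]
  gcongr
  have hm : Measurable fun τ : ℝ ↦
      ENNReal.ofReal (τ ^ (2 * a - 1)) * rearr μ f (ENNReal.ofReal τ) ^ 2 :=
    Measurable.mul (by fun_prop) ((measurable_rearr_ofReal f).pow_const 2)
  rw [lor, lor, ← lintegral_add_left hm, ← lintegral_const_mul' _ _ (by simp)]
  refine lintegral_mono fun τ ↦ ?_
  calc _ ≤ ENNReal.ofReal (τ ^ (2 * a - 1)) *
        (2 * (rearr μ f (ENNReal.ofReal τ) ^ 2 + rearr μ g (ENNReal.ofReal τ) ^ 2)) := by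
        gcongr
        refine le_trans ?_ (add_sq_le_two _ _)
        gcongr
        exact rearr_add_le f g _ _
    _ = _ := by ring

/-- O'Neil's form of Hölder's inequality, L^{1/b,∞} · L^{1/a,2} ⊂ L^{1/(a+b),2}: the rearrangement
of the product at 2τ is at most the product of those at τ, and the factor τ^{-b} accounts for the
change of weight. -/
lemma lor_mul_le (a : ℝ) {b : ℝ} {v : α → ℝ≥0∞} {K : ℝ≥0∞}
    (hv : ∀ τ : ℝ, 0 < τ → rearr μ v (ENNReal.ofReal τ) ≤ K * ENNReal.ofReal (τ ^ (-b)))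
    (f : α → ℝ≥0∞) :
    lor μ (a + b) (v * f) ≤ ENNReal.ofReal (2 ^ (2 * (a + b))) * (K ^ 2 * lor μ a f) := by
  rw [lor_eq_double]
  gcongr
  have hm : Measurable fun τ : ℝ ↦
      ENNReal.ofReal (τ ^ (2 * a - 1)) * rearr μ f (ENNReal.ofReal τ) ^ 2 :=
    Measurable.mul (by fun_prop) ((measurable_rearr_ofReal f).pow_const 2)
  rw [lor, ← lintegral_const_mul _ hm]
  refine setLIntegral_mono' measurableSet_Ioi fun τ (hτ : 0 < τ) ↦ ?_
  calc _ ≤ ENNReal.ofReal (τ ^ (2 * (a + b) - 1)) *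
        (K * ENNReal.ofReal (τ ^ (-b)) * rearr μ f (ENNReal.ofReal τ)) ^ 2 := by
        gcongr
        exact (rearr_mul_le v f _ _).trans (mul_le_mul_left (hv τ hτ) _)
    _ = (ENNReal.ofReal (τ ^ (2 * (a + b) - 1)) * ENNReal.ofReal (τ ^ (-b)) ^ 2) *
        (K ^ 2 * rearr μ f (ENNReal.ofReal τ) ^ 2) := by ring
    _ = _ := by
      rw [← ENNReal.ofReal_pow (by positivity), ← ENNReal.ofReal_mul (by positivity),
        ← Real.rpow_natCast, ← Real.rpow_mul hτ.le, ← Real.rpow_add hτ, mul_left_comm]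
      congr 4
      push_cast
      ring

lemma lintegral_mul_le_rearr [SFinite μ] {f g : α → ℝ≥0∞} (hf : AEMeasurable f μ)
    (hg : AEMeasurable g μ) : ∫⁻ x, f x * g x ∂μ ≤
      2 * ∫⁻ τ in Ioi (0 : ℝ), rearr μ f (ENNReal.ofReal τ) * rearr μ g (ENNReal.ofReal τ) := by
  rw [show ∫⁻ x, f x * g x ∂μ = ∫⁻ x, (f * g) x ∂μ from rfl, ← lintegral_rearr (hf.mul hg),
    lintegral_Ioi_comp_mul _ two_pos, ENNReal.ofReal_ofNat]
  gcongr with τ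
  by_cases hτ : 0 ≤ τ
  · rw [two_mul, ENNReal.ofReal_add hτ hτ]
    exact rearr_mul_le _ _ _ _
  · rw [ENNReal.ofReal_of_nonpos (by linarith), ENNReal.ofReal_of_nonpos (by linarith)]
    simpa using rearr_mul_le (μ := μ) f g 0 0

/-- Duality of L^{1/a,2} and L^{1/(1-a),2}: the weights τ^{a-1/2} and τ^{(1-a)-1/2} multiply to 1,
so Cauchy–Schwarz applies to the product of the rearrangements. -/
lemma lintegral_mul_le_lor [SFinite μ] {f g : α → ℝ≥0∞} (hf : AEMeasurable f μ)
    (hg : AEMeasurable g μ) (a : ℝ) : ∫⁻ x, f x * g x ∂μ ≤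
      2 * (lor μ a f ^ (1 / 2 : ℝ) * lor μ (1 - a) g ^ (1 / 2 : ℝ)) := by
  refine (lintegral_mul_le_rearr hf hg).trans ?_
  gcongr
  have hm : ∀ (b : ℝ) (h : α → ℝ≥0∞), AEMeasurable (fun τ : ℝ ↦
      ENNReal.ofReal (τ ^ (b - 1 / 2)) * rearr μ h (ENNReal.ofReal τ))
      (volume.restrict (Ioi 0)) := fun b h ↦
    (Measurable.mul (by fun_prop) (measurable_rearr_ofReal h)).aemeasurable
  have h := ENNReal.lintegral_mul_le_Lp_mul_Lq (volume.restrict (Ioi (0 : ℝ)))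
    (Real.HolderConjugate.two_two) (hm a f) (hm (1 - a) g)
  refine le_trans (le_of_eq ?_) (h.trans (le_of_eq ?_))
  · refine setLIntegral_congr_fun measurableSet_Ioi fun τ (hτ : 0 < τ) ↦ ?_
    simp only [Pi.mul_apply]
    rw [mul_mul_mul_comm, ← ENNReal.ofReal_mul (by positivity), ← Real.rpow_add hτ]
    rw [show a - 1 / 2 + (1 - a - 1 / 2) = 0 by ring, Real.rpow_zero]
    simp
  · have e : ∀ (b : ℝ) (h : α → ℝ≥0∞), ∫⁻ τ in Ioi (0 : ℝ), (ENNReal.ofReal (τ ^ (b - 1 / 2)) *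
        rearr μ h (ENNReal.ofReal τ)) ^ (2 : ℝ) = lor μ b h := by
      intro b h
      refine setLIntegral_congr_fun measurableSet_Ioi fun τ (hτ : 0 < τ) ↦ ?_
      rw [ENNReal.rpow_two, mul_pow, ← ENNReal.ofReal_pow (by positivity), ← Real.rpow_natCast,
        ← Real.rpow_mul hτ.le]
      congr 3
      push_cast
      ring
    rw [e, e]

/-- The inclusion of L^{1/a,2} in L^{1/a,∞}: the rearrangement is decreasing, so its value at τ is a
lower bound for it on (0, τ). -/
lemma rearr_le_of_lor {a : ℝ} (ha : 0 < a) (f : α → ℝ≥0∞) {τ : ℝ} (hτ : 0 < τ) :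
    rearr μ f (ENNReal.ofReal τ) ≤
      (ENNReal.ofReal (2 * a) * lor μ a f) ^ (1 / 2 : ℝ) * ENNReal.ofReal (τ ^ (-a)) := by
  have h : ENNReal.ofReal τ ^ (2 * a) * rearr μ f (ENNReal.ofReal τ) ^ 2 ≤
      ENNReal.ofReal (2 * a) * lor μ a f := by
    rw [← lintegral_rpow_lt (show 0 < 2 * a by linarith), mul_assoc]
    gcongr
    rw [← lintegral_mul_const]
    · refine lintegral_mono fun σ ↦ ?_
      by_cases hσ : ENNReal.ofReal σ < ENNReal.ofReal τ
      · rw [indicator_of_mem (by exact hσ)]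
        gcongr
        exact rearr_antitone f hσ.le
      · rw [indicator_of_notMem (by exact hσ)]
        simp
    · exact Measurable.indicator (by fun_prop)
        (measurableSet_lt ENNReal.measurable_ofReal measurable_const)
  have h2 := ENNReal.rpow_le_rpow h (show (0 : ℝ) ≤ 1 / 2 by norm_num)
  rw [ENNReal.mul_rpow_of_nonneg _ _ (by norm_num), ← ENNReal.rpow_mul, ← ENNReal.rpow_natCast,
    ← ENNReal.rpow_mul, show (2 * a * (1 / 2)) = a by ring,
    show ((2 : ℕ) : ℝ) * (1 / 2) = 1 by norm_num, ENNReal.rpow_one] at h2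
  calc _ = ENNReal.ofReal τ ^ a * rearr μ f (ENNReal.ofReal τ) * ENNReal.ofReal (τ ^ (-a)) := by
        rw [ENNReal.ofReal_rpow_of_pos hτ, mul_right_comm, ← ENNReal.ofReal_mul (by positivity),
          ← Real.rpow_add hτ]
        simp
    _ ≤ _ := by gcongr

lemma lor_half [SFinite μ] {f : α → ℝ≥0∞} (hf : AEMeasurable f μ) :
    lor μ (1 / 2) f = ∫⁻ x, f x ^ 2 ∂μ := by
  have h1 := lintegral_rpow_mul_rearr (μ := μ) f one_pos two_pos
  have h2 := lintegral_rpow_eq hf two_pos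
  simp only [ENNReal.rpow_one] at h1
  rw [← h1] at h2
  simp only [ENNReal.rpow_two, ENNReal.ofReal_one, one_mul] at h2
  rw [h2, lor]
  norm_num

/-- A weak Lebesgue function lies in L¹ + L^∞. The rearranged integral is split at τ = 1: below, g*
≤ M and τ^{-a} is integrable because a < 1; above, g* ≤ τ^{-1}∫g and τ^{-a-1} is integrable because
a > 0. -/
lemma lintegral_mul_le_of_weak [SFinite μ] {a : ℝ} (ha : 0 < a) (ha1 : a < 1)
    {f g : α → ℝ≥0∞} (hf : AEMeasurable f μ) (hg : AEMeasurable g μ) {K M : ℝ≥0∞}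
    (hK : ∀ τ : ℝ, 0 < τ → rearr μ f (ENNReal.ofReal τ) ≤ K * ENNReal.ofReal (τ ^ (-a)))
    (hM : ∀ x, g x ≤ M) :
    ∫⁻ x, f x * g x ∂μ ≤ 2 * K * (ENNReal.ofReal (1 / (1 - a)) * M +
      ENNReal.ofReal (1 / a) * ∫⁻ x, g x ∂μ) := by
  refine (lintegral_mul_le_rearr hf hg).trans ?_
  rw [mul_assoc]
  gcongr
  rw [← Ioc_union_Ioi_eq_Ioi zero_le_one, lintegral_union measurableSet_Ioi
    (Set.disjoint_left.2 fun x hx hx' ↦ absurd hx.2 (not_le.2 hx')), mul_add]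
  gcongr
  · calc _ ≤ ∫⁻ τ in Ioc (0 : ℝ) 1, K * M * ENNReal.ofReal (τ ^ (-a)) := by
          refine setLIntegral_mono' measurableSet_Ioc fun τ hτ ↦ ?_
          calc _ ≤ K * ENNReal.ofReal (τ ^ (-a)) * M := by
                gcongr
                · exact hK τ hτ.1
                · exact rearr_le_of_forall_le hM _
            _ = _ := by ring
      _ ≤ _ := by
        rw [lintegral_const_mul _ (by fun_prop), mul_comm (ENNReal.ofReal _) M, ← mul_assoc]
        gcongr
        rw [← ofReal_integral_eq_lintegral_ofReal, ← intervalIntegral.integral_of_le zero_le_one,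
          integral_rpow (Or.inl (by linarith))]
        · refine ENNReal.ofReal_le_ofReal (le_of_eq ?_)
          rw [Real.one_rpow, Real.zero_rpow (by linarith)]
          ring
        · rw [← IntegrableOn, ← intervalIntegrable_iff_integrableOn_Ioc_of_le zero_le_one]
          exact intervalIntegral.intervalIntegrable_rpow' (by linarith)
        · filter_upwards [ae_restrict_mem measurableSet_Ioc] with t ht
          exact Real.rpow_nonneg ht.1.le _
  · calc _ ≤ ∫⁻ τ in Ioi (1 : ℝ), K * (∫⁻ x, g x ∂μ) * ENNReal.ofReal (τ ^ (-a - 1)) := by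
          refine setLIntegral_mono' measurableSet_Ioi fun τ (hτ : 1 < τ) ↦ ?_
          have h0 : 0 < τ := by linarith
          calc _ = ENNReal.ofReal (τ ^ (-(1 : ℝ))) * rearr μ f (ENNReal.ofReal τ) *
                (ENNReal.ofReal τ * rearr μ g (ENNReal.ofReal τ)) := by
                rw [mul_mul_mul_comm, ← ENNReal.ofReal_mul (by positivity),
                  Real.rpow_neg_one, inv_mul_cancel₀ h0.ne']
                simp
            _ ≤ ENNReal.ofReal (τ ^ (-(1 : ℝ))) * (K * ENNReal.ofReal (τ ^ (-a))) *
                ∫⁻ x, g x ∂μ := by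
                gcongr
                · exact hK τ h0
                · exact mul_rearr_le_lintegral hg _
            _ = _ := by
                rw [sub_eq_add_neg, Real.rpow_add h0, ENNReal.ofReal_mul (by positivity)]
                ring
      _ ≤ _ := by
        rw [lintegral_const_mul _ (by fun_prop), mul_comm (ENNReal.ofReal _) (lintegral _ _),
          ← mul_assoc]
        gcongr
        rw [← ofReal_integral_eq_lintegral_ofReal, integral_Ioi_rpow_of_lt (by linarith) one_pos]
        · refine ENNReal.ofReal_le_ofReal (le_of_eq ?_)
          rw [Real.one_rpow, sub_add_cancel, neg_div_neg_eq]
        · exact integrableOn_Ioi_rpow_of_lt (by linarith) one_pos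
        · filter_upwards [ae_restrict_mem measurableSet_Ioi] with t ht
          exact Real.rpow_nonneg (le_of_lt (lt_trans one_pos ht)) _

/-- The rearrangement is at most `M` and vanishes once τ ≥ μ(s); for smaller τ the factor (μ(s)/τ)^b
is at least 1. -/
lemma rearr_le_of_support {f : α → ℝ≥0∞} {M : ℝ≥0∞} {s : Set α} (hM : ∀ x, f x ≤ M)
    (hs : ∀ x ∉ s, f x = 0) {b : ℝ} (hb : 0 ≤ b) {τ : ℝ} (hτ : 0 < τ) :
    rearr μ f (ENNReal.ofReal τ) ≤ M * μ s ^ b * ENNReal.ofReal (τ ^ (-b)) := by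
  rcases le_or_gt (μ s) (ENNReal.ofReal τ) with h | h
  · have : rearr μ f (ENNReal.ofReal τ) ≤ 0 := by
      refine rearr_le_iff.2 (le_trans (measure_mono fun x hx ↦ ?_) h)
      by_contra hxs
      exact absurd (hs x hxs) (ne_of_gt hx)
    exact this.trans zero_le
  · refine (rearr_le_of_forall_le hM _).trans ?_
    rw [mul_assoc]
    refine le_mul_of_one_le_right' ?_
    calc (1 : ℝ≥0∞) = ENNReal.ofReal τ ^ b * ENNReal.ofReal (τ ^ (-b)) := by
          rw [ENNReal.ofReal_rpow_of_pos hτ, ← ENNReal.ofReal_mul (by positivity),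
            ← Real.rpow_add hτ]
          simp
      _ ≤ _ := by gcongr

lemma ofReal_two_mul_lor {a : ℝ} (ha : 0 < a) (f : α → ℝ≥0∞) :
    ENNReal.ofReal (2 * a) * lor μ a f = 2 * ∫⁻ t in Ioi (0 : ℝ),
      ENNReal.ofReal t * μ {x | ENNReal.ofReal t < f x} ^ (2 * a) := by
  have h := lintegral_rpow_mul_rearr (μ := μ) f (show 0 < 2 * a by linarith) two_pos
  simp only [ENNReal.rpow_two, ENNReal.ofReal_ofNat] at h
  rw [lor, h]
  norm_num

/-- Absolute continuity of the L^{1/a,2} quasi-norm: dominated convergence in the level t, using the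
distribution function form of `lor`. -/
lemma lor_tendsto_zero {a : ℝ} (ha : 0 < a) {f : α → ℝ≥0∞} (hf : AEMeasurable f μ)
    (hfin : lor μ a f < ∞) {A : ℕ → Set α} (hA : ∀ n, NullMeasurableSet (A n) μ)
    (hmono : Antitone A) (hinter : ⋂ n, A n = ∅) :
    Filter.Tendsto (fun n ↦ lor μ a ((A n).indicator f)) Filter.atTop (nhds 0) := by
  have h2a : ENNReal.ofReal (2 * a) ≠ 0 := by simpa using ha
  have hfin' : ∫⁻ t in Ioi (0 : ℝ),
      ENNReal.ofReal t * μ {x | ENNReal.ofReal t < f x} ^ (2 * a) ≠ ∞ := by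
    intro h
    have := ofReal_two_mul_lor (μ := μ) ha f
    rw [h, ENNReal.mul_top two_ne_zero] at this
    exact (ENNReal.mul_lt_top ENNReal.ofReal_lt_top hfin).ne this
  have key : Filter.Tendsto (fun n ↦ ∫⁻ t in Ioi (0 : ℝ),
      ENNReal.ofReal t * μ {x | ENNReal.ofReal t < (A n).indicator f x} ^ (2 * a))
      Filter.atTop (nhds (∫⁻ t in Ioi (0 : ℝ), 0)) := by
    have hmeas : ∀ g : α → ℝ≥0∞, Measurable fun t : ℝ ↦
        ENNReal.ofReal t * μ {x | ENNReal.ofReal t < g x} ^ (2 * a) := by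
      intro g
      have : Antitone fun t : ℝ ↦ μ {x | ENNReal.ofReal t < g x} := fun s t hst ↦
        measure_mono fun x hx ↦ lt_of_le_of_lt (ENNReal.ofReal_le_ofReal hst) hx
      have := this.measurable
      exact ENNReal.measurable_ofReal.mul (this.pow_const _)
    refine tendsto_lintegral_of_dominated_convergence' _ (fun n ↦ (hmeas _).aemeasurable)
      (fun n ↦ ?_) hfin' ?_
    · refine Filter.Eventually.of_forall fun t ↦ ?_
      simp only
      gcongr with x
      exact indicator_le_self _ _ _
    · have hlt := ae_lt_top (hmeas f) hfin'
      filter_upwards [hlt, ae_restrict_mem measurableSet_Ioi] with t ht ht0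
      have ht0 : 0 < t := ht0
      -- Continuity of the measure from above needs level sets of finite measure; almost every level
      -- t > 0 has one, because the integrand is finite there.
      have hfinm : μ {x | ENNReal.ofReal t < f x} ≠ ∞ := by
        intro h
        rw [h, ENNReal.top_rpow_of_pos (by linarith), ENNReal.mul_top (by simpa using ht0)] at ht
        exact lt_irrefl _ ht
      have e : ∀ n, {x | ENNReal.ofReal t < (A n).indicator f x} =
          A n ∩ {x | ENNReal.ofReal t < f x} := by
        intro n
        ext x
        by_cases hx : x ∈ A n <;> simp [hx]
      have hlim : Filter.Tendsto (fun n ↦ μ {x | ENNReal.ofReal t < (A n).indicator f x})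
          Filter.atTop (nhds 0) := by
        simp_rw [e]
        have := tendsto_measure_iInter_atTop (μ := μ)
          (s := fun n ↦ A n ∩ {x | ENNReal.ofReal t < f x})
          (fun n ↦ (hA n).inter (nullMeasurableSet_lt aemeasurable_const hf))
          (fun i j hij ↦ inter_subset_inter_left _ (hmono hij))
          ⟨0, ((measure_mono inter_subset_right).trans_lt hfinm.lt_top).ne⟩
        rwa [← iInter_inter, hinter, empty_inter, measure_empty] at this
      have h3 := (ENNReal.continuous_rpow_const (y := 2 * a)).tendsto 0 |>.comp hlim
      rw [ENNReal.zero_rpow_of_pos (by linarith)] at h3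
      have := ENNReal.Tendsto.const_mul h3 (Or.inr (by simp : ENNReal.ofReal t ≠ ∞))
      rwa [mul_zero] at this
  rw [lintegral_zero] at key
  have h4 := ENNReal.Tendsto.const_mul key (Or.inr (ENNReal.ofNat_ne_top : (2 : ℝ≥0∞) ≠ ∞))
  rw [mul_zero] at h4
  simp_rw [← ofReal_two_mul_lor ha] at h4
  have h5 := ENNReal.Tendsto.const_mul h4
    (Or.inr (ENNReal.inv_ne_top.2 h2a) : (0 : ℝ≥0∞) ≠ 0 ∨ (ENNReal.ofReal (2 * a))⁻¹ ≠ ∞)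
  rw [mul_zero] at h5
  simp_rw [← mul_assoc, ENNReal.inv_mul_cancel h2a ENNReal.ofReal_ne_top, one_mul] at h5
  exact h5

end Lorentz

/-! ### Lorentz and weak norms on `ℝ^d` in terms of rearrangements; translation invariance -/

section Euclidean

variable {d : ℕ}

lemma distFun_eq (f : E d → ℂ) {t : ℝ} (ht : 0 ≤ t) :
    distFun f t = volume {x | ENNReal.ofReal t < ‖f x‖ₑ} := by
  rw [distFun]
  congr 1
  ext x
  rw [mem_ofPred_eq, mem_ofPred_eq, ← ofReal_norm,
    ENNReal.ofReal_lt_ofReal_iff_of_nonneg ht]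

lemma lorentzNorm_eq {p : ℝ} (hp : 0 < p) (f : E d → ℂ) : lorentzNorm p 2 f =
    (ENNReal.ofReal (2 / p) * lor volume (1 / p) (fun x ↦ ‖f x‖ₑ)) ^ (1 / 2 : ℝ) := by
  rw [lorentzNorm, show (2 : ℝ) / p = 2 * (1 / p) by ring, ofReal_two_mul_lor (by positivity),
    ENNReal.ofReal_ofNat]
  congr 2
  refine setLIntegral_congr_fun measurableSet_Ioi fun t (ht : 0 < t) ↦ ?_
  rw [distFun_eq f ht.le]
  norm_num

lemma lorentzNorm_lt_top_iff {p : ℝ} (hp : 0 < p) {f : E d → ℂ} :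
    lorentzNorm p 2 f < ∞ ↔ lor volume (1 / p) (fun x ↦ ‖f x‖ₑ) < ∞ := by
  rw [lorentzNorm_eq hp, ENNReal.rpow_lt_top_iff_of_pos (by norm_num)]
  constructor
  · intro h
    refine lt_top_iff_ne_top.2 fun h' ↦ ?_
    rw [h', ENNReal.mul_top (by simpa using hp)] at h
    exact lt_irrefl _ h
  · exact fun h ↦ ENNReal.mul_lt_top (by simp) h

lemma rearr_le_weakNorm {q : ℝ} (hq : 0 < q) (f : E d → ℂ) {τ : ℝ} (hτ : 0 < τ) :
    rearr volume (fun x ↦ ‖f x‖ₑ) (ENNReal.ofReal τ) ≤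
      weakNorm q f * ENNReal.ofReal (τ ^ (-(1 / q))) := by
  refine le_of_forall_lt fun s hs ↦ ?_
  obtain ⟨s', hss', hs'⟩ := exists_between hs
  refine lt_of_lt_of_le hss' ?_
  have hs0 : 0 < s' := lt_of_le_of_lt zero_le hss'
  have hst : s' ≠ ∞ := hs'.ne_top
  have h := lt_rearr_iff.1 hs'
  have e : ENNReal.ofReal s'.toReal = s' := ENNReal.ofReal_toReal hst
  rw [← e, ← distFun_eq f ENNReal.toReal_nonneg] at h
  calc s' = s' * ENNReal.ofReal τ ^ (1 / q) * ENNReal.ofReal (τ ^ (-(1 / q))) := by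
        rw [ENNReal.ofReal_rpow_of_pos hτ, mul_assoc, ← ENNReal.ofReal_mul (by positivity),
          ← Real.rpow_add hτ]
        simp
    _ ≤ weakNorm q f * ENNReal.ofReal (τ ^ (-(1 / q))) := by
        gcongr
        refine le_trans ?_ (le_iSup₂ (f := fun (t : ℝ) (_ : 0 < t) ↦
          ENNReal.ofReal t * distFun f t ^ (1 / q)) s'.toReal (ENNReal.toReal_pos hs0.ne' hst))
        rw [e]
        gcongr

lemma rearr_comp_sub (f : E d → ℝ≥0∞) (z : E d) :
    rearr volume (fun x ↦ f (x - z)) = rearr volume f := by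
  funext τ
  refine eq_of_forall_lt_iff fun s ↦ ?_
  rw [lt_rearr_iff, lt_rearr_iff]
  have : {x | s < f (x - z)} = (fun x ↦ x + (-z)) ⁻¹' {x | s < f x} := by
    ext x; simp [sub_eq_add_neg]
  rw [this, measure_preimage_add_right]

lemma lor_comp_sub (a : ℝ) (f : E d → ℝ≥0∞) (z : E d) :
    lor volume a (fun x ↦ f (x - z)) = lor volume a f := by
  rw [lor, rearr_comp_sub, lor]

end Euclidean

/-! ### Convolution with measures of fractional dimension -/

section Hardy

lemma measure_lt_top_of_lor {α : Type*} [MeasurableSpace α] {μ : Measure α} {a : ℝ} (ha : 0 < a)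
    {f : α → ℝ≥0∞} (hf : lor μ a f < ∞) {s : ℝ≥0∞} (hs : 0 < s) : μ {x | s < f x} < ∞ := by
  set K := (ENNReal.ofReal (2 * a) * lor μ a f) ^ (1 / 2 : ℝ) with hK
  have hKt : K ≠ ∞ := ENNReal.rpow_ne_top_of_nonneg (by norm_num)
    (ENNReal.mul_lt_top ENNReal.ofReal_lt_top hf).ne
  have hlim : Filter.Tendsto (fun τ : ℝ ↦ K * ENNReal.ofReal (τ ^ (-a))) Filter.atTop
      (nhds 0) := by
    have := ENNReal.Tendsto.const_mul (ENNReal.tendsto_ofReal (tendsto_rpow_neg_atTop ha))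
      (Or.inr hKt)
    simpa using this
  obtain ⟨τ, h1, h2⟩ := ((hlim.eventually (gt_mem_nhds hs)).and
    (Filter.eventually_gt_atTop 0)).exists
  refine lt_of_le_of_lt (rearr_le_iff.1 ?_) (ENNReal.ofReal_lt_top (r := τ))
  exact (rearr_le_of_lor ha f h2).trans h1.le

/-- On (0, x) the decreasing power σ^{κ-1} is at least x^{κ-1}, so the integrand dominates a
constant whose integral is the left side. This makes the bound of `prod_measure_le` a layer-cake
integrand. -/
lemma min_le_lintegral_indicator {κ τ : ℝ} (hκ : κ < 1) (hτ : 0 < τ)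
    {x : ℝ≥0∞} (hx : x ≠ ∞) :
    min (x ^ κ) (ENNReal.ofReal (τ ^ (κ - 1)) * x) ≤ ∫⁻ σ in Ioi (0 : ℝ),
      {σ : ℝ | ENNReal.ofReal σ < x}.indicator
        (fun σ ↦ ENNReal.ofReal (min (τ ^ (κ - 1)) (σ ^ (κ - 1)))) σ := by
  rcases eq_or_ne x 0 with rfl | hx0
  · simp
  set X := x.toReal with hX
  have hXpos : 0 < X := ENNReal.toReal_pos hx0 hx
  have hxX : x = ENNReal.ofReal X := (ENNReal.ofReal_toReal hx).symm
  calc _ = ∫⁻ σ in Ioo (0 : ℝ) X, ENNReal.ofReal (min (τ ^ (κ - 1)) (X ^ (κ - 1))) := by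
        rw [lintegral_const, Measure.restrict_apply_univ, Real.volume_Ioo, sub_zero, hxX,
          ENNReal.ofReal_rpow_of_pos hXpos, ← ENNReal.ofReal_mul (by positivity),
          ← ENNReal.ofReal_mul (by positivity), ← ENNReal.ofReal_min]
        congr 1
        rw [min_mul_of_nonneg _ _ hXpos.le, min_comm]
        congr 1
        rw [← Real.rpow_add_one hXpos.ne', sub_add_cancel]
    _ ≤ ∫⁻ σ in Ioo (0 : ℝ) X, {σ : ℝ | ENNReal.ofReal σ < x}.indicator
        (fun σ ↦ ENNReal.ofReal (min (τ ^ (κ - 1)) (σ ^ (κ - 1)))) σ := by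
        refine setLIntegral_mono' measurableSet_Ioo fun σ hσ ↦ ?_
        rw [indicator_of_mem (by
          rw [mem_ofPred_eq, hxX]; exact (ENNReal.ofReal_lt_ofReal_iff hXpos).2 hσ.2)]
        refine ENNReal.ofReal_le_ofReal (min_le_min_left _ ?_)
        exact Real.rpow_le_rpow_of_nonpos hσ.1 hσ.2.le (by linarith)
    _ ≤ _ := lintegral_mono_set Ioo_subset_Ioi_self

variable {d : ℕ}

/-- Two ways of slicing. For fixed x in B the slice is a translate of A, of ν-measure at most
C|A|^κ. After the shear (y, x) ↦ (y, y + x), the slice over z in A is z - B, of ν-measure at most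
C|B|^κ. -/
lemma prod_measure_le {ν : Measure (E d)} [SFinite ν] {C : ℝ≥0∞} {κ : ℝ}
    (hν : ∀ A, MeasurableSet A → ν A ≤ C * volume A ^ κ) {A B : Set (E d)}
    (hA : MeasurableSet A) (hB : MeasurableSet B) :
    (ν.prod (volume.restrict B)) {z | z.1 + z.2 ∈ A} ≤
      C * min (volume A ^ κ * volume B) (volume B ^ κ * volume A) := by
  have hm : MeasurableSet {z : E d × E d | z.1 + z.2 ∈ A} := measurable_add hA
  rw [mul_min]
  refine le_min ?_ ?_
  · rw [Measure.prod_apply_symm hm]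
    calc _ ≤ ∫⁻ x in B, C * volume A ^ κ := by
          refine lintegral_mono fun x ↦ ?_
          refine (hν _ (hm.preimage (by fun_prop))).trans (le_of_eq ?_)
          have : (fun y : E d ↦ (y, x)) ⁻¹' {z | z.1 + z.2 ∈ A} = (fun y ↦ y + x) ⁻¹' A := rfl
          rw [this, measure_preimage_add_right]
      _ = _ := by simp [mul_assoc]
  · have hmp := measurePreserving_prod_add ν (volume : Measure (E d))
    have hS : MeasurableSet {z : E d × E d | z.2 - z.1 ∈ B ∧ z.2 ∈ A} :=
      ((measurable_snd.sub measurable_fst) hB).inter (measurable_snd hA)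
    have e : (ν.prod (volume.restrict B)) {z | z.1 + z.2 ∈ A} =
        (ν.prod volume) {z : E d × E d | z.2 - z.1 ∈ B ∧ z.2 ∈ A} := by
      rw [← hmp.measure_preimage hS.nullMeasurableSet]
      have : ν.prod (volume.restrict B) = (ν.prod volume).restrict (univ ×ˢ B) := by
        rw [← Measure.prod_restrict, Measure.restrict_univ]
      rw [this, Measure.restrict_apply hm]
      congr 1
      ext z
      simp [and_comm]
    rw [e, Measure.prod_apply_symm hS]
    calc _ ≤ ∫⁻ z, A.indicator (fun _ ↦ C * volume B ^ κ) z := by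
          refine lintegral_mono fun z ↦ ?_
          by_cases hz : z ∈ A
          · rw [indicator_of_mem hz]
            have : (fun y : E d ↦ (y, z)) ⁻¹' {z | z.2 - z.1 ∈ B ∧ z.2 ∈ A} =
                (fun y ↦ z - y) ⁻¹' B := by
              ext y; simp [hz]
            rw [this]
            refine (hν _ (hB.preimage (by fun_prop))).trans (le_of_eq ?_)
            rw [(Measure.measurePreserving_sub_left volume z).measure_preimage hB.nullMeasurableSet]
          · have : (fun y : E d ↦ (y, z)) ⁻¹' {z | z.2 - z.1 ∈ B ∧ z.2 ∈ A} = ∅ := by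
              ext y; simp [hz]
            rw [this]; simp
      _ = _ := by rw [lintegral_indicator_const hA, mul_assoc]

/-- If the convolution exceeds s on B, then s|B| is at most the integral of f(y + x) over ν × B.
Layer cake reduces this to indicators of level sets of f, which `prod_measure_le` controls. -/
lemma rearr_conv_le {ν : Measure (E d)} [SFinite ν] {C : ℝ≥0} {κ : ℝ} (hκ : κ < 1)
    (hν : ∀ A, MeasurableSet A → ν A ≤ C * volume A ^ κ) {f : E d → ℝ≥0∞} (hf : Measurable f)
    (hfin : ∀ s, 0 < s → volume {x | s < f x} < ∞) {τ : ℝ} (hτ : 0 < τ) :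
    rearr volume (fun x ↦ ∫⁻ y, f (y + x) ∂ν) (ENNReal.ofReal τ) ≤
      C * ∫⁻ σ in Ioi (0 : ℝ), ENNReal.ofReal (min (τ ^ (κ - 1)) (σ ^ (κ - 1))) *
        rearr volume f (ENNReal.ofReal σ) := by
  have hmf : Measurable fun z : E d × E d ↦ f (z.1 + z.2) := hf.comp measurable_add
  have hh : Measurable fun x ↦ ∫⁻ y, f (y + x) ∂ν := hmf.lintegral_prod_left'
  refine le_of_forall_lt fun s₀ hs₀ ↦ ?_
  obtain ⟨s, hs₀s, hs⟩ := exists_between hs₀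
  refine lt_of_lt_of_le hs₀s ?_
  -- Finite measure allows the final division by |B|; measure above τ gives |B|^{κ-1} ≤ τ^{κ-1}.
  obtain ⟨B, hB, hBs, hτB, hBt⟩ := Measure.exists_subset_measure_lt_top
    (measurableSet_lt measurable_const hh) (lt_rearr_iff.1 hs)
  have hB0 : volume B ≠ 0 := (lt_of_le_of_lt zero_le hτB).ne'
  have h1 : s * volume B ≤ ∫⁻ z, f (z.1 + z.2) ∂(ν.prod (volume.restrict B)) := by
    rw [lintegral_prod_symm' _ hmf]
    calc s * volume B = ∫⁻ _ in B, s := by simp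
      _ ≤ _ := setLIntegral_mono' hB fun x hx ↦ (le_of_lt (hBs hx))
  have h2 := lintegral_rpow_eq (μ := ν.prod (volume.restrict B)) hmf.aemeasurable one_pos
  simp only [ENNReal.rpow_one, ENNReal.ofReal_one, one_mul, sub_self, Real.rpow_zero] at h2
  rw [h2] at h1
  have h3 : s * volume B ≤ (C * ∫⁻ σ in Ioi (0 : ℝ),
      ENNReal.ofReal (min (τ ^ (κ - 1)) (σ ^ (κ - 1))) * rearr volume f (ENNReal.ofReal σ)) *
        volume B := by
    refine h1.trans ?_
    have h4 := lintegral_mul_rpow_eq (μ := volume.restrict (Ioi (0 : ℝ)))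
      (w := fun σ : ℝ ↦ ENNReal.ofReal (min (τ ^ (κ - 1)) (σ ^ (κ - 1)))) (by fun_prop)
      (measurable_rearr_ofReal (μ := volume) f).aemeasurable one_pos
    simp only [ENNReal.rpow_one, ENNReal.ofReal_one, one_mul, sub_self, Real.rpow_zero,
      lt_rearr_iff] at h4
    rw [h4, mul_assoc, ← lintegral_mul_const' _ _ hBt.ne]
    rw [← lintegral_const_mul' _ _ ENNReal.coe_ne_top]
    refine setLIntegral_mono' measurableSet_Ioi fun t (ht : 0 < t) ↦ ?_
    refine (prod_measure_le hν (measurableSet_lt measurable_const hf) hB).trans ?_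
    gcongr
    refine le_trans ?_ (mul_le_mul_left (min_le_lintegral_indicator hκ hτ
      (hfin (ENNReal.ofReal t) (by simpa using ht)).ne) _)
    rw [min_mul_of_nonneg _ _ zero_le]
    refine min_le_min_left _ ?_
    rw [mul_right_comm]
    gcongr
    calc volume B ^ κ = volume B ^ (κ - 1) * volume B := by
          nth_rewrite 3 [← ENNReal.rpow_one (volume B)]
          rw [← ENNReal.rpow_add _ _ hB0 hBt.ne, sub_add_cancel]
      _ ≤ _ := by
          gcongr
          rw [← ENNReal.ofReal_rpow_of_pos hτ]
          rw [show κ - 1 = -(1 - κ) by ring, ENNReal.rpow_neg, ENNReal.rpow_neg]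
          exact ENNReal.inv_le_inv.2 (ENNReal.rpow_le_rpow hτB.le (by linarith))
  exact (ENNReal.mul_le_mul_iff_left hB0 hBt.ne).1 h3

lemma lintegral_min_rpow_lt_top {κ a : ℝ} (hκ : κ < a) (ha : a < 1) :
    ∫⁻ ρ in Ioi (0 : ℝ), ENNReal.ofReal (min 1 (ρ ^ (κ - 1)) * ρ ^ (-a)) < ∞ := by
  rw [← Ioc_union_Ioi_eq_Ioi zero_le_one, lintegral_union measurableSet_Ioi
    (Set.disjoint_left.2 fun x hx hx' ↦ absurd hx.2 (not_le.2 hx'))]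
  refine ENNReal.add_lt_top.2 ⟨?_, ?_⟩
  · refine lt_of_le_of_lt (setLIntegral_mono' (g := fun ρ ↦ ENNReal.ofReal (ρ ^ (-a)))
      measurableSet_Ioc fun ρ hρ ↦ ?_) ?_
    · refine ENNReal.ofReal_le_ofReal ?_
      exact mul_le_of_le_one_left (Real.rpow_nonneg hρ.1.le _) (min_le_left _ _)
    · have : IntegrableOn (fun ρ : ℝ ↦ ρ ^ (-a)) (Ioc 0 1) := by
        rw [← intervalIntegrable_iff_integrableOn_Ioc_of_le zero_le_one]
        exact intervalIntegral.intervalIntegrable_rpow' (by linarith)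
      exact this.lintegral_lt_top
  · refine lt_of_le_of_lt (setLIntegral_mono' (g := fun ρ ↦ ENNReal.ofReal (ρ ^ (κ - 1 - a)))
      measurableSet_Ioi fun ρ (hρ : 1 < ρ) ↦ ?_) ?_
    · refine ENNReal.ofReal_le_ofReal ?_
      rw [sub_eq_add_neg _ a, Real.rpow_add (by linarith)]
      gcongr
      exact min_le_right _ _
    · exact (integrableOn_Ioi_rpow_of_lt (by linarith) one_pos).lintegral_lt_top

/-- Cauchy–Schwarz with an auxiliary weight `u`, as in Schur's test. -/
lemma sq_lintegral_le {α : Type*} [MeasurableSpace α] {μ : Measure α} {w u f : α → ℝ≥0∞}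
    (hw : AEMeasurable w μ) (hu : AEMeasurable u μ) (hf : AEMeasurable f μ)
    (h0 : ∀ᵐ x ∂μ, u x ≠ 0) (ht : ∀ᵐ x ∂μ, u x ≠ ∞) :
    (∫⁻ x, w x * f x ∂μ) ^ 2 ≤ (∫⁻ x, w x * u x ∂μ) * ∫⁻ x, w x * (u x)⁻¹ * f x ^ 2 ∂μ := by
  have h := ENNReal.lintegral_mul_le_Lp_mul_Lq μ Real.HolderConjugate.two_two
    (f := fun x ↦ (w x * u x) ^ (1 / 2 : ℝ)) (g := fun x ↦ (w x * (u x)⁻¹ * f x ^ 2) ^ (1 / 2 : ℝ))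
    (by fun_prop) (by fun_prop)
  have e : ∀ z : ℝ≥0∞, (z ^ (1 / 2 : ℝ)) ^ (2 : ℝ) = z := fun z ↦ by
    rw [← ENNReal.rpow_mul]; norm_num
  simp_rw [e] at h
  calc (∫⁻ x, w x * f x ∂μ) ^ 2 ≤ ((∫⁻ x, w x * u x ∂μ) ^ (1 / 2 : ℝ) *
        (∫⁻ x, w x * (u x)⁻¹ * f x ^ 2 ∂μ) ^ (1 / 2 : ℝ)) ^ 2 := by
        gcongr
        refine le_trans (le_of_eq (lintegral_congr_ae ?_)) h
        filter_upwards [h0, ht] with x hx0 hxt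
        simp only [Pi.mul_apply]
        rw [← ENNReal.mul_rpow_of_nonneg _ _ (by norm_num)]
        rw [show w x * u x * (w x * (u x)⁻¹ * f x ^ 2) = (u x * (u x)⁻¹) * (w x * f x) ^ 2 by ring,
          ENNReal.mul_inv_cancel hx0 hxt, one_mul, ← ENNReal.rpow_two, ← ENNReal.rpow_mul]
        norm_num
    _ = _ := by
        rw [mul_pow, ← ENNReal.rpow_two, ← ENNReal.rpow_two, e, e]

/-- With σ = ρτ the homogeneous kernel becomes min(1, ρ^{κ-1}) acting on dilates. Cauchy–Schwarz
with the weight ρ^{-a} costs one factor of the constant. The dilate by ρ scales `lor` by ρ^{-2a},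
and integrating this against the remaining weight ρ^a gives the second factor. -/
lemma hardy_lor {α : Type*} [MeasurableSpace α] {μ : Measure α} {κ a : ℝ} (f : α → ℝ≥0∞) :
    ∫⁻ τ in Ioi (0 : ℝ), ENNReal.ofReal (τ ^ (2 * (a - κ) - 1)) *
      (∫⁻ σ in Ioi (0 : ℝ), ENNReal.ofReal (min (τ ^ (κ - 1)) (σ ^ (κ - 1))) *
        rearr μ f (ENNReal.ofReal σ)) ^ 2 ≤
    (∫⁻ ρ in Ioi (0 : ℝ), ENNReal.ofReal (min 1 (ρ ^ (κ - 1)) * ρ ^ (-a))) ^ 2 * lor μ a f := by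
  set W := ∫⁻ ρ in Ioi (0 : ℝ), ENNReal.ofReal (min 1 (ρ ^ (κ - 1)) * ρ ^ (-a)) with hW
  set F : ℝ → ℝ≥0∞ := fun σ ↦ rearr μ f (ENNReal.ofReal σ) with hF
  have hFm : Measurable F := measurable_rearr_ofReal f
  set m : ℝ → ℝ≥0∞ := fun ρ ↦ ENNReal.ofReal (min 1 (ρ ^ (κ - 1))) with hm
  have hmm : Measurable m := by fun_prop
  have hpos : ∀ᵐ ρ ∂(volume.restrict (Ioi (0 : ℝ))), 0 < ρ := ae_restrict_mem measurableSet_Ioi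
  have hstep : ∀ τ ∈ Ioi (0 : ℝ), ENNReal.ofReal (τ ^ (2 * (a - κ) - 1)) *
      (∫⁻ σ in Ioi (0 : ℝ), ENNReal.ofReal (min (τ ^ (κ - 1)) (σ ^ (κ - 1))) * F σ) ^ 2 ≤
      W * ∫⁻ ρ in Ioi (0 : ℝ), m ρ * ENNReal.ofReal (ρ ^ a) *
        (ENNReal.ofReal (τ ^ (2 * a - 1)) * F (ρ * τ) ^ 2) := by
    intro τ hτ
    have hτ : 0 < τ := hτ
    have e1 : ∫⁻ σ in Ioi (0 : ℝ), ENNReal.ofReal (min (τ ^ (κ - 1)) (σ ^ (κ - 1))) * F σ =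
        ENNReal.ofReal (τ ^ κ) * ∫⁻ ρ in Ioi (0 : ℝ), m ρ * F (ρ * τ) := by
      rw [lintegral_Ioi_comp_mul _ hτ, ← lintegral_const_mul' _ _ (by simp),
        ← lintegral_const_mul' _ _ (by simp)]
      refine setLIntegral_congr_fun measurableSet_Ioi fun ρ (hρ : 0 < ρ) ↦ ?_
      rw [Real.mul_rpow hτ.le hρ.le, mul_comm τ ρ]
      simp only [hm]
      rw [← mul_assoc, ← mul_assoc, ← ENNReal.ofReal_mul hτ.le,
        ← ENNReal.ofReal_mul (by positivity)]
      congr 2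
      have h0 : 0 ≤ τ ^ (κ - 1) := by positivity
      have h1 : min (τ ^ (κ - 1)) (τ ^ (κ - 1) * ρ ^ (κ - 1)) =
          τ ^ (κ - 1) * min 1 (ρ ^ (κ - 1)) := by
        rw [mul_min_of_nonneg _ _ h0, mul_one]
      rw [h1, ← mul_assoc, Real.rpow_sub_one hτ.ne']
      field_simp
    rw [e1, mul_pow, ← mul_assoc, ← ENNReal.ofReal_pow (by positivity),
      ← ENNReal.ofReal_mul (by positivity)]
    have e2 : τ ^ (2 * (a - κ) - 1) * (τ ^ κ) ^ 2 = τ ^ (2 * a - 1) := by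
      rw [← Real.rpow_natCast, ← Real.rpow_mul hτ.le, ← Real.rpow_add hτ]
      congr 1
      push_cast
      ring
    rw [e2]
    have h := sq_lintegral_le (μ := volume.restrict (Ioi (0 : ℝ))) (w := m)
      (u := fun ρ ↦ ENNReal.ofReal (ρ ^ (-a))) (f := fun ρ ↦ F (ρ * τ)) hmm.aemeasurable
      (by fun_prop) (by fun_prop)
      (by filter_upwards [hpos] with ρ hρ; simpa using Real.rpow_pos_of_pos hρ _)
      (by simp)
    have e3 : ∫⁻ ρ in Ioi (0 : ℝ), m ρ * ENNReal.ofReal (ρ ^ (-a)) = W := by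
      rw [hW]
      refine setLIntegral_congr_fun measurableSet_Ioi fun ρ (hρ : 0 < ρ) ↦ ?_
      simp only [hm]
      rw [← ENNReal.ofReal_mul (by positivity)]
    rw [e3] at h
    refine (mul_le_mul_right h _).trans (le_of_eq ?_)
    rw [mul_left_comm, ← lintegral_const_mul' _ _ (by simp)]
    congr 1
    refine setLIntegral_congr_fun measurableSet_Ioi fun ρ (hρ : 0 < ρ) ↦ ?_
    rw [← ENNReal.ofReal_inv_of_pos (by positivity), ← Real.rpow_neg hρ.le, neg_neg]
    ring
  refine (setLIntegral_mono' measurableSet_Ioi hstep).trans ?_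
  have hmeas : Measurable fun z : ℝ × ℝ ↦ m z.2 * ENNReal.ofReal (z.2 ^ a) *
      (ENNReal.ofReal (z.1 ^ (2 * a - 1)) * F (z.2 * z.1) ^ 2) := by fun_prop
  rw [lintegral_const_mul _ hmeas.lintegral_prod_right', sq, mul_assoc]
  gcongr
  rw [lintegral_lintegral_swap hmeas.aemeasurable, hW, ← lintegral_mul_const _ (by fun_prop)]
  refine le_of_eq (setLIntegral_congr_fun measurableSet_Ioi fun ρ (hρ : 0 < ρ) ↦ ?_)
  simp only
  rw [lintegral_const_mul' _ _ (ENNReal.mul_ne_top ENNReal.ofReal_ne_top ENNReal.ofReal_ne_top),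
    lor,
    lintegral_Ioi_comp_mul (fun τ ↦ ENNReal.ofReal (τ ^ (2 * a - 1)) *
      rearr μ f (ENNReal.ofReal τ) ^ 2) hρ, ← mul_assoc,
    ← lintegral_const_mul' _ _ (ENNReal.mul_ne_top ENNReal.ofReal_ne_top ENNReal.ofReal_ne_top), 
    ← lintegral_const_mul' _ _ (ENNReal.mul_ne_top ENNReal.ofReal_ne_top ENNReal.ofReal_ne_top)]
  refine setLIntegral_congr_fun measurableSet_Ioi fun τ (hτ : 0 < τ) ↦ ?_
  simp only [hF]
  rw [← mul_assoc, ← mul_assoc, ← ENNReal.ofReal_mul (by positivity),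
    ← ENNReal.ofReal_mul (by positivity), ← ENNReal.ofReal_mul (by positivity),
    ← ENNReal.ofReal_mul (by positivity), Real.mul_rpow hρ.le hτ.le]
  congr 2
  have : ρ ^ a = ρ ^ (-a) * ρ * ρ ^ (2 * a - 1) := by
    rw [← Real.rpow_add_one hρ.ne', ← Real.rpow_add hρ]
    congr 1
    ring
  rw [this]
  ring

/-- Hardy–Littlewood–Sobolev for measures of fractional dimension. The constant depends on ν only
through `C`; κ = 0 covers convolution with probability measures. -/
theorem lor_conv_le {κ a : ℝ} (hκ0 : 0 ≤ κ) (hκ : κ < a) (ha : a < 1) (C : ℝ≥0) :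
    ∃ C' : ℝ≥0, ∀ (ν : Measure (E d)) [SFinite ν],
      (∀ A, MeasurableSet A → ν A ≤ C * volume A ^ κ) → ∀ f : E d → ℝ≥0∞,
      AEMeasurable f → lor volume a f < ∞ →
      lor volume (a - κ) (fun x ↦ ∫⁻ y, f (y + x) ∂ν) ≤ C' * lor volume a f := by
  set W := ∫⁻ ρ in Ioi (0 : ℝ), ENNReal.ofReal (min 1 (ρ ^ (κ - 1)) * ρ ^ (-a)) with hW
  have hWt : W ≠ ∞ := (lintegral_min_rpow_lt_top hκ ha).ne
  refine ⟨C ^ 2 * W.toNNReal ^ 2, fun ν _ hν f hf hlor ↦ ?_⟩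
  -- Null sets of the sum y + x pull back to null sets of ν × volume, so a measurable representative
  -- of `f` changes the convolution only on a null set, even if ν is singular.
  have hqmp : Measure.QuasiMeasurePreserving (fun z : E d × E d ↦ z.1 + z.2)
      (ν.prod volume) volume :=
    Measure.quasiMeasurePreserving_snd.comp
      (measurePreserving_prod_add ν (volume : Measure (E d))).quasiMeasurePreserving
  have hcongr : (fun x ↦ ∫⁻ y, f (y + x) ∂ν) =ᵐ[volume] fun x ↦ ∫⁻ y, hf.mk f (y + x) ∂ν := by
    have h1 := hqmp.ae hf.ae_eq_mk
    have h2 := Measure.measurePreserving_swap.quasiMeasurePreserving.ae h1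
    have h3 := Measure.ae_ae_of_ae_prod h2
    filter_upwards [h3] with x hx
    exact lintegral_congr_ae hx
  have hfin : lor volume a (hf.mk f) < ∞ := by rwa [← lor_congr hf.ae_eq_mk]
  rw [lor_congr hcongr, lor_congr hf.ae_eq_mk]
  have hb := fun (τ : ℝ) (hτ : 0 < τ) ↦ rearr_conv_le (hκ.trans ha) hν hf.measurable_mk
    (fun s hs ↦ measure_lt_top_of_lor (hκ0.trans_lt hκ) hfin hs) hτ
  push_cast
  rw [ENNReal.coe_toNNReal hWt, mul_assoc]
  refine le_trans ?_ (mul_le_mul_right (hardy_lor (κ := κ) (a := a) (hf.mk f)) _)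
  rw [← lintegral_const_mul' _ _ (by simp), lor]
  refine setLIntegral_mono' measurableSet_Ioi fun τ (hτ : 0 < τ) ↦ ?_
  rw [mul_left_comm, ← mul_pow]
  gcongr
  exact hb τ hτ

end Hardy

/-! ### The Bessel kernel as a Gaussian mixture -/

section Bessel

open ProbabilityTheory

lemma gaussianReal_le_volume (A : Set ℝ) : gaussianReal 0 1 A ≤ volume A := by
  rw [gaussianReal_apply 0 one_ne_zero A]
  calc ∫⁻ x in A, gaussianPDF 0 1 x ≤ ∫⁻ x in A, 1 := by
        refine lintegral_mono fun x ↦ ?_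
        rw [gaussianPDF, gaussianPDFReal]
        refine ENNReal.ofReal_le_one.2 (mul_le_one₀ ?_ (by positivity) ?_)
        · refine inv_le_one_of_one_le₀ (Real.one_le_sqrt.2 ?_)
          have := Real.pi_gt_three
          simp only [NNReal.coe_one, mul_one]
          linarith
        · refine Real.exp_le_one_iff.2 ?_
          rw [neg_div]
          exact neg_nonpos.2 (by positivity)
    _ = volume A := by simp

lemma pi_gaussianReal_le_volume {d : ℕ} {A : Set (Fin d → ℝ)} (hA : MeasurableSet A) :
    Measure.pi (fun _ : Fin d ↦ gaussianReal 0 1) A ≤ volume A := by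
  -- `OuterMeasure.pi` is the largest outer measure bounded on boxes by the product of the side
  -- measures, so the one-dimensional comparison suffices.
  have h : (Measure.pi (fun _ : Fin d ↦ gaussianReal 0 1)).toOuterMeasure ≤
      OuterMeasure.pi fun _ : Fin d ↦ (volume : Measure ℝ).toOuterMeasure := by
    refine OuterMeasure.le_pi.2 fun s _ ↦ ?_
    rw [Measure.coe_toOuterMeasure, Measure.pi_pi]
    exact Finset.prod_le_prod' fun i _ ↦ gaussianReal_le_volume (s i)
  refine (h A).trans (le_of_eq ?_)
  rw [volume_pi, Measure.pi_def, toMeasure_apply _ _ hA]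

lemma stdGaussian_le_volume {d : ℕ} {A : Set (E d)} (hA : MeasurableSet A) :
    stdGaussian (E d) A ≤ volume A := by
  rw [← map_pi_eq_stdGaussian, Measure.map_apply (by fun_prop) hA,
    ← (PiLp.volume_preserving_toLp (Fin d)).measure_preimage hA.nullMeasurableSet]
  exact pi_gaussianReal_le_volume ((PiLp.volume_preserving_toLp (Fin d)).measurable hA)

/-- The law of `√(2 t) z`, where `t` has the `Γ(α/2, 1)` distribution and `z` is a standard
Gaussian vector; its density is the kernel of `S_{-α}`. -/
noncomputable def besselMeasure (d : ℕ) (α : ℝ) : Measure (E d) :=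
  ((gammaMeasure (α / 2) 1).prod (stdGaussian (E d))).map fun z ↦ Real.sqrt (2 * z.1) • z.2

lemma measurable_besselMap {d : ℕ} :
    Measurable fun z : ℝ × E d ↦ Real.sqrt (2 * z.1) • z.2 := by fun_prop

lemma isProbabilityMeasure_besselMeasure {d : ℕ} {α : ℝ} (hα : 0 < α) :
    IsProbabilityMeasure (besselMeasure d α) := by
  have : IsProbabilityMeasure (gammaMeasure (α / 2) 1) :=
    isProbabilityMeasure_gammaMeasure (by linarith) one_pos
  exact Measure.isProbabilityMeasure_map measurable_besselMap.aemeasurable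

lemma integral_exp_gammaMeasure {a s : ℝ} (ha : 0 < a) (hs : 0 ≤ s) :
    ∫ t, Real.exp (-(t * s)) ∂(gammaMeasure a 1) = (1 + s) ^ (-a) := by
  rw [gammaMeasure, integral_withDensity_eq_integral_toReal_smul (by
    unfold gammaPDF; fun_prop) (by simp [gammaPDF])]
  have e : ∀ t, (gammaPDF a 1 t).toReal • Real.exp (-(t * s)) =
      (Ici (0 : ℝ)).indicator (fun t ↦ (Real.Gamma a)⁻¹ *
        (t ^ (a - 1) * Real.exp (-((1 + s) * t)))) t := by
    intro t
    rcases lt_or_ge t 0 with ht | ht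
    · rw [gammaPDF_of_neg ht, indicator_of_notMem (by simpa using ht)]
      simp
    · have hG := Real.Gamma_pos_of_pos ha
      rw [gammaPDF_of_nonneg ht, indicator_of_mem (by simpa using ht),
        ENNReal.toReal_ofReal (by positivity), smul_eq_mul, Real.one_rpow, one_div, one_mul,
        mul_assoc, mul_assoc, ← Real.exp_add]
      congr 4
      ring
  simp_rw [e]
  rw [integral_indicator measurableSet_Ici, integral_const_mul, integral_Ici_eq_integral_Ioi,
    Real.integral_rpow_mul_exp_neg_mul_Ioi ha (by linarith), mul_comm, mul_assoc,
    mul_inv_cancel₀ (Real.Gamma_pos_of_pos ha).ne', mul_one, one_div,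
    Real.inv_rpow (by linarith), Real.rpow_neg (by linarith)]

lemma ae_gammaMeasure_pos (a : ℝ) : ∀ᵐ t ∂(gammaMeasure a 1), 0 < t := by
  rw [gammaMeasure, ae_withDensity_iff (by unfold gammaPDF; fun_prop)]
  have h : ∀ᵐ t : ℝ, t ≠ 0 := Measure.ae_ne volume 0
  filter_upwards [h] with t ht0 ht
  by_contra hcon
  exact ht (gammaPDF_of_neg (lt_of_le_of_ne (not_lt.1 hcon) ht0))

/-- Given t, the Gaussian √(2t) z has characteristic function exp(-t|ξ|²); averaging over t gives
the Laplace transform of the Gamma law, which is (1 + |ξ|²)^{-α/2}. -/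
lemma charFun_besselMeasure {d : ℕ} {α : ℝ} (hα : 0 < α) (ξ : E d) :
    charFun (besselMeasure d α) ξ = (((1 + ‖ξ‖ ^ 2) ^ (-α / 2) : ℝ) : ℂ) := by
  have : IsProbabilityMeasure (gammaMeasure (α / 2) 1) :=
    isProbabilityMeasure_gammaMeasure (by linarith) one_pos
  have hm : Continuous fun v : E d ↦ Complex.exp (inner ℝ v ξ * Complex.I) := by fun_prop
  rw [charFun_apply, besselMeasure,
    integral_map measurable_besselMap.aemeasurable hm.aestronglyMeasurable, integral_prod]
  · have e : ∀ᵐ t ∂(gammaMeasure (α / 2) 1),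
        ∫ z, Complex.exp (inner ℝ (Real.sqrt (2 * (t, z).1) • (t, z).2) ξ * Complex.I)
          ∂(stdGaussian (E d)) = ((Real.exp (-(t * ‖ξ‖ ^ 2)) : ℝ) : ℂ) := by
      filter_upwards [ae_gammaMeasure_pos (α / 2)] with t ht
      have h := charFun_stdGaussian (E := E d) (Real.sqrt (2 * t) • ξ)
      rw [charFun_apply] at h
      simp only [inner_smul_left, inner_smul_right] at h ⊢
      simp only [conj_trivial]
      rw [h, norm_smul, Real.norm_eq_abs]
      push_cast
      congr 1
      rw [mul_pow, ← Complex.ofReal_pow |Real.sqrt (2 * t)|, sq_abs, Real.sq_sqrt (by linarith)]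
      push_cast
      ring
    rw [integral_congr_ae e, integral_complex_ofReal,
      integral_exp_gammaMeasure (by linarith) (by positivity), neg_div]
  · refine Integrable.of_bound (C := 1) ?_ ?_
    · exact (hm.measurable.comp measurable_besselMap).aestronglyMeasurable
    · exact Filter.Eventually.of_forall fun z ↦ (Complex.norm_exp_ofReal_mul_I _).le

lemma exists_rpow_mul_exp_le (δ : ℝ) (hδ : 0 ≤ δ) :
    ∃ C : ℝ, 0 ≤ C ∧ ∀ t : ℝ, 0 ≤ t → t ^ δ * Real.exp (-t) ≤ C := by
  obtain ⟨n, hn⟩ := exists_nat_ge δ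
  refine ⟨1 + n.factorial, by positivity, fun t ht ↦ ?_⟩
  have h1 : t ^ δ ≤ 1 + t ^ n := by
    rcases le_total t 1 with h | h
    · exact (Real.rpow_le_one ht h hδ).trans (by have := pow_nonneg ht n; linarith)
    · calc t ^ δ ≤ t ^ (n : ℝ) := Real.rpow_le_rpow_of_exponent_le h hn
        _ ≤ _ := by rw [Real.rpow_natCast]; linarith
  have h2 := Real.pow_div_factorial_le_exp t ht n
  rw [div_le_iff₀ (by positivity)] at h2
  have h3 := Real.one_le_exp ht
  rw [Real.exp_neg, ← div_eq_mul_inv, div_le_iff₀ (Real.exp_pos t)]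
  linarith

lemma lintegral_rpow_min_lt_top {b c : ℝ} (hb : 0 < b) (hbc : b < c) :
    ∫⁻ s in Ioi (0 : ℝ), ENNReal.ofReal (s ^ (b - 1) * min 1 (s ^ (-c))) < ∞ := by
  rw [← Ioc_union_Ioi_eq_Ioi zero_le_one, lintegral_union measurableSet_Ioi
    (Set.disjoint_left.2 fun x hx hx' ↦ absurd hx.2 (not_le.2 hx'))]
  refine ENNReal.add_lt_top.2 ⟨?_, ?_⟩
  · refine lt_of_le_of_lt (setLIntegral_mono' (g := fun ρ ↦ ENNReal.ofReal (ρ ^ (b - 1)))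
      measurableSet_Ioc fun ρ hρ ↦ ?_) ?_
    · refine ENNReal.ofReal_le_ofReal ?_
      exact mul_le_of_le_one_right (Real.rpow_nonneg hρ.1.le _) (min_le_left _ _)
    · have : IntegrableOn (fun ρ : ℝ ↦ ρ ^ (b - 1)) (Ioc 0 1) := by
        rw [← intervalIntegrable_iff_integrableOn_Ioc_of_le zero_le_one]
        exact intervalIntegral.intervalIntegrable_rpow' (by linarith)
      exact this.lintegral_lt_top
  · refine lt_of_le_of_lt (setLIntegral_mono' (g := fun ρ ↦ ENNReal.ofReal (ρ ^ (b - 1 - c)))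
      measurableSet_Ioi fun ρ (hρ : 1 < ρ) ↦ ?_) ?_
    · refine ENNReal.ofReal_le_ofReal ?_
      rw [sub_eq_add_neg _ c, Real.rpow_add (by linarith)]
      gcongr
      exact min_le_right _ _
    · exact (integrableOn_Ioi_rpow_of_lt (by linarith) one_pos).lintegral_lt_top

/-- For fixed t the conditional law is a probability measure, and scaling `stdGaussian_le_volume`
bounds it by (2t)^{-d/2} times volume. -/
lemma besselMeasure_apply_le {d : ℕ} {α : ℝ} (hα : 0 < α) {A : Set (E d)} (hA : MeasurableSet A) :
    besselMeasure d α A ≤ ∫⁻ t in Ioi (0 : ℝ), gammaPDF (α / 2) 1 t *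
      min 1 (ENNReal.ofReal ((2 * t) ^ (-((d : ℝ) / 2))) * volume A) := by
  have : IsProbabilityMeasure (gammaMeasure (α / 2) 1) :=
    isProbabilityMeasure_gammaMeasure (by linarith) one_pos
  have hpdf : Measurable (gammaPDF (α / 2) 1) := by unfold gammaPDF; fun_prop
  rw [besselMeasure, Measure.map_apply measurable_besselMap hA,
    Measure.prod_apply (measurable_besselMap hA)]
  calc _ ≤ ∫⁻ t, min 1 (ENNReal.ofReal ((2 * t) ^ (-((d : ℝ) / 2))) * volume A)
        ∂(gammaMeasure (α / 2) 1) := by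
        refine lintegral_mono_ae ?_
        filter_upwards [ae_gammaMeasure_pos (α / 2)] with t ht
        refine le_min prob_le_one ?_
        have hs : 0 < Real.sqrt (2 * t) := Real.sqrt_pos.2 (by linarith)
        have hmeas : MeasurableSet ((fun z : E d ↦ Real.sqrt (2 * t) • z) ⁻¹' A) :=
          hA.preimage (by fun_prop)
        refine (stdGaussian_le_volume hmeas).trans (le_of_eq ?_)
        rw [Measure.addHaar_preimage_smul _ hs.ne', finrank_euclideanSpace, Fintype.card_fin]
        congr 2
        rw [abs_of_pos (by positivity), Real.sqrt_eq_rpow, ← Real.rpow_natCast,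
          ← Real.rpow_mul (by linarith), ← Real.rpow_neg (by linarith)]
        congr 1
        ring
    _ = _ := by
        rw [← Measure.restrict_eq_self_of_ae_mem (ae_gammaMeasure_pos (α / 2)), gammaMeasure]
        change ∫⁻ t in Ioi (0 : ℝ), _ ∂_ = _
        rw [restrict_withDensity measurableSet_Ioi, lintegral_withDensity_eq_lintegral_mul _ hpdf
          (by fun_prop)]
        rfl

/-- Scaling t by |A|^{2/d} in the previous bound extracts |A|^κ. The remaining integral converges at
0 since κ > 0 and at infinity since κ < 1; the case κ = 0 is the total mass. -/
theorem besselMeasure_le_rpow {d : ℕ} {α κ : ℝ} (hd : 0 < d) (hα : 0 < α) (hκ0 : 0 ≤ κ)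
    (hκ1 : κ < 1)
    (hκ : κ ≤ α / d) :
    ∃ C : ℝ≥0, ∀ A : Set (E d), MeasurableSet A → besselMeasure d α A ≤ C * volume A ^ κ := by
  have := isProbabilityMeasure_besselMeasure (d := d) hα
  have hd' : (0 : ℝ) < d := by exact_mod_cast hd
  rcases hκ0.eq_or_lt with rfl | hκ0
  · exact ⟨1, fun A _ ↦ by simpa using prob_le_one⟩
  -- The Gamma density t^{α/2-1}e^{-t} is at most a constant times t^{b-1} because b ≤ α/2, and t^b
  -- scales to |A|^κ. The endpoint κ = α/d is b = α/2.
  set b : ℝ := d * κ / 2 with hb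
  have hb0 : 0 < b := by positivity
  have hbα : b ≤ α / 2 := by
    rw [le_div_iff₀ hd'] at hκ
    rw [hb]; linarith
  obtain ⟨C₀, hC₀, hC₀'⟩ := exists_rpow_mul_exp_le (α / 2 - b) (by linarith)
  have hG := Real.Gamma_pos_of_pos (show 0 < α / 2 by linarith)
  set M : ℝ := (Real.Gamma (α / 2))⁻¹ * C₀ with hM
  have hM0 : 0 ≤ M := by positivity
  set J := ∫⁻ s in Ioi (0 : ℝ), ENNReal.ofReal (s ^ (b - 1) * min 1 (s ^ (-((d : ℝ) / 2)))) with hJ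
  have hJt : J < ∞ := lintegral_rpow_min_lt_top hb0 (by rw [hb]; nlinarith)
  -- The summand 1 keeps the constant nonzero, so that the bound is ∞ when |A| = ∞.
  refine ⟨1 + M.toNNReal * J.toNNReal, fun A hA ↦ ?_⟩
  rcases eq_or_ne (volume A) ∞ with hAt | hAt
  · rw [hAt, ENNReal.top_rpow_of_pos hκ0, ENNReal.mul_top (by push_cast; simp)]
    exact le_top
  refine (besselMeasure_apply_le hα hA).trans ?_
  rcases eq_or_ne (volume A) 0 with hA0 | hA0
  · simp [hA0]
  set v := (volume A).toReal with hv
  have hv0 : 0 < v := ENNReal.toReal_pos hA0 hAt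
  have hvA : volume A = ENNReal.ofReal v := (ENNReal.ofReal_toReal hAt).symm
  set r : ℝ := v ^ (2 / (d : ℝ)) with hr
  have hr0 : 0 < r := by positivity
  have hrv : r ^ (-((d : ℝ) / 2)) * v = 1 := by
    rw [hr, ← Real.rpow_mul hv0.le, show 2 / (d : ℝ) * -(d / 2) = -1 by field_simp,
      Real.rpow_neg_one, inv_mul_cancel₀ hv0.ne']
  have hrb : r ^ b = v ^ κ := by
    rw [hr, ← Real.rpow_mul hv0.le]
    congr 1
    rw [hb]; field_simp
  calc _ ≤ ∫⁻ t in Ioi (0 : ℝ), ENNReal.ofReal (M * (t ^ (b - 1) *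
        min 1 (t ^ (-((d : ℝ) / 2)) * v))) := by
        refine setLIntegral_mono' measurableSet_Ioi fun t (ht : 0 < t) ↦ ?_
        rw [gammaPDF_of_nonneg ht.le, hvA, ← ENNReal.ofReal_mul (by positivity),
          ← ENNReal.ofReal_one, ← ENNReal.ofReal_min, ← ENNReal.ofReal_mul (by positivity)]
        refine ENNReal.ofReal_le_ofReal ?_
        rw [← mul_assoc]
        refine mul_le_mul ?_ (min_le_min_left _ ?_) (by positivity) (by positivity)
        · have := hC₀' t ht.le
          have e : t ^ (α / 2 - 1) = t ^ (α / 2 - b) * t ^ (b - 1) := by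
            rw [← Real.rpow_add ht]; congr 1; ring
          rw [e, Real.one_rpow, one_div, one_mul, hM]
          calc _ = (Real.Gamma (α / 2))⁻¹ * (t ^ (α / 2 - b) * Real.exp (-t)) * t ^ (b - 1) := by
                ring
            _ ≤ _ := by gcongr
        · refine mul_le_mul_of_nonneg_right ?_ hv0.le
          exact Real.rpow_le_rpow_of_nonpos ht (by linarith) (by linarith)
    _ = ENNReal.ofReal M * (ENNReal.ofReal (v ^ κ) * J) := by
        rw [lintegral_Ioi_comp_mul _ hr0, hJ, ← lintegral_const_mul' _ _ (by simp),
          ← lintegral_const_mul' _ _ (by simp), ← lintegral_const_mul' _ _ (by simp)]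
        refine setLIntegral_congr_fun measurableSet_Ioi fun s (hs : 0 < s) ↦ ?_
        rw [← ENNReal.ofReal_mul hr0.le, ← ENNReal.ofReal_mul (by positivity),
          ← ENNReal.ofReal_mul hM0]
        congr 1
        rw [Real.mul_rpow hr0.le hs.le, Real.mul_rpow hr0.le hs.le,
          mul_right_comm (r ^ (-((d : ℝ) / 2))), hrv,
          one_mul, ← hrb, Real.rpow_sub_one hr0.ne']
        field_simp
    _ ≤ _ := by
        rw [hvA, ENNReal.ofReal_rpow_of_pos hv0]
        push_cast
        rw [ENNReal.coe_toNNReal hJt.ne, add_mul, mul_left_comm, mul_comm (ENNReal.ofReal (v ^ κ))]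
        exact le_add_self

end Bessel

/-! ### Bessel potentials of Schwartz functions -/

section Schwartz

open FourierTransform ProbabilityTheory

variable {d : ℕ}

/-- The symbol of `S_α`. -/
noncomputable def besselSymbol (d : ℕ) (α : ℝ) (ξ : E d) : ℂ :=
  (((1 + ‖(2 * Real.pi) • ξ‖ ^ 2) ^ (α / 2) : ℝ) : ℂ)

lemma besselSymbol_hasTemperateGrowth (α : ℝ) : (besselSymbol d α).HasTemperateGrowth :=
  S_symbol_hasTemperateGrowth α

/-- The action of `S_α` on test functions. -/
noncomputable def besselS (α : ℝ) (φ : 𝓢(E d, ℂ)) : 𝓢(E d, ℂ) :=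
  𝓕 (SchwartzMap.smulLeftCLM ℂ (besselSymbol d α) (𝓕⁻ φ))

lemma S_apply_apply (α : ℝ) (T : 𝓢'(E d, ℂ)) (φ : 𝓢(E d, ℂ)) : S α T φ = T (besselS α φ) := rfl

lemma besselS_besselS (α β : ℝ) (φ : 𝓢(E d, ℂ)) :
    besselS α (besselS β φ) = besselS (α + β) φ := by
  rw [besselS, besselS, fourierInv_fourier_eq, SchwartzMap.smulLeftCLM_smulLeftCLM_apply
    (besselSymbol_hasTemperateGrowth _) (besselSymbol_hasTemperateGrowth _), besselS]
  congr 3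
  ext ξ
  simp only [Pi.mul_apply, besselSymbol]
  rw [← Complex.ofReal_mul, ← Real.rpow_add (by positivity), add_div]

lemma besselS_zero (φ : 𝓢(E d, ℂ)) : besselS 0 φ = φ := by
  have : besselSymbol d 0 = fun _ ↦ 1 := by
    ext ξ; simp [besselSymbol]
  rw [besselS, this, SchwartzMap.smulLeftCLM_const]
  simp

lemma S_S (α β : ℝ) (T : 𝓢'(E d, ℂ)) : S α (S β T) = S (α + β) T := by
  ext φ
  rw [S_apply_apply, S_apply_apply, S_apply_apply, besselS_besselS, add_comm]

lemma S_zero (T : 𝓢'(E d, ℂ)) : S 0 T = T := by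
  ext φ
  rw [S_apply_apply, besselS_zero]

/-- A Fourier multiplier which is the characteristic function of a finite measure acts as
convolution with it, by Fubini. -/
lemma fourier_smulLeft_fourierInv_apply {ν : Measure (E d)} [IsFiniteMeasure ν] {g : E d → ℂ}
    (hg : g.HasTemperateGrowth) (hν : ∀ ξ, charFun ν ((2 * Real.pi) • ξ) = g ξ)
    (φ : 𝓢(E d, ℂ)) (x : E d) :
    (𝓕 (SchwartzMap.smulLeftCLM ℂ g (𝓕⁻ φ)) : 𝓢(E d, ℂ)) x = ∫ y, φ (x - y) ∂ν := by
  set ψ : 𝓢(E d, ℂ) := 𝓕⁻ φ with hψ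
  have hφψ : φ = 𝓕 ψ := by rw [hψ, fourier_fourierInv_eq]
  have e1 : ∀ y, φ (x - y) = ∫ ξ, Complex.exp (↑(-2 * Real.pi * inner ℝ ξ (x - y)) * Complex.I) *
      ψ ξ := by
    intro y
    rw [hφψ, SchwartzMap.fourier_coe, Real.fourier_eq']
    rfl
  simp_rw [e1]
  rw [integral_integral_swap]
  · rw [SchwartzMap.fourier_coe, Real.fourier_eq']
    refine integral_congr_ae (Filter.Eventually.of_forall fun ξ ↦ ?_)
    simp only
    rw [SchwartzMap.smulLeftCLM_apply_apply hg, integral_mul_const, ← hν, charFun_apply,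
      smul_eq_mul, smul_eq_mul, ← mul_assoc, ← integral_const_mul]
    congr 1
    refine integral_congr_ae (Filter.Eventually.of_forall fun y ↦ ?_)
    simp only
    rw [← Complex.exp_add, inner_sub_right, inner_smul_right, real_inner_comm y ξ]
    congr 1
    push_cast
    ring
  · have hc : Continuous fun z : E d × E d ↦
        Complex.exp (↑(-2 * Real.pi * inner ℝ z.2 (x - z.1)) * Complex.I) := by fun_prop
    have hi : Integrable (fun z : E d × E d ↦ ψ z.2) (ν.prod volume) := ψ.integrable.comp_snd ν
    refine hi.bdd_mul (c := 1) hc.aestronglyMeasurable (Filter.Eventually.of_forall fun z ↦ ?_)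
    exact (Complex.norm_exp_ofReal_mul_I _).le

lemma besselS_neg_apply {α : ℝ} (hα : 0 < α) (φ : 𝓢(E d, ℂ)) (x : E d) :
    besselS (-α) φ x = ∫ y, φ (x - y) ∂(besselMeasure d α) := by
  have := isProbabilityMeasure_besselMeasure (d := d) hα
  exact fourier_smulLeft_fourierInv_apply (besselSymbol_hasTemperateGrowth _)
    (fun ξ ↦ charFun_besselMeasure hα _) φ x

/-- The symbol is even, so the reflected measure represents the same multiplier. -/
lemma besselS_neg_apply' {α : ℝ} (hα : 0 < α) (φ : 𝓢(E d, ℂ)) (x : E d) :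
    besselS (-α) φ x = ∫ y, φ (x + y) ∂(besselMeasure d α) := by
  have := isProbabilityMeasure_besselMeasure (d := d) hα
  have hm : Measurable fun y : E d ↦ (-1 : ℝ) • y := by fun_prop
  have := Measure.isFiniteMeasure_map (besselMeasure d α) fun y : E d ↦ (-1 : ℝ) • y
  have h := fourier_smulLeft_fourierInv_apply (ν := (besselMeasure d α).map fun y ↦ (-1 : ℝ) • y)
    (besselSymbol_hasTemperateGrowth (-α)) (fun ξ ↦ by
      rw [charFun_map_smul, charFun_besselMeasure hα, besselSymbol, norm_smul]
      simp) φ x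
  refine h.trans ?_
  rw [integral_map hm.aemeasurable]
  · simp
  · exact (φ.continuous.comp (by fun_prop)).aestronglyMeasurable

end Schwartz

/-! ### Functions as tempered distributions -/

section Distributions

variable {d : ℕ}

/-- Functions which belong to `L¹ + L^∞`, expressed by duality. -/
def Tame (f : E d → ℂ) : Prop :=
  AEStronglyMeasurable f volume ∧ ∃ C : ℝ≥0, ∀ φ : E d → ℝ≥0∞, AEMeasurable φ →
    ∀ M, (∀ x, φ x ≤ M) → ∫⁻ x, ‖f x‖ₑ * φ x ≤ C * (M + ∫⁻ x, φ x)

lemma tame_of_weak {a : ℝ} (ha : 0 < a) (ha1 : a < 1) {f : E d → ℂ}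
    (hf : AEStronglyMeasurable f volume) {K : ℝ≥0∞} (hKt : K ≠ ∞)
    (hK : ∀ τ : ℝ, 0 < τ → rearr volume (fun x ↦ ‖f x‖ₑ) (ENNReal.ofReal τ) ≤
      K * ENNReal.ofReal (τ ^ (-a))) : Tame f := by
  refine ⟨hf, (2 * K * (ENNReal.ofReal (1 / (1 - a)) + ENNReal.ofReal (1 / a))).toNNReal,
    fun φ hφ M hM ↦ ?_⟩
  rw [ENNReal.coe_toNNReal (by finiteness)]
  refine (lintegral_mul_le_of_weak ha ha1 hf.enorm hφ hK hM).trans ?_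
  rw [mul_assoc _ _ (M + _)]
  gcongr
  rw [mul_add]
  gcongr
  · exact le_self_add
  · exact le_add_self

lemma tame_of_lor {a : ℝ} (ha : 0 < a) (ha1 : a < 1) {f : E d → ℂ}
    (hf : AEStronglyMeasurable f volume) (h : lor volume a (fun x ↦ ‖f x‖ₑ) < ∞) : Tame f :=
  tame_of_weak ha ha1 hf (ENNReal.rpow_ne_top_of_nonneg (by norm_num)
    (ENNReal.mul_lt_top ENNReal.ofReal_lt_top h).ne) fun _ hτ ↦ rearr_le_of_lor ha _ hτ

lemma schwartz_enorm_le (φ : 𝓢(E d, ℂ)) (x : E d) :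
    ‖φ x‖ₑ ≤ ENNReal.ofReal (SchwartzMap.seminorm ℂ 0 0 φ) := by
  rw [← ofReal_norm]
  exact ENNReal.ofReal_le_ofReal (φ.norm_le_seminorm ℂ x)

lemma Tame.integrable {f : E d → ℂ} (hf : Tame f) (φ : 𝓢(E d, ℂ)) :
    Integrable fun x ↦ φ x * f x := by
  obtain ⟨hm, C, hC⟩ := hf
  refine ⟨φ.continuous.aestronglyMeasurable.mul hm, ?_⟩
  rw [HasFiniteIntegral]
  simp_rw [enorm_mul, mul_comm ‖φ _‖ₑ]
  refine lt_of_le_of_lt (hC _ φ.continuous.enorm.aemeasurable _ (schwartz_enorm_le φ)) ?_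
  exact ENNReal.mul_lt_top (by simp) (ENNReal.add_lt_top.2 ⟨by simp, φ.integrable.2⟩)

/-- The functional is controlled by the sup norm and the L¹ norm of the test function, both of which
are bounded by Schwartz seminorms. -/
lemma Tame.exists_isFun {f : E d → ℂ} (hf : Tame f) : ∃ T : 𝓢'(E d, ℂ), IsFun T f := by
  have hint := hf.integrable
  obtain ⟨hm, C, hC⟩ := id hf
  obtain ⟨k, D, hD⟩ := SchwartzMap.eLpNorm_le_seminorm (E := E d) ℂ ℂ 1
  have hbound : ∃ (s : Finset (ℕ × ℕ)) (c : ℝ), 0 ≤ c ∧ ∀ φ : 𝓢(E d, ℂ),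
      ‖∫ x, φ x * f x‖ ≤ c * s.sup (schwartzSeminormFamily ℂ (E d) ℂ) φ := by
    refine ⟨Finset.Iic (k, 0), C * (1 + D), by positivity, fun φ ↦ ?_⟩
    set s := (Finset.Iic (k, 0)).sup (schwartzSeminormFamily ℂ (E d) ℂ) φ with hs
    have hs0 : 0 ≤ s := apply_nonneg _ _
    have h0 : SchwartzMap.seminorm ℂ 0 0 φ ≤ s := by
      have : schwartzSeminormFamily ℂ (E d) ℂ (0, 0) ≤
          (Finset.Iic (k, 0)).sup (schwartzSeminormFamily ℂ (E d) ℂ) :=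
        Finset.le_sup (f := schwartzSeminormFamily ℂ (E d) ℂ) (by simp [Prod.le_def])
      exact this φ
    have h1 : ENNReal.ofReal ‖∫ x, φ x * f x‖ ≤ ENNReal.ofReal (C * (1 + D) * s) := by
      rw [ofReal_norm]
      calc _ ≤ ∫⁻ x, ‖φ x * f x‖ₑ := enorm_integral_le_lintegral_enorm _
        _ = ∫⁻ x, ‖f x‖ₑ * ‖φ x‖ₑ := by simp_rw [enorm_mul, mul_comm ‖φ _‖ₑ]
        _ ≤ C * (ENNReal.ofReal s + ∫⁻ x, ‖φ x‖ₑ) :=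
          hC _ φ.continuous.enorm.aemeasurable _ fun x ↦
            (schwartz_enorm_le φ x).trans (ENNReal.ofReal_le_ofReal h0)
        _ ≤ C * (ENNReal.ofReal s + D * ENNReal.ofReal s) := by
          gcongr
          rw [← eLpNorm_one_eq_lintegral_enorm]
          exact hD φ
        _ = _ := by
          rw [ENNReal.ofReal_mul (by positivity), ENNReal.ofReal_mul (by positivity),
            ENNReal.ofReal_add zero_le_one (by positivity)]
          simp only [ENNReal.ofReal_coe_nnreal, ENNReal.ofReal_one]
          ring
    exact (ENNReal.ofReal_le_ofReal_iff (by positivity)).1 h1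
  refine ⟨ContinuousLinearMap.toPointwiseConvergenceCLM _ _ _ _
    (SchwartzMap.mkCLMtoNormedSpace (𝕜 := ℂ) (𝕜' := ℂ) (σ := RingHom.id ℂ)
      (fun φ : 𝓢(E d, ℂ) ↦ ∫ x, φ x * f x) ?_ ?_ hbound),
    hm, fun φ ↦ ⟨hint φ, rfl⟩⟩
  · intro φ ψ
    rw [← integral_add (hint φ) (hint ψ)]
    simp [add_mul]
  · intro c φ
    simp only [smul_apply, smul_eq_mul, mul_assoc, RingHom.id_apply]
    exact integral_const_mul _ _

lemma IsFun.locallyIntegrable {T : 𝓢'(E d, ℂ)} {f : E d → ℂ} (hf : IsFun T f) :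
    LocallyIntegrable f := by
  intro x
  let b : ContDiffBump (0 : E d) := ⟨‖x‖ + 1, ‖x‖ + 2, by positivity, by linarith⟩
  have hb : ContDiff ℝ (⊤ : ℕ∞) fun y ↦ ((b y : ℝ) : ℂ) :=
    Complex.ofRealCLM.contDiff.comp b.contDiff
  have hbc : HasCompactSupport fun y ↦ ((b y : ℝ) : ℂ) :=
    b.hasCompactSupport.comp_left Complex.ofReal_zero
  have h := (hf.2 (hbc.toSchwartzMap hb)).1
  refine ⟨Metric.ball 0 (‖x‖ + 1), Metric.isOpen_ball.mem_nhds (by simp), ?_⟩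
  refine (h.integrableOn (s := Metric.ball 0 (‖x‖ + 1))).congr_fun (fun y hy ↦ ?_)
    measurableSet_ball
  have : b y = 1 := b.one_of_mem_closedBall (Metric.ball_subset_closedBall hy)
  change ((b y : ℝ) : ℂ) * f y = f y
  rw [this]
  simp

lemma IsFun.ae_eq {T : 𝓢'(E d, ℂ)} {f g : E d → ℂ} (hf : IsFun T f) (hg : IsFun T g) :
    f =ᵐ[volume] g := by
  refine ae_eq_of_integral_contDiff_smul_eq hf.locallyIntegrable hg.locallyIntegrable
    fun b hb hbc ↦ ?_
  have hb' : ContDiff ℝ (⊤ : ℕ∞) fun y ↦ ((b y : ℝ) : ℂ) := Complex.ofRealCLM.contDiff.comp hb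
  have hbc' : HasCompactSupport fun y ↦ ((b y : ℝ) : ℂ) := hbc.comp_left Complex.ofReal_zero
  have h1 := (hf.2 (hbc'.toSchwartzMap hb')).2
  have h2 := (hg.2 (hbc'.toSchwartzMap hb')).2
  exact h1.symm.trans h2

lemma IsFun.congr {T : 𝓢'(E d, ℂ)} {f g : E d → ℂ} (hf : IsFun T f) (h : f =ᵐ[volume] g) :
    IsFun T g := by
  refine ⟨hf.1.congr h, fun φ ↦ ?_⟩
  have e : (fun x ↦ φ x * f x) =ᵐ[volume] fun x ↦ φ x * g x := by
    filter_upwards [h] with x hx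
    rw [hx]
  exact ⟨(hf.2 φ).1.congr e, (hf.2 φ).2.trans (integral_congr_ae e)⟩

lemma IsFun.dist_ext {T U : 𝓢'(E d, ℂ)} {f : E d → ℂ} (hT : IsFun T f) (hU : IsFun U f) :
    T = U := by
  ext φ
  rw [(hT.2 φ).2, (hU.2 φ).2]

lemma IsFun.mulMu {T : 𝓢'(E d, ℂ)} {f : E d → ℂ} (hT : IsFun T f) (N : ℝ) {γ : ℝ} (hγ : 0 < γ) :
    IsFun (mulMu N γ T) fun x ↦ (mu N γ x : ℂ) * f x := by
  have hg := mu_hasTemperateGrowth (d := d) N hγ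
  refine ⟨hg.1.continuous.aestronglyMeasurable.mul hT.1, fun φ ↦ ?_⟩
  have h := hT.2 (SchwartzMap.smulLeftCLM ℂ (fun x : E d ↦ (mu N γ x : ℂ)) φ)
  simp only [SchwartzMap.smulLeftCLM_apply_apply hg, smul_eq_mul] at h
  have e : (fun x ↦ (mu N γ x : ℂ) * φ x * f x) = fun x ↦ φ x * ((mu N γ x : ℂ) * f x) := by
    ext x; ring
  rw [e] at h
  exact h

lemma quasiMeasurePreserving_add (ν : Measure (E d)) [SFinite ν] :
    Measure.QuasiMeasurePreserving (fun z : E d × E d ↦ z.1 + z.2) (ν.prod volume) volume :=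
  Measure.quasiMeasurePreserving_snd.comp
    (measurePreserving_prod_add ν (volume : Measure (E d))).quasiMeasurePreserving

lemma aestronglyMeasurable_conv {ν : Measure (E d)} [SFinite ν] {f : E d → ℂ}
    (hf : AEStronglyMeasurable f volume) :
    AEStronglyMeasurable (fun x ↦ ∫ y, f (y + x) ∂ν) volume :=
  ((hf.comp_quasiMeasurePreserving (quasiMeasurePreserving_add ν)).prod_swap).integral_prod_right'

/-- Fubini, after moving S_{-α} to the test function, with the shear (y, x) ↦ (y, y + x) as change
of variables. -/
lemma Tame.isFun_S_neg {α : ℝ} (hα : 0 < α) {T : 𝓢'(E d, ℂ)} {f : E d → ℂ} (hT : IsFun T f)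
    (hf : Tame f) : IsFun (S (-α) T) fun x ↦ ∫ y, f (y + x) ∂(besselMeasure d α) := by
  have := isProbabilityMeasure_besselMeasure (d := d) hα
  set ν := besselMeasure d α with hν
  refine ⟨aestronglyMeasurable_conv hf.1, fun φ ↦ ?_⟩
  have hφm : Continuous fun z : E d × E d ↦ φ (z.2 - z.1) := φ.continuous.comp (by fun_prop)
  have hm : AEStronglyMeasurable (fun z : E d × E d ↦ φ (z.2 - z.1) * f z.2) (ν.prod volume) :=
    hφm.aestronglyMeasurable.mul hf.1.comp_snd
  have hI : Integrable (fun z : E d × E d ↦ φ (z.2 - z.1) * f z.2) (ν.prod volume) := by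
    refine ⟨hm, ?_⟩
    rw [HasFiniteIntegral, lintegral_prod_symm _ hm.enorm]
    obtain ⟨-, C, hC⟩ := hf
    have hΦm : Measurable fun x ↦ ∫⁻ y, ‖φ (x - y)‖ₑ ∂ν := by
      have : Measurable fun z : E d × E d ↦ ‖φ (z.2 - z.1)‖ₑ := hφm.enorm.measurable
      exact this.lintegral_prod_left'
    have e : ∀ x, ∫⁻ y, ‖φ ((y, x).2 - (y, x).1) * f (y, x).2‖ₑ ∂ν =
        ‖f x‖ₑ * ∫⁻ y, ‖φ (x - y)‖ₑ ∂ν := by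
      intro x
      simp_rw [enorm_mul]
      rw [lintegral_mul_const _ (by
        exact (φ.continuous.comp (by fun_prop : Continuous fun y ↦ x - y)).enorm.measurable),
        mul_comm]
    simp_rw [e]
    -- The convolution of |φ| with a probability measure has the sup bound and the integral of |φ|,
    -- so tameness gives absolute integrability.
    refine lt_of_le_of_lt (hC _ hΦm.aemeasurable
      (ENNReal.ofReal (SchwartzMap.seminorm ℂ 0 0 φ)) fun x ↦ ?_) ?_
    · calc _ ≤ ∫⁻ y, ENNReal.ofReal (SchwartzMap.seminorm ℂ 0 0 φ) ∂ν :=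
            lintegral_mono fun y ↦ schwartz_enorm_le φ _
        _ = _ := by simp
    · refine ENNReal.mul_lt_top (by simp) (ENNReal.add_lt_top.2 ⟨by simp, ?_⟩)
      rw [lintegral_lintegral_swap (by
        exact ((φ.continuous.comp (by fun_prop : Continuous fun z : E d × E d ↦ z.1 - z.2)).enorm
          ).aemeasurable)]
      have e2 : ∀ y, ∫⁻ x, ‖φ (x - y)‖ₑ = ∫⁻ x, ‖φ x‖ₑ := fun y ↦
        lintegral_sub_right_eq_self (fun x ↦ ‖φ x‖ₑ) y
      simp_rw [e2]
      have := φ.integrable (μ := volume).2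
      rw [HasFiniteIntegral] at this
      simpa using this
  have hmp := measurePreserving_prod_add ν (volume : Measure (E d))
  have hI2 : Integrable (fun z : E d × E d ↦ φ z.2 * f (z.1 + z.2)) (ν.prod volume) := by
    have := hmp.integrable_comp_of_integrable hI
    refine this.congr (Filter.Eventually.of_forall fun z ↦ ?_)
    simp
  have hswap := hI2.swap
  constructor
  · refine hswap.integral_prod_left.congr (Filter.Eventually.of_forall fun x ↦ ?_)
    simp only [Function.comp_apply, Prod.swap_prod_mk]
    exact integral_const_mul _ _
  · rw [S_apply_apply, (hT.2 _).2]
    calc ∫ x, besselS (-α) φ x * f x = ∫ x, ∫ y, φ (x - y) * f x ∂ν := by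
          refine integral_congr_ae (Filter.Eventually.of_forall fun x ↦ ?_)
          simp only
          rw [besselS_neg_apply hα, integral_mul_const]
      _ = ∫ z, φ (z.2 - z.1) * f z.2 ∂(ν.prod volume) := (integral_prod_symm _ hI).symm
      _ = ∫ z, φ z.2 * f (z.1 + z.2) ∂(ν.prod volume) := by
          have h := integral_map (μ := ν.prod volume) hmp.measurable.aemeasurable
            (f := fun z : E d × E d ↦ φ (z.2 - z.1) * f z.2) (by rwa [hmp.map_eq])
          rw [hmp.map_eq] at h
          rw [h]
          simp
      _ = ∫ x, ∫ y, φ x * f (y + x) ∂ν := integral_prod_symm _ hI2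
      _ = _ := by simp_rw [integral_const_mul]

end Distributions

/-! ### The duality of `B` and `B^*` -/

section Shells

variable {d : ℕ}

lemma exists_mem_shell (x : E d) : ∃ j, x ∈ shell d j := by
  by_cases h : ‖x‖ ≤ 1
  · exact ⟨0, h⟩
  · obtain ⟨n, h1, h2⟩ := exists_nat_pow_near (not_le.1 h).le one_lt_two
    exact ⟨n + 1, h1, h2.le⟩

lemma measurableSet_shell (j : ℕ) : MeasurableSet (shell d j) := by
  cases j with
  | zero => exact measurableSet_le measurable_norm measurable_const
  | succ j =>
    exact (measurableSet_le measurable_const measurable_norm).inter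
      (measurableSet_le measurable_norm measurable_const)

lemma lintegral_mul_le_eLpNorm_two {α : Type*} [MeasurableSpace α] {μ : Measure α} {F G : α → ℂ}
    (hF : AEStronglyMeasurable F μ) (hG : AEStronglyMeasurable G μ) :
    ∫⁻ x, ‖F x‖ₑ * ‖G x‖ₑ ∂μ ≤ eLpNorm F 2 μ * eLpNorm G 2 μ := by
  have h := ENNReal.lintegral_mul_le_Lp_mul_Lq μ Real.HolderConjugate.two_two hF.enorm hG.enorm
  simpa [eLpNorm_eq_lintegral_rpow_enorm_toReal two_ne_zero ENNReal.ofNat_ne_top] using h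

lemma lintegral_mul_le_normB {F G : E d → ℂ} (hF : AEStronglyMeasurable F volume)
    (hG : AEStronglyMeasurable G volume) :
    ∫⁻ x, ‖F x‖ₑ * ‖G x‖ₑ ≤ normB F * normBStar G := by
  have hcov : (⋃ j, shell d j) = univ := iUnion_eq_univ_iff.2 exists_mem_shell
  calc ∫⁻ x, ‖F x‖ₑ * ‖G x‖ₑ = ∫⁻ x in ⋃ j, shell d j, ‖F x‖ₑ * ‖G x‖ₑ := by
        rw [hcov, Measure.restrict_univ]
    _ ≤ ∑' j, ∫⁻ x in shell d j, ‖F x‖ₑ * ‖G x‖ₑ := lintegral_iUnion_le _ _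
    _ ≤ ∑' j : ℕ, (2 : ℝ≥0∞) ^ ((j : ℝ) / 2) * eLpNorm F 2 (volume.restrict (shell d j)) *
          normBStar G := ENNReal.tsum_le_tsum fun j ↦ by
        refine (lintegral_mul_le_eLpNorm_two hF.restrict hG.restrict).trans ?_
        have h2 : (2 : ℝ≥0∞) ^ ((j : ℝ) / 2) * (2 : ℝ≥0∞) ^ (-((j : ℝ) / 2)) = 1 := by
          rw [← ENNReal.rpow_add _ _ two_ne_zero ENNReal.ofNat_ne_top]
          simp
        calc _ = (2 : ℝ≥0∞) ^ ((j : ℝ) / 2) * eLpNorm F 2 (volume.restrict (shell d j)) *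
              ((2 : ℝ≥0∞) ^ (-((j : ℝ) / 2)) * eLpNorm G 2 (volume.restrict (shell d j))) := by
              rw [mul_mul_mul_comm, h2, one_mul]
          _ ≤ _ := by
              gcongr
              exact le_iSup (fun j : ℕ ↦ (2 : ℝ≥0∞) ^ (-((j : ℝ) / 2)) *
                eLpNorm G 2 (volume.restrict (shell d j))) j
    _ = _ := by rw [ENNReal.tsum_mul_right, normB]

lemma eLpNorm_two_sq {μ : Measure (E d)} (f : E d → ℂ) :
    eLpNorm f 2 μ ^ 2 = ∫⁻ x, ‖f x‖ₑ ^ 2 ∂μ := by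
  rw [eLpNorm_eq_lintegral_rpow_enorm_toReal two_ne_zero ENNReal.ofNat_ne_top,
    ← ENNReal.rpow_natCast, ← ENNReal.rpow_mul]
  simp

lemma lintegral_shell_sq_le (G : E d → ℂ) (j : ℕ) :
    ∫⁻ x in shell d j, ‖G x‖ₑ ^ 2 ≤ 2 ^ j * normBStar G ^ 2 := by
  have h : eLpNorm G 2 (volume.restrict (shell d j)) ≤ 2 ^ ((j : ℝ) / 2) * normBStar G := by
    have h2 : (2 : ℝ≥0∞) ^ ((j : ℝ) / 2) * (2 : ℝ≥0∞) ^ (-((j : ℝ) / 2)) = 1 := by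
      rw [← ENNReal.rpow_add _ _ two_ne_zero ENNReal.ofNat_ne_top]
      simp
    calc _ = (2 : ℝ≥0∞) ^ ((j : ℝ) / 2) *
          ((2 : ℝ≥0∞) ^ (-((j : ℝ) / 2)) * eLpNorm G 2 (volume.restrict (shell d j))) := by
          rw [← mul_assoc, h2, one_mul]
      _ ≤ _ := by
          gcongr
          exact le_iSup (fun j : ℕ ↦ (2 : ℝ≥0∞) ^ (-((j : ℝ) / 2)) *
            eLpNorm G 2 (volume.restrict (shell d j))) j
  rw [← eLpNorm_two_sq]
  calc _ ≤ (2 ^ ((j : ℝ) / 2) * normBStar G) ^ 2 := by gcongr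
    _ = _ := by
      rw [mul_pow]
      congr 1
      rw [← ENNReal.rpow_natCast, ← ENNReal.rpow_mul, ← ENNReal.rpow_natCast]
      congr 1
      push_cast
      ring

/-- The bounds 2^i on the shells with i ≤ j sum to less than 2^{j+1}. -/
lemma lintegral_closedBall_sq_le (G : E d → ℂ) (j : ℕ) :
    ∫⁻ x in {x | ‖x‖ ≤ 2 ^ j}, ‖G x‖ₑ ^ 2 ≤ 2 ^ (j + 1) * normBStar G ^ 2 := by
  induction j with
  | zero =>
    have := lintegral_shell_sq_le G 0
    simp only [shell, pow_zero, one_mul, zero_add, pow_one] at this ⊢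
    refine this.trans ?_
    rw [two_mul]
    exact le_self_add
  | succ j ih =>
    have hsub : {x : E d | ‖x‖ ≤ 2 ^ (j + 1)} ⊆ {x | ‖x‖ ≤ 2 ^ j} ∪ shell d (j + 1) := by
      intro x hx
      by_cases h : ‖x‖ ≤ 2 ^ j
      · exact Or.inl h
      · exact Or.inr ⟨(not_le.1 h).le, hx⟩
    calc _ ≤ ∫⁻ x in {x | ‖x‖ ≤ 2 ^ j} ∪ shell d (j + 1), ‖G x‖ₑ ^ 2 := lintegral_mono_set hsub
      _ ≤ _ := lintegral_union_le _ _ _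
      _ ≤ _ := add_le_add ih (lintegral_shell_sq_le G (j + 1))
      _ = _ := by ring

lemma norm_le_of_mem_shell {x : E d} {j : ℕ} (hx : x ∈ shell d j) : ‖x‖ ≤ 2 ^ j := by
  cases j with
  | zero => simpa [shell] using hx
  | succ j => exact hx.2

/-- A shift by at most 1 carries the shell D_j into the ball of radius 2^{j+1}, whose squared L²
mass is at most 2^{j+2} times the squared B^* norm; hence the factor 2. -/
lemma normBStar_comp_add_le (G : E d → ℂ) {z : E d} (hz : ‖z‖ ≤ 1) :
    normBStar (fun x ↦ G (x + z)) ≤ 2 * normBStar G := by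
  refine iSup_le fun j ↦ ?_
  have h1 : eLpNorm (fun x ↦ G (x + z)) 2 (volume.restrict (shell d j)) ^ 2 ≤
      (2 ^ (((j : ℝ) + 2) / 2) * normBStar G) ^ 2 := by
    rw [eLpNorm_two_sq]
    calc ∫⁻ x in shell d j, ‖G (x + z)‖ₑ ^ 2
        = ∫⁻ x, (shell d j).indicator (fun x ↦ ‖G (x + z)‖ₑ ^ 2) x :=
          (lintegral_indicator (measurableSet_shell j) _).symm
      _ ≤ ∫⁻ x, {x : E d | ‖x‖ ≤ 2 ^ (j + 1)}.indicator (fun x ↦ ‖G x‖ₑ ^ 2) (x + z) := by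
          refine lintegral_mono fun x ↦ ?_
          by_cases hx : x ∈ shell d j
          · rw [indicator_of_mem hx, indicator_of_mem]
            have h1 := norm_le_of_mem_shell hx
            have h2 : (1 : ℝ) ≤ 2 ^ j := one_le_pow₀ one_le_two
            rw [mem_ofPred_eq, pow_succ]
            linarith [norm_add_le x z]
          · rw [indicator_of_notMem hx]
            exact zero_le
      _ = ∫⁻ x, {x : E d | ‖x‖ ≤ 2 ^ (j + 1)}.indicator (fun x ↦ ‖G x‖ₑ ^ 2) x :=
          lintegral_add_right_eq_self _ z
      _ = ∫⁻ x in {x : E d | ‖x‖ ≤ 2 ^ (j + 1)}, ‖G x‖ₑ ^ 2 :=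
          lintegral_indicator (measurableSet_le measurable_norm measurable_const) _
      _ ≤ _ := lintegral_closedBall_sq_le G (j + 1)
      _ = _ := by
          rw [mul_pow, ← ENNReal.rpow_natCast (2 ^ _), ← ENNReal.rpow_mul, ← ENNReal.rpow_natCast 2]
          congr 2
          push_cast
          ring
  replace h1 := (ENNReal.pow_right_strictMono two_ne_zero).le_iff_le.1 h1
  calc _ ≤ (2 : ℝ≥0∞) ^ (-((j : ℝ) / 2)) * (2 ^ (((j : ℝ) + 2) / 2) * normBStar G) := by gcongr
    _ = _ := by
      rw [← mul_assoc, ← ENNReal.rpow_add _ _ two_ne_zero ENNReal.ofNat_ne_top]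
      congr 1
      rw [← ENNReal.rpow_one 2]
      congr 1
      · simp
      · ring

/-- Absolute continuity of the B norm: dominated convergence on each shell, then in the sum over
shells. -/
lemma normB_tendsto_zero {F : E d → ℂ} (hF : AEStronglyMeasurable F volume) (h : normB F < ∞)
    {A : ℕ → Set (E d)} (hA : ∀ n, NullMeasurableSet (A n))
    (hinter : ∀ x, ∀ᶠ n in Filter.atTop, x ∉ A n) :
    Filter.Tendsto (fun n ↦ normB ((A n).indicator F)) Filter.atTop (nhds 0) := by
  have hterm : ∀ j : ℕ, (2 : ℝ≥0∞) ^ ((j : ℝ) / 2) * eLpNorm F 2 (volume.restrict (shell d j)) ≠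
      ∞ :=
    fun j ↦ (lt_of_le_of_lt (ENNReal.le_tsum j) h).ne
  have h2 : ∀ j : ℕ, (2 : ℝ≥0∞) ^ ((j : ℝ) / 2) ≠ ∞ := fun j ↦
    ENNReal.rpow_ne_top_of_nonneg (by positivity) ENNReal.ofNat_ne_top
  have hLp : ∀ j, Filter.Tendsto (fun n ↦ eLpNorm ((A n).indicator F) 2
      (volume.restrict (shell d j))) Filter.atTop (nhds 0) := by
    intro j
    have hfin : ∫⁻ x in shell d j, ‖F x‖ₑ ^ 2 ≠ ∞ := by
      rw [← eLpNorm_two_sq]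
      refine ENNReal.pow_ne_top fun h' ↦ hterm j ?_
      rw [h', ENNReal.mul_top]
      exact (ENNReal.rpow_pos two_pos ENNReal.ofNat_ne_top).ne'
    have hsq : Filter.Tendsto (fun n ↦ eLpNorm ((A n).indicator F) 2
      (volume.restrict (shell d j)) ^ 2) Filter.atTop (nhds 0) := by
      simp_rw [eLpNorm_two_sq]
      have := tendsto_lintegral_of_dominated_convergence' (μ := volume.restrict (shell d j))
        (F := fun n x ↦ ‖(A n).indicator F x‖ₑ ^ 2) (f := fun _ ↦ 0) (fun x ↦ ‖F x‖ₑ ^ 2)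
        (fun n ↦ ((hF.indicator₀ (hA n)).restrict.enorm.pow_const 2))
        (fun n ↦ Filter.Eventually.of_forall fun x ↦ by
          dsimp only
          gcongr
          exact enorm_indicator_le_enorm_self _ _) hfin
        (Filter.Eventually.of_forall fun x ↦ by
          refine tendsto_const_nhds.congr' ?_
          filter_upwards [hinter x] with n hn
          simp [indicator_of_notMem hn])
      simpa using this
    have := (ENNReal.continuous_rpow_const (y := (1 / 2 : ℝ))).tendsto 0 |>.comp hsq
    rw [ENNReal.zero_rpow_of_pos (by norm_num)] at this
    refine this.congr fun n ↦ ?_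
    simp only [Function.comp_apply]
    rw [← ENNReal.rpow_natCast, ← ENNReal.rpow_mul]
    simp
  have hcount : ∀ F : E d → ℂ, normB F = ∫⁻ j : ℕ, (2 : ℝ≥0∞) ^ ((j : ℝ) / 2) *
      eLpNorm F 2 (volume.restrict (shell d j)) ∂Measure.count := fun F ↦ by
    rw [lintegral_count, normB]
  simp_rw [hcount]
  have := tendsto_lintegral_of_dominated_convergence (μ := (Measure.count : Measure ℕ))
    (F := fun n j ↦ (2 : ℝ≥0∞) ^ ((j : ℝ) / 2) *
      eLpNorm ((A n).indicator F) 2 (volume.restrict (shell d j))) (f := fun _ ↦ 0)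
    (fun j ↦ (2 : ℝ≥0∞) ^ ((j : ℝ) / 2) * eLpNorm F 2 (volume.restrict (shell d j)))
    (fun n ↦ measurable_of_countable _)
    (fun n ↦ Filter.Eventually.of_forall fun j ↦ by
      dsimp only
      gcongr
      exact eLpNorm_mono_enorm fun x ↦ enorm_indicator_le_enorm_self _ _)
    (by rw [← hcount]; exact h.ne)
    (Filter.Eventually.of_forall fun j ↦ by
      have := ENNReal.Tendsto.const_mul (hLp j) (Or.inr (h2 j))
      simpa using this)
  simpa using this

end Shells

/-! ### Continuity of correlations -/

section Correlation

variable {d : ℕ}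

lemma tendsto_lintegral_translate {g : E d → ℂ} (hg : Integrable g) :
    Filter.Tendsto (fun z ↦ ∫⁻ x, ‖g (x + z) - g x‖ₑ) (nhds 0) (nhds 0) := by
  have : Fact ((1 : ℝ≥0∞) ≠ ∞) := ⟨ENNReal.one_ne_top⟩
  have hg1 : MemLp g 1 volume := memLp_one_iff_integrable.2 hg
  set G := hg1.toLp g with hG
  have hc : Continuous fun z : E d ↦ DomAddAct.mk z +ᵥ G :=
    (continuous_id.vadd continuous_const).comp DomAddAct.continuous_mk
  have h0 := (tendsto_iff_edist_tendsto_0.1 (hc.tendsto 0))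
  refine h0.congr fun z ↦ ?_
  have e0 : DomAddAct.mk (0 : E d) +ᵥ G = G := by
    have : DomAddAct.mk (0 : E d) = 0 := rfl
    rw [this, zero_vadd]
  rw [e0, hG, DomAddAct.mk_vadd_toLp, Lp.edist_toLp_toLp, eLpNorm_one_eq_lintegral_enorm]
  refine lintegral_congr fun x ↦ ?_
  simp [vadd_eq_add, add_comm z x]

/-- The part of F where |x| or |F| exceeds n contributes at most δ n, uniformly in small shifts. The
rest is bounded with bounded support, so continuity of translations in L¹ applies to a truncation of
G. The Lorentz and the B, B^* cases both follow. -/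
lemma tendsto_correlation {F G : E d → ℂ} (hF : AEStronglyMeasurable F volume)
    (hG : LocallyIntegrable G)
    {δ : ℕ → ℝ≥0∞} (hδ : Filter.Tendsto δ Filter.atTop (nhds 0))
    (hfin : ∀ z, ‖z‖ ≤ 1 → ∫⁻ x, ‖F x‖ₑ * ‖G (x + z)‖ₑ < ∞)
    (hle : ∀ (n : ℕ) z, ‖z‖ ≤ 1 →
      ∫⁻ x, ‖{x | (n : ℝ) < ‖x‖ ∨ (n : ℝ) < ‖F x‖}.indicator F x‖ₑ * ‖G (x + z)‖ₑ ≤ δ n) :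
    Filter.Tendsto (fun z ↦ ∫ x, F x * G (x + z)) (nhds 0) (nhds (∫ x, F x * G x)) := by
  have hGm := hG.aestronglyMeasurable
  have hGz : ∀ z, AEStronglyMeasurable (fun x ↦ G (x + z)) volume := fun z ↦
    hGm.comp_measurePreserving (measurePreserving_add_right volume z)
  have hint : ∀ z, ‖z‖ ≤ 1 → Integrable fun x ↦ F x * G (x + z) := fun z hz ↦ by
    refine ⟨hF.mul (hGz z), ?_⟩
    rw [HasFiniteIntegral]
    simp_rw [enorm_mul]
    exact hfin z hz
  rw [tendsto_iff_edist_tendsto_0, ENNReal.tendsto_nhds_zero]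
  intro ε hε
  have h3 : (0 : ℝ≥0∞) < ε / 3 := by
    refine ENNReal.div_pos hε.ne' (by simp)
  obtain ⟨n, hn⟩ := ((ENNReal.tendsto_nhds_zero.1 hδ) _ h3).exists
  set A : Set (E d) := {x | (n : ℝ) < ‖x‖ ∨ (n : ℝ) < ‖F x‖} with hA
  -- The radius n + 1 leaves room for shifts of length at most 1.
  set g : E d → ℂ := (Metric.closedBall 0 ((n : ℝ) + 1)).indicator G with hg
  have hgi : Integrable g := (integrable_indicator_iff measurableSet_closedBall).2
    (hG.integrableOn_isCompact (isCompact_closedBall _ _))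
  have ht := ENNReal.Tendsto.const_mul (a := (n : ℝ≥0∞)) (tendsto_lintegral_translate hgi)
    (Or.inr (ENNReal.natCast_ne_top n))
  rw [mul_zero] at ht
  filter_upwards [(ENNReal.tendsto_nhds_zero.1 ht) _ h3,
    Metric.closedBall_mem_nhds (0 : E d) one_pos]
    with z hz hz1
  rw [mem_closedBall_zero_iff] at hz1
  have e0 : ∫ x, F x * G x = ∫ x, F x * G (x + 0) := by simp
  rw [e0, edist_eq_enorm_sub, ← integral_sub (hint z hz1) (hint 0 (by simp))]
  refine (enorm_integral_le_lintegral_enorm _).trans ?_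
  have hAF : AEStronglyMeasurable (A.indicator F) volume := by
    refine hF.indicator₀ ?_
    exact (nullMeasurableSet_lt aemeasurable_const measurable_norm.aemeasurable).union
      (nullMeasurableSet_lt aemeasurable_const hF.norm.aemeasurable)
  have hpt : ∀ x, ‖F x * G (x + z) - F x * G (x + 0)‖ₑ ≤
      ‖A.indicator F x‖ₑ * ‖G (x + z)‖ₑ + ‖A.indicator F x‖ₑ * ‖G (x + 0)‖ₑ +
        n * ‖g (x + z) - g x‖ₑ := by
    intro x
    by_cases hx : x ∈ A
    · rw [indicator_of_mem hx, ← enorm_mul, ← enorm_mul]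
      exact enorm_sub_le.trans le_self_add
    · rw [indicator_of_notMem hx]
      simp only [hA, mem_ofPred_eq, not_or, not_lt] at hx
      have h1 : g (x + z) = G (x + z) := indicator_of_mem (by
        rw [mem_closedBall_zero_iff]; linarith [norm_add_le x z, hx.1]) _
      have h2 : g x = G x := indicator_of_mem (by
        rw [mem_closedBall_zero_iff]; linarith [hx.1]) _
      rw [h1, h2, ← mul_sub, enorm_mul, add_zero]
      simp only [enorm_zero, zero_mul, zero_add]
      gcongr
      rw [← ofReal_norm, ← ENNReal.ofReal_natCast]
      exact ENNReal.ofReal_le_ofReal hx.2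
  calc _ ≤ ∫⁻ x, (‖A.indicator F x‖ₑ * ‖G (x + z)‖ₑ + ‖A.indicator F x‖ₑ * ‖G (x + 0)‖ₑ +
        n * ‖g (x + z) - g x‖ₑ) := lintegral_mono hpt
    _ = (∫⁻ x, ‖A.indicator F x‖ₑ * ‖G (x + z)‖ₑ) + (∫⁻ x, ‖A.indicator F x‖ₑ * ‖G (x + 0)‖ₑ) +
        n * ∫⁻ x, ‖g (x + z) - g x‖ₑ := by
      have h1 : ∀ z, AEMeasurable (fun x ↦ ‖A.indicator F x‖ₑ * ‖G (x + z)‖ₑ) volume :=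
        fun z ↦ hAF.enorm.mul (hGz z).enorm
      have h2 : AEMeasurable (fun x ↦ ‖A.indicator F x‖ₑ * ‖G (x + z)‖ₑ +
        ‖A.indicator F x‖ₑ * ‖G (x + 0)‖ₑ) volume := (h1 z).add (h1 0)
      rw [lintegral_add_left' h2, lintegral_add_left' (h1 z),
        lintegral_const_mul' _ _ (ENNReal.natCast_ne_top n)]
    _ ≤ ε / 3 + ε / 3 + ε / 3 := by
      gcongr
      · exact (hle n z hz1).trans hn
      · exact (hle n 0 (by simp)).trans hn
    _ = ε := ENNReal.add_thirds ε

end Correlation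

/-! ### Moving Bessel potentials across the duality -/

section Duality

variable {d : ℕ}

/-- Fubini with w = x + z, in both orders of integration; comparing the two moves the kernel from
one function to the other. -/
lemma integral_correlation {K F G : E d → ℂ} (hK : Continuous K)
    (hF : AEStronglyMeasurable F volume) (hG : AEStronglyMeasurable G volume)
    (h : ∫⁻ z, ‖K z‖ₑ * ∫⁻ x, ‖F x‖ₑ * ‖G (x + z)‖ₑ < ∞) :
    ∫ z, K z * ∫ x, F x * G (x + z) = ∫ x, F x * ∫ w, K (w - x) * G w ∧
    ∫ z, K z * ∫ x, F x * G (x + z) = ∫ w, G w * ∫ x, K (w - x) * F x := by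
  set μ : Measure (E d × E d) := (volume : Measure (E d)).prod volume with hμ
  have hGz : AEStronglyMeasurable (fun p : E d × E d ↦ G (p.1 + p.2)) μ :=
    hG.comp_quasiMeasurePreserving (quasiMeasurePreserving_add volume)
  have hΦm : AEStronglyMeasurable (fun p : E d × E d ↦ K p.2 * (F p.1 * G (p.1 + p.2))) μ :=
    (hK.comp continuous_snd).aestronglyMeasurable.mul (hF.comp_fst.mul hGz)
  have hΦ : Integrable (fun p : E d × E d ↦ K p.2 * (F p.1 * G (p.1 + p.2))) μ := by
    refine ⟨hΦm, ?_⟩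
    rw [HasFiniteIntegral, lintegral_prod_symm _ hΦm.enorm]
    refine lt_of_eq_of_lt (lintegral_congr fun z ↦ ?_) h
    simp_rw [enorm_mul]
    rw [lintegral_const_mul' _ _ enorm_ne_top]
  have hmp := measurePreserving_prod_add (volume : Measure (E d)) (volume : Measure (E d))
  have hΨm : AEStronglyMeasurable (fun p : E d × E d ↦ K (p.2 - p.1) * (F p.1 * G p.2)) μ :=
    (hK.comp (by fun_prop)).aestronglyMeasurable.mul (hF.comp_fst.mul hG.comp_snd)
  have hcomp : (fun p : E d × E d ↦ K (p.2 - p.1) * (F p.1 * G p.2)) ∘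
      (fun z : E d × E d ↦ (z.1, z.1 + z.2)) = fun p ↦ K p.2 * (F p.1 * G (p.1 + p.2)) := by
    ext p
    simp
  have hΨ : Integrable (fun p : E d × E d ↦ K (p.2 - p.1) * (F p.1 * G p.2)) μ := by
    rw [← hmp.integrable_comp hΨm, hcomp]
    exact hΦ
  have h0 : ∫ z, K z * ∫ x, F x * G (x + z) = ∫ p, K (p.2 - p.1) * (F p.1 * G p.2) ∂μ := by
    have h1 := integral_map (μ := μ) hmp.measurable.aemeasurable
      (f := fun p : E d × E d ↦ K (p.2 - p.1) * (F p.1 * G p.2)) (by rwa [hmp.map_eq])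
    rw [hmp.map_eq] at h1
    rw [h1]
    simp only [add_sub_cancel_left]
    rw [integral_prod_symm _ hΦ]
    simp_rw [← integral_const_mul]
  constructor
  · rw [h0, integral_prod _ hΨ]
    simp_rw [← integral_const_mul]
    refine integral_congr_ae (Filter.Eventually.of_forall fun x ↦ ?_)
    refine integral_congr_ae (Filter.Eventually.of_forall fun w ↦ ?_)
    simp only
    ring
  · rw [h0, integral_prod_symm _ hΨ]
    simp_rw [← integral_const_mul]
    refine integral_congr_ae (Filter.Eventually.of_forall fun x ↦ ?_)
    refine integral_congr_ae (Filter.Eventually.of_forall fun w ↦ ?_)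
    simp only
    ring

lemma aestronglyMeasurable_correlation {F G : E d → ℂ} (hF : AEStronglyMeasurable F volume)
    (hG : AEStronglyMeasurable G volume) :
    AEStronglyMeasurable (fun z ↦ ∫ x, F x * G (x + z)) volume := by
  have h : AEStronglyMeasurable (fun p : E d × E d ↦ F p.1 * G (p.1 + p.2))
      ((volume : Measure (E d)).prod volume) :=
    hF.comp_fst.mul (hG.comp_quasiMeasurePreserving (quasiMeasurePreserving_add volume))
  exact h.prod_swap.integral_prod_right'

lemma eq_of_integral_bump_eq {c₁ c₂ : E d → ℂ} (h1 : AEStronglyMeasurable c₁ volume)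
    (h2 : AEStronglyMeasurable c₂ volume) (hc1 : ContinuousAt c₁ 0) (hc2 : ContinuousAt c₂ 0)
    (h : ∀ b : ContDiffBump (0 : E d), b.rOut ≤ 1 →
      ∫ z, (b.normed volume z : ℂ) * c₁ z = ∫ z, (b.normed volume z : ℂ) * c₂ z) :
    c₁ 0 = c₂ 0 := by
  have key : ∀ {c : E d → ℂ} (b : ContDiffBump (0 : E d)) {ε : ℝ}, AEStronglyMeasurable c volume →
      (∀ x ∈ Metric.ball 0 b.rOut, dist (c x) (c 0) ≤ ε) →
      dist (∫ z, (b.normed volume z : ℂ) * c z) (c 0) ≤ ε := by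
    intro c b ε hc hd
    have hcm : AEStronglyMeasurable (fun x ↦ c (-x)) volume :=
      hc.comp_measurePreserving (Measure.measurePreserving_neg volume)
    -- A convolution at 0 evaluates the function at -z, hence the reflection of `c`.
    have h := b.dist_normed_convolution_le (μ := volume) (g := fun x ↦ c (-x)) (x₀ := 0) hcm
      (ε := ε) (fun x hx ↦ by
        simp only [neg_zero]
        exact hd _ (by simpa using hx))
    rw [convolution_def] at h
    simpa using h
  refine eq_of_forall_dist_le fun ε hε ↦ ?_
  obtain ⟨r1, hr1, h1'⟩ := Metric.continuousAt_iff.1 hc1 (ε / 2) (by positivity)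
  obtain ⟨r2, hr2, h2'⟩ := Metric.continuousAt_iff.1 hc2 (ε / 2) (by positivity)
  set r := min 1 (min r1 r2) with hr
  have hr0 : 0 < r := by positivity
  let b : ContDiffBump (0 : E d) := ⟨r / 2, r, by positivity, by linarith⟩
  have k1 := key b h1 (ε := ε / 2) fun x hx ↦ (h1' (lt_of_lt_of_le (Metric.mem_ball.1 hx)
    ((min_le_right _ _).trans (min_le_left _ _)))).le
  have k2 := key b h2 (ε := ε / 2) fun x hx ↦ (h2' (lt_of_lt_of_le (Metric.mem_ball.1 hx)
    ((min_le_right _ _).trans (min_le_right _ _)))).le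
  rw [h b (min_le_left _ _), dist_comm] at k1
  linarith [dist_triangle (c₁ 0) (∫ z, (b.normed volume z : ℂ) * c₂ z) (c₂ 0)]

lemma besselS_neg_translate {β : ℝ} (hβ : 0 < β) {K ψ : 𝓢(E d, ℂ)} {y : E d}
    (h : ∀ x, ψ x = K (x - y)) (x : E d) : besselS (-β) ψ x = besselS (-β) K (x - y) := by
  rw [besselS_neg_apply hβ, besselS_neg_apply hβ]
  simp_rw [h, sub_right_comm]

lemma besselS_neg_reflect {β : ℝ} (hβ : 0 < β) {K ψ : 𝓢(E d, ℂ)} {y : E d}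
    (h : ∀ x, ψ x = K (y - x)) (x : E d) : besselS (-β) ψ x = besselS (-β) K (y - x) := by
  rw [besselS_neg_apply hβ, besselS_neg_apply' hβ]
  refine integral_congr_ae (Filter.Eventually.of_forall fun w ↦ ?_)
  simp only [h]
  congr 1
  abel

lemma besselS_neg_conj {β : ℝ} (hβ : 0 < β) {K ψ : 𝓢(E d, ℂ)}
    (h : ∀ x, ψ x = conj (K x)) (x : E d) : besselS (-β) ψ x = conj (besselS (-β) K x) := by
  rw [besselS_neg_apply hβ, besselS_neg_apply hβ, ← integral_conj]
  simp_rw [h]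

/-- For β > 0 the operator S_{-β} is convolution with a real measure, so it commutes with
conjugation; its inverse on Schwartz functions therefore preserves real functions. -/
lemma besselS_conj {β : ℝ} (hβ : 0 < β) {φ : 𝓢(E d, ℂ)} (h : ∀ x, conj (φ x) = φ x) (x : E d) :
    conj (besselS β φ x) = besselS β φ x := by
  set K := besselS β φ with hK
  set ψ : 𝓢(E d, ℂ) := SchwartzMap.postcompCLM (𝕜 := ℝ) Complex.conjCLE.toContinuousLinearMap K
    with hψ
  have hφ : besselS (-β) K = φ := by rw [hK, besselS_besselS, neg_add_cancel, besselS_zero]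
  have e : besselS (-β) ψ = φ := by
    ext x
    rw [besselS_neg_conj hβ (K := K) (fun x ↦ rfl), hφ, h]
  have : ψ = K := by rw [hK, ← e, besselS_besselS, add_neg_cancel, besselS_zero]
  exact congrArg (fun f : 𝓢(E d, ℂ) ↦ f x) this

lemma exists_reflect (K : 𝓢(E d, ℂ)) (y : E d) : ∃ ψ : 𝓢(E d, ℂ), ∀ x, ψ x = K (y - x) := by
  refine ⟨SchwartzMap.compSubConstCLM ℂ y (SchwartzMap.compCLMOfContinuousLinearEquiv ℂ
    (ContinuousLinearEquiv.neg ℝ) K), fun x ↦ ?_⟩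
  simp

/-- The test function is the reflected translate of S_β φ. Since S_{-β} commutes with translations
and reflection, it returns the reflected translate of φ. -/
lemma IsFun.integral_reflect {β : ℝ} (hβ : 0 < β) {U : 𝓢'(E d, ℂ)} {F H : E d → ℂ}
    (hH : IsFun U H) (hF : IsFun (S (-β) U) F) (φ : 𝓢(E d, ℂ)) (w : E d) :
    ∫ x, besselS β φ (w - x) * F x = ∫ x, φ (w - x) * H x := by
  obtain ⟨ψ, hψ⟩ := exists_reflect (besselS β φ) w
  have h1 := (hF.2 ψ).2
  rw [S_apply_apply, (hH.2 _).2] at h1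
  simp_rw [besselS_neg_reflect hβ hψ, hψ, besselS_besselS, neg_add_cancel, besselS_zero] at h1
  exact h1.symm

lemma IsFun.integral_translate {β : ℝ} (hβ : 0 < β) {U : 𝓢'(E d, ℂ)} {F H : E d → ℂ}
    (hH : IsFun U H) (hF : IsFun (S (-β) U) F) (φ : 𝓢(E d, ℂ)) (y : E d) :
    ∫ x, besselS β φ (x - y) * F x = ∫ x, φ (x - y) * H x := by
  obtain ⟨ψ, hψ⟩ : ∃ ψ : 𝓢(E d, ℂ), ∀ x, ψ x = besselS β φ (x - y) :=
    ⟨SchwartzMap.compSubConstCLM ℂ y (besselS β φ), fun _ ↦ rfl⟩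
  have h1 := (hF.2 ψ).2
  rw [S_apply_apply, (hH.2 _).2] at h1
  simp_rw [besselS_neg_translate hβ hψ, hψ, besselS_besselS, neg_add_cancel, besselS_zero] at h1
  exact h1.symm

lemma IsFun.integral_translate_conj {β : ℝ} (hβ : 0 < β) {U : 𝓢'(E d, ℂ)} {F H : E d → ℂ}
    (hH : IsFun U H) (hF : IsFun (S (-β) U) F) {φ : 𝓢(E d, ℂ)} (hφ : ∀ x, conj (φ x) = φ x)
    (y : E d) :
    ∫ x, besselS β φ (x - y) * conj (F x) = ∫ x, φ (x - y) * conj (H x) := by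
  have h := congrArg conj (hH.integral_translate hβ hF φ y)
  rw [← integral_conj, ← integral_conj] at h
  simpa [besselS_conj hβ hφ, hφ] using h

lemma lor_conj (a : ℝ) (f : E d → ℂ) :
    lor volume a (fun x ↦ ‖conj (f x)‖ₑ) = lor volume a fun x ↦ ‖f x‖ₑ := by
  simp

lemma lor_comp_add (a : ℝ) (f : E d → ℝ≥0∞) (z : E d) :
    lor volume a (fun x ↦ f (x + z)) = lor volume a f := by
  simpa using lor_comp_sub a f (-z)

lemma tendsto_correlation_lor {a : ℝ} (ha : 0 < a) {H G : E d → ℂ}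
    (hH : AEStronglyMeasurable H volume) (hHl : lor volume a (fun x ↦ ‖H x‖ₑ) < ∞)
    (hG : LocallyIntegrable G) (hGl : lor volume (1 - a) (fun x ↦ ‖G x‖ₑ) < ∞) :
    ContinuousAt (fun z ↦ ∫ x, H x * G (x + z)) 0 := by
  set M := lor volume (1 - a) (fun x ↦ ‖G x‖ₑ) ^ (1 / 2 : ℝ) with hM
  have hMt : M ≠ ∞ := ENNReal.rpow_ne_top_of_nonneg (by norm_num) hGl.ne
  have hGz : ∀ z, AEMeasurable (fun x ↦ ‖G (x + z)‖ₑ) volume := fun z ↦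
    (hG.aestronglyMeasurable.comp_measurePreserving (measurePreserving_add_right volume z)).enorm
  set A : ℕ → Set (E d) := fun n ↦ {x | (n : ℝ) < ‖x‖ ∨ (n : ℝ) < ‖H x‖} with hA
  have hAm : ∀ n, NullMeasurableSet (A n) := fun n ↦
    (nullMeasurableSet_lt aemeasurable_const measurable_norm.aemeasurable).union
      (nullMeasurableSet_lt aemeasurable_const hH.norm.aemeasurable)
  have hAa : Antitone A := fun m n hmn x hx ↦ by
    have : (m : ℝ) ≤ n := by exact_mod_cast hmn
    exact hx.imp (lt_of_le_of_lt this) (lt_of_le_of_lt this)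
  have hAi : ⋂ n, A n = ∅ := by
    refine eq_empty_of_forall_notMem fun x hx ↦ ?_
    obtain ⟨n, hn⟩ := exists_nat_gt (max ‖x‖ ‖H x‖)
    rcases mem_iInter.1 hx n with h | h
    · exact absurd (h.trans_le (le_max_left _ _)) hn.not_gt
    · exact absurd (h.trans_le (le_max_right _ _)) hn.not_gt
  have hlim := lor_tendsto_zero ha hH.enorm hHl hAm hAa hAi
  have hlim2 : Filter.Tendsto (fun n ↦
      2 * (lor volume a ((A n).indicator fun x ↦ ‖H x‖ₑ) ^ (1 / 2 : ℝ) * M))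
        Filter.atTop (nhds 0) := by
    have h1 := (ENNReal.continuous_rpow_const (y := (1 / 2 : ℝ))).tendsto 0 |>.comp hlim
    rw [ENNReal.zero_rpow_of_pos (by norm_num)] at h1
    have h2 := ENNReal.Tendsto.const_mul (ENNReal.Tendsto.mul_const h1 (Or.inr hMt))
      (Or.inr (ENNReal.ofNat_ne_top (n := 2)))
    simpa using h2
  have hlor : ∀ z, lor volume (1 - a) (fun x ↦ ‖G (x + z)‖ₑ) ^ (1 / 2 : ℝ) = M := fun z ↦ by
    rw [hM, lor_comp_add (1 - a) (fun x ↦ ‖G x‖ₑ) z]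
  have := tendsto_correlation hH hG hlim2
    (fun z _ ↦ lt_of_le_of_lt (lintegral_mul_le_lor hH.enorm (hGz z) a) (by
      rw [hlor]
      exact ENNReal.mul_lt_top ENNReal.ofNat_lt_top (ENNReal.mul_lt_top
        (ENNReal.rpow_lt_top_of_nonneg (by norm_num) hHl.ne) hMt.lt_top)))
    (fun n z _ ↦ by
      refine (lintegral_mul_le_lor (hH.indicator₀ (hAm n)).enorm (hGz z) a).trans ?_
      rw [hlor]
      simp_rw [enorm_indicator_eq_indicator_enorm]
      exact le_rfl)
  simpa [ContinuousAt] using this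

lemma tendsto_correlation_normB {F G : E d → ℂ}
    (hF : AEStronglyMeasurable F volume) (hFB : normB F < ∞)
    (hG : LocallyIntegrable G) (hGB : normBStar G < ∞) :
    ContinuousAt (fun z ↦ ∫ x, F x * G (x + z)) 0 := by
  have hGz : ∀ z, AEStronglyMeasurable (fun x ↦ G (x + z)) volume := fun z ↦
    hG.aestronglyMeasurable.comp_measurePreserving (measurePreserving_add_right volume z)
  set A : ℕ → Set (E d) := fun n ↦ {x | (n : ℝ) < ‖x‖ ∨ (n : ℝ) < ‖F x‖} with hA
  have hAm : ∀ n, NullMeasurableSet (A n) := fun n ↦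
    (nullMeasurableSet_lt aemeasurable_const measurable_norm.aemeasurable).union
      (nullMeasurableSet_lt aemeasurable_const hF.norm.aemeasurable)
  have hlim := normB_tendsto_zero hF hFB hAm fun x ↦ by
    obtain ⟨n, hn⟩ := exists_nat_gt (max ‖x‖ ‖F x‖)
    filter_upwards [Filter.eventually_ge_atTop n] with m hm
    have : (n : ℝ) ≤ m := by exact_mod_cast hm
    simp only [hA, mem_ofPred_eq, not_or, not_lt]
    exact ⟨((le_max_left _ _).trans hn.le).trans this, ((le_max_right _ _).trans hn.le).trans this⟩
  have hMt : 2 * normBStar G ≠ ∞ := ENNReal.mul_ne_top ENNReal.ofNat_ne_top hGB.ne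
  have hlim2 := ENNReal.Tendsto.mul_const hlim (Or.inr hMt)
  rw [zero_mul] at hlim2
  have := tendsto_correlation hF hG hlim2
    (fun z hz ↦ lt_of_le_of_lt ((lintegral_mul_le_normB hF (hGz z)).trans
      (mul_le_mul_right (normBStar_comp_add_le G hz) _)) (ENNReal.mul_lt_top hFB hMt.lt_top))
    (fun n z hz ↦ (lintegral_mul_le_normB (hF.indicator₀ (hAm n)) (hGz z)).trans
      (mul_le_mul_right (normBStar_comp_add_le G hz) _))
  simpa [ContinuousAt] using this

lemma LocallyIntegrable.conj_comp {G : E d → ℂ} (hG : LocallyIntegrable G) :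
    LocallyIntegrable fun x ↦ conj (G x) :=
  hG.mono (Complex.continuous_conj.comp_aestronglyMeasurable hG.aestronglyMeasurable)
    (Filter.Eventually.of_forall fun x ↦ by simp)

lemma IsFun.lor_le_of_S_neg {β a : ℝ} (hβ : 0 < β) (ha : 0 < a) (ha1 : a < 1)
    {U : 𝓢'(E d, ℂ)} {F H : E d → ℂ} (hH : IsFun U H)
    (hHl : lor volume a (fun x ↦ ‖H x‖ₑ) < ∞) (hF : IsFun (S (-β) U) F) :
    lor volume a (fun x ↦ ‖F x‖ₑ) < ∞ := by
  have := isProbabilityMeasure_besselMeasure (d := d) hβ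
  obtain ⟨C', hC'⟩ := lor_conv_le (d := d) le_rfl ha ha1 1
  have h1 := (tame_of_lor ha ha1 hH.1 hHl).isFun_S_neg hβ hH
  have h2 := hC' (besselMeasure d β) (fun A _ ↦ by simpa using prob_le_one) _ hH.1.enorm hHl
  rw [sub_zero] at h2
  refine lt_of_le_of_lt (lor_mono ?_ a) (lt_of_le_of_lt h2 (ENNReal.mul_lt_top (by simp) hHl))
  filter_upwards [hF.ae_eq h1] with x hx
  rw [hx]
  exact enorm_integral_le_lintegral_enorm _

/-- Formally the self-adjoint operator S_β is moved across the pairing, but the two integrals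
converge for different reasons and S_β is not an integral operator on these functions. Averaging
both correlations against a bump φ puts S_β on φ, which stays Schwartz. Continuity of the
correlations at 0 removes the average. -/
theorem integral_mul_conj_eq {β a : ℝ} (hβ : 0 < β) (ha : 0 < a) (ha1 : a < 1)
    {U g : 𝓢'(E d, ℂ)} {F H G₁ G₂ : E d → ℂ} (hH : IsFun U H)
    (hHl : lor volume a (fun x ↦ ‖H x‖ₑ) < ∞) (hF : IsFun (S (-β) U) F) (hFB : normB F < ∞)
    (hG₁ : IsFun g G₁) (hG₁l : lor volume (1 - a) (fun x ↦ ‖G₁ x‖ₑ) < ∞)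
    (hG₂ : IsFun (S β g) G₂) (hG₂B : normBStar G₂ < ∞) :
    ∫ x, H x * conj (G₁ x) = ∫ x, F x * conj (G₂ x) := by
  have hFl := hH.lor_le_of_S_neg hβ ha ha1 hHl hF
  have hl1 := LocallyIntegrable.conj_comp hG₁.locallyIntegrable
  have hl2 := LocallyIntegrable.conj_comp hG₂.locallyIntegrable
  have hG₁' : IsFun (S (-β) (S β g)) G₁ := by rwa [S_S, neg_add_cancel, S_zero]
  have hG₂B' : normBStar (fun x ↦ conj (G₂ x)) < ∞ := by
    refine lt_of_le_of_lt (iSup_mono fun j ↦ ?_) hG₂B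
    gcongr
    exact eLpNorm_mono_enorm fun x ↦ by simp
  have hG₁l' : lor volume (1 - a) (fun x ↦ ‖conj (G₁ x)‖ₑ) < ∞ :=
    (lor_conj (1 - a) G₁).trans_lt hG₁l
  set c₁ : E d → ℂ := fun z ↦ ∫ x, H x * conj (G₁ (x + z)) with hc₁
  set c₂ : E d → ℂ := fun z ↦ ∫ x, F x * conj (G₂ (x + z)) with hc₂
  have hbound : ∀ {P : E d → ℂ}, AEStronglyMeasurable P volume → lor volume a (fun x ↦ ‖P x‖ₑ) < ∞ →
      ∀ ψ : 𝓢(E d, ℂ), ∫⁻ z, ‖ψ z‖ₑ * ∫⁻ x, ‖P x‖ₑ * ‖conj (G₁ (x + z))‖ₑ < ∞ := by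
    intro P hP hPl ψ
    set M := 2 * (lor volume a (fun x ↦ ‖P x‖ₑ) ^ (1 / 2 : ℝ) *
      lor volume (1 - a) (fun x ↦ ‖conj (G₁ x)‖ₑ) ^ (1 / 2 : ℝ)) with hM
    have hMt : M ≠ ∞ := ENNReal.mul_ne_top ENNReal.ofNat_ne_top (ENNReal.mul_ne_top
      (ENNReal.rpow_ne_top_of_nonneg (by norm_num) hPl.ne)
      (ENNReal.rpow_ne_top_of_nonneg (by norm_num) hG₁l'.ne))
    calc _ ≤ ∫⁻ z, ‖ψ z‖ₑ * M := by
          refine lintegral_mono fun z ↦ ?_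
          gcongr
          refine (lintegral_mul_le_lor hP.enorm (hl1.aestronglyMeasurable.comp_measurePreserving
            (measurePreserving_add_right volume z)).enorm a).trans ?_
          rw [hM]
          gcongr 2 * (_ * ?_ ^ _)
          exact (lor_comp_add (1 - a) (fun x ↦ ‖conj (G₁ x)‖ₑ) z).le
      _ = (∫⁻ z, ‖ψ z‖ₑ) * M := lintegral_mul_const' _ _ hMt
      _ < ∞ := ENNReal.mul_lt_top ψ.integrable.2 hMt.lt_top
  have key : c₁ 0 = c₂ 0 := by
    have hm1 : AEStronglyMeasurable c₁ volume :=
      aestronglyMeasurable_correlation (G := fun x ↦ conj (G₁ x)) hH.1 hl1.aestronglyMeasurable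
    have hm2 : AEStronglyMeasurable c₂ volume :=
      aestronglyMeasurable_correlation (G := fun x ↦ conj (G₂ x)) hF.1 hl2.aestronglyMeasurable
    have hcont1 : ContinuousAt c₁ 0 :=
      tendsto_correlation_lor (G := fun x ↦ conj (G₁ x)) ha hH.1 hHl hl1 hG₁l'
    have hcont2 : ContinuousAt c₂ 0 :=
      tendsto_correlation_normB (G := fun x ↦ conj (G₂ x)) hF.1 hFB hl2 hG₂B'
    -- Bumps supported in the unit ball suffice, and the B^* norm of translates is controlled only
    -- for such shifts.
    refine eq_of_integral_bump_eq hm1 hm2 hcont1 hcont2 fun b hb ↦ ?_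
    have hbs : ContDiff ℝ (⊤ : ℕ∞) fun y ↦ ((b.normed volume y : ℝ) : ℂ) :=
      Complex.ofRealCLM.contDiff.comp b.contDiff_normed
    have hbc : HasCompactSupport fun y ↦ ((b.normed volume y : ℝ) : ℂ) :=
      b.hasCompactSupport_normed.comp_left Complex.ofReal_zero
    obtain ⟨φ, hφ⟩ : ∃ φ : 𝓢(E d, ℂ), ∀ x, φ x = ((b.normed volume x : ℝ) : ℂ) :=
      ⟨hbc.toSchwartzMap hbs, fun _ ↦ rfl⟩
    simp_rw [← hφ]
    have hφr : ∀ x, conj (φ x) = φ x := fun x ↦ by rw [hφ, Complex.conj_ofReal]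
    have hφ0 : ∀ x, 1 ≤ ‖x‖ → φ x = 0 := fun x hx ↦ by
      have : b.normed volume x = 0 := by
        rw [← Function.notMem_support, b.support_normed_eq]
        simpa using hb.trans hx
      rw [hφ, this, Complex.ofReal_zero]
    have k1 := (integral_correlation φ.continuous hH.1 hl1.aestronglyMeasurable
      (hbound hH.1 hHl φ)).2
    -- S_β φ need not have compact support, so Fubini relies here on the Lorentz bound for F, which
    -- is uniform in all shifts, instead of the B norm.
    have k2 := integral_correlation (besselS β φ).continuous hF.1 hl1.aestronglyMeasurable
      (hbound hF.1 hFl (besselS β φ))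
    have k3 := (integral_correlation φ.continuous hF.1 hl2.aestronglyMeasurable (by
      set M := normB F * (2 * normBStar fun x ↦ conj (G₂ x)) with hM
      have hMt : M ≠ ∞ := ENNReal.mul_ne_top hFB.ne
        (ENNReal.mul_ne_top ENNReal.ofNat_ne_top hG₂B'.ne)
      calc _ ≤ ∫⁻ z, ‖φ z‖ₑ * M := by
            refine lintegral_mono fun z ↦ ?_
            dsimp only
            by_cases hz : 1 ≤ ‖z‖
            · simp [hφ0 z hz]
            · gcongr
              refine (lintegral_mul_le_normB hF.1 (hl2.aestronglyMeasurable.comp_measurePreserving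
                (measurePreserving_add_right volume z))).trans ?_
              rw [hM]
              gcongr
              exact normBStar_comp_add_le (fun x ↦ conj (G₂ x)) (not_le.1 hz).le
        _ = (∫⁻ z, ‖φ z‖ₑ) * M := lintegral_mul_const' _ _ hMt
        _ < ∞ := ENNReal.mul_lt_top φ.integrable.2 hMt.lt_top)).1
    calc ∫ z, φ z * c₁ z = ∫ w, conj (G₁ w) * ∫ x, φ (w - x) * H x := k1
      _ = ∫ w, conj (G₁ w) * ∫ x, besselS β φ (w - x) * F x := by
        simp_rw [hH.integral_reflect hβ hF φ]
      _ = ∫ x, F x * ∫ w, besselS β φ (w - x) * conj (G₁ w) := k2.2.symm.trans k2.1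
      _ = ∫ x, F x * ∫ w, φ (w - x) * conj (G₂ w) := by
        simp_rw [hG₂.integral_translate_conj hβ hG₁' hφr]
      _ = _ := k3.symm
  simpa [hc₁, hc₂] using key

end Duality

/-! ### Norms of distributions which are functions -/

section Norms

variable {d : ℕ}

lemma distNorm_eq {N : (E d → ℂ) → ℝ≥0∞} (hN : ∀ f g, f =ᵐ[volume] g → N f = N g)
    {T : 𝓢'(E d, ℂ)} {f : E d → ℂ} (hT : IsFun T f) : distNorm N T = N f :=
  le_antisymm (iInf₂_le f hT) (le_iInf₂ fun _ hg ↦ (hN _ _ (hT.ae_eq hg)).le)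

lemma lorentzNorm_congr {p : ℝ} (hp : 0 < p) {f g : E d → ℂ} (h : f =ᵐ[volume] g) :
    lorentzNorm p 2 f = lorentzNorm p 2 g := by
  rw [lorentzNorm_eq hp, lorentzNorm_eq hp, lor_congr]
  filter_upwards [h] with x hx
  rw [hx]

lemma normBStar_congr {f g : E d → ℂ} (h : f =ᵐ[volume] g) : normBStar f = normBStar g := by
  refine iSup_congr fun j ↦ ?_
  rw [eLpNorm_congr_ae (ae_restrict_of_ae h)]

lemma eLpNorm_two_eq_lor {f : E d → ℂ} (hf : AEStronglyMeasurable f volume) :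
    eLpNorm f 2 volume = lor volume (1 / 2) (fun x ↦ ‖f x‖ₑ) ^ (1 / 2 : ℝ) := by
  rw [lor_half hf.enorm, ← eLpNorm_two_sq, ← ENNReal.rpow_natCast, ← ENNReal.rpow_mul]
  simp

lemma lorentzNorm_sq {p : ℝ} (hp : 0 < p) (f : E d → ℂ) :
    lorentzNorm p 2 f ^ 2 = ENNReal.ofReal (2 / p) * lor volume (1 / p) (fun x ↦ ‖f x‖ₑ) := by
  rw [lorentzNorm_eq hp, ← ENNReal.rpow_natCast, ← ENNReal.rpow_mul]
  simp

lemma lor_le_lorentzNorm {p : ℝ} (hp : 0 < p) (f : E d → ℂ) :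
    lor volume (1 / p) (fun x ↦ ‖f x‖ₑ) = ENNReal.ofReal (p / 2) * lorentzNorm p 2 f ^ 2 := by
  rw [lorentzNorm_sq hp, ← mul_assoc, ← ENNReal.ofReal_mul (by positivity)]
  have : p / 2 * (2 / p) = 1 := by field_simp
  simp [this]

end Norms

/-! ### Bessel potentials between Lorentz spaces -/

section Potentials

variable {d : ℕ}

lemma lor_bessel_le {α κ a : ℝ} (hd : 0 < d) (hα : 0 < α) (hκ0 : 0 ≤ κ) (hκα : κ ≤ α / d)
    (hκ : κ < a) (ha : a < 1) : ∃ C : ℝ≥0, ∀ f : E d → ℂ, AEStronglyMeasurable f volume →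
      lor volume a (fun x ↦ ‖f x‖ₑ) < ∞ →
      lor volume (a - κ) (fun x ↦ ∫⁻ y, ‖f (y + x)‖ₑ ∂besselMeasure d α) ≤
        C * lor volume a (fun x ↦ ‖f x‖ₑ) ∧
      lor volume (a - κ) (fun x ↦ ‖∫ y, f (y + x) ∂besselMeasure d α‖ₑ) ≤
        C * lor volume a (fun x ↦ ‖f x‖ₑ) := by
  have := isProbabilityMeasure_besselMeasure (d := d) hα
  obtain ⟨C₀, hC₀⟩ := besselMeasure_le_rpow hd hα hκ0 (hκ.trans ha) hκα
  obtain ⟨C, hC⟩ := lor_conv_le (d := d) hκ0 hκ ha C₀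
  refine ⟨C, fun f hf hl ↦ ?_⟩
  have h := hC (besselMeasure d α) hC₀ _ hf.enorm hl
  exact ⟨h, (lor_mono (Filter.Eventually.of_forall fun x ↦
    enorm_integral_le_lintegral_enorm _) _).trans h⟩

lemma map_neg_besselMeasure {α : ℝ} (hα : 0 < α) :
    (besselMeasure d α).map (fun y ↦ -y) = besselMeasure d α := by
  have := isProbabilityMeasure_besselMeasure (d := d) hα
  have hm : Measurable fun y : E d ↦ -y := measurable_neg
  have := Measure.isFiniteMeasure_map (besselMeasure d α) fun y : E d ↦ -y
  refine Measure.ext_of_charFun (funext fun ξ ↦ ?_)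
  have e : (fun y : E d ↦ -y) = fun y ↦ (-1 : ℝ) • y := by
    ext y
    simp
  rw [e, charFun_map_smul, charFun_besselMeasure hα, charFun_besselMeasure hα]
  simp

/-- Convolution with a symmetric measure is its own transpose: the map (y, x) ↦ (-y, y + x)
preserves the product measure. -/
lemma integral_conv_mul {ν : Measure (E d)} [SFinite ν] (hν : ν.map (fun y ↦ -y) = ν)
    {h G : E d → ℂ} (hh : AEStronglyMeasurable h volume) (hG : AEStronglyMeasurable G volume)
    (hfin : ∫⁻ x, (∫⁻ y, ‖h (y + x)‖ₑ ∂ν) * ‖G x‖ₑ < ∞) :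
    ∫ x, (∫ y, h (y + x) ∂ν) * G x = ∫ x, h x * ∫ y, G (y + x) ∂ν := by
  set μ := ν.prod (volume : Measure (E d)) with hμ
  have hΦm : AEStronglyMeasurable (fun p : E d × E d ↦ h (p.1 + p.2) * G p.2) μ :=
    (hh.comp_quasiMeasurePreserving (quasiMeasurePreserving_add ν)).mul hG.comp_snd
  have hΦ : Integrable (fun p : E d × E d ↦ h (p.1 + p.2) * G p.2) μ := by
    refine ⟨hΦm, ?_⟩
    rw [HasFiniteIntegral, lintegral_prod_symm _ hΦm.enorm]
    refine lt_of_eq_of_lt (lintegral_congr fun z ↦ ?_) hfin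
    simp_rw [enorm_mul]
    rw [lintegral_mul_const' _ _ enorm_ne_top]
  have hΨm : AEStronglyMeasurable (fun p : E d × E d ↦ h p.2 * G (p.1 + p.2)) μ :=
    hh.comp_snd.mul (hG.comp_quasiMeasurePreserving (quasiMeasurePreserving_add ν))
  have hneg : MeasurePreserving (fun y : E d ↦ -y) ν ν := ⟨measurable_neg, hν⟩
  have hmp : MeasurePreserving (fun p : E d × E d ↦ (-p.1, p.1 + p.2)) μ μ :=
    (hneg.prod (MeasurePreserving.id volume)).comp
      (measurePreserving_prod_add ν (volume : Measure (E d)))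
  have hcomp : (fun p : E d × E d ↦ h p.2 * G (p.1 + p.2)) ∘
      (fun p : E d × E d ↦ (-p.1, p.1 + p.2)) = fun p ↦ h (p.1 + p.2) * G p.2 := by
    ext p
    simp
  have hΨ : Integrable (fun p : E d × E d ↦ h p.2 * G (p.1 + p.2)) μ := by
    rw [← hmp.integrable_comp hΨm, hcomp]
    exact hΦ
  have h1 := integral_map (μ := μ) hmp.measurable.aemeasurable
    (f := fun p : E d × E d ↦ h p.2 * G (p.1 + p.2)) (by rwa [hmp.map_eq])
  rw [hmp.map_eq] at h1
  have h2 : ∫ p, h p.2 * G (p.1 + p.2) ∂μ = ∫ p, h (p.1 + p.2) * G p.2 ∂μ := by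
    rw [h1]
    simp
  rw [integral_prod_symm _ hΨ, integral_prod_symm _ hΦ] at h2
  simp_rw [integral_mul_const, integral_const_mul] at h2
  exact h2.symm

end Potentials

/-! ### Weak Lebesgue potentials -/

section Weak

variable {d : ℕ}

/-- `W` belongs to `L^{1/b,∞}` with constant `K`. -/
def WeakBound (W : E d → ℂ) (b : ℝ) (K : ℝ≥0∞) : Prop :=
  ∀ τ : ℝ, 0 < τ → rearr volume (fun x ↦ ‖W x‖ₑ) (ENNReal.ofReal τ) ≤
    K * ENNReal.ofReal (τ ^ (-b))

lemma WeakBound.lor_mul_le {W : E d → ℂ} {b : ℝ} {K : ℝ≥0∞} (hW : WeakBound W b K) (a : ℝ)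
    (f : E d → ℂ) : lor volume (a + b) (fun x ↦ ‖W x * f x‖ₑ) ≤
      ENNReal.ofReal (2 ^ (2 * (a + b))) * (K ^ 2 * lor volume a (fun x ↦ ‖f x‖ₑ)) := by
  have h := HighOrderSchrodinger.lor_mul_le a (v := fun x ↦ ‖W x‖ₑ) hW (fun x ↦ ‖f x‖ₑ)
  refine le_trans (le_of_eq ?_) h
  congr 1
  ext x
  simp

lemma WeakBound.sqrt_lor_mul_le {W : E d → ℂ} {b : ℝ} {K : ℝ≥0∞} (hW : WeakBound W b K) (a : ℝ)
    (f : E d → ℂ) : lor volume (a + b) (fun x ↦ ‖W x * f x‖ₑ) ^ (1 / 2 : ℝ) ≤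
      ENNReal.ofReal (2 ^ (a + b)) * (K * lor volume a (fun x ↦ ‖f x‖ₑ) ^ (1 / 2 : ℝ)) := by
  refine (ENNReal.rpow_le_rpow (hW.lor_mul_le a f) (by norm_num)).trans (le_of_eq ?_)
  rw [ENNReal.mul_rpow_of_nonneg _ _ (by norm_num), ENNReal.mul_rpow_of_nonneg _ _ (by norm_num),
    ENNReal.ofReal_rpow_of_pos (by positivity), ← Real.rpow_mul (by norm_num),
    ← ENNReal.rpow_natCast, ← ENNReal.rpow_mul]
  norm_num
  ring_nf

lemma sqrt_lor_add_le (a : ℝ) (f g : E d → ℂ) :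
    lor volume a (fun x ↦ ‖f x + g x‖ₑ) ^ (1 / 2 : ℝ) ≤
      (ENNReal.ofReal (2 ^ (2 * a)) * 2) ^ (1 / 2 : ℝ) *
        (lor volume a (fun x ↦ ‖f x‖ₑ) ^ (1 / 2 : ℝ) +
          lor volume a (fun x ↦ ‖g x‖ₑ) ^ (1 / 2 : ℝ)) := by
  have h := (lor_mono (Filter.Eventually.of_forall fun x ↦ enorm_add_le (f x) (g x)) a).trans
    (lor_add_le (μ := volume) a (fun x ↦ ‖f x‖ₑ) fun x ↦ ‖g x‖ₑ)
  refine (ENNReal.rpow_le_rpow h (by norm_num)).trans ?_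
  rw [ENNReal.mul_rpow_of_nonneg _ _ (by norm_num)]
  gcongr
  exact ENNReal.rpow_add_le_add_rpow _ _ (by norm_num) (by norm_num)

/-- The constant is chosen before `W`; (P2) uses this to be uniform in γ. -/
lemma weakBound_of_support (d : ℕ) (M : ℝ≥0) (R : ℝ) {b : ℝ} (hb : 0 ≤ b) :
    ∃ K : ℝ≥0, ∀ W : E d → ℂ, (∀ x, ‖W x‖ₑ ≤ M) → (∀ x, R < ‖x‖ → W x = 0) →
      WeakBound W b K := by
  have hfin : (M : ℝ≥0∞) * volume (Metric.closedBall (0 : E d) R) ^ b ≠ ∞ :=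
    ENNReal.mul_ne_top ENNReal.coe_ne_top (ENNReal.rpow_ne_top_of_nonneg hb
      measure_closedBall_lt_top.ne)
  refine ⟨((M : ℝ≥0∞) * volume (Metric.closedBall (0 : E d) R) ^ b).toNNReal,
    fun W hM hs τ hτ ↦ ?_⟩
  rw [ENNReal.coe_toNNReal hfin]
  refine rearr_le_of_support hM (fun x hx ↦ ?_) hb hτ
  rw [hs x (by simpa using hx), enorm_zero]

lemma WeakBound.sqrt {W w : E d → ℂ} {b : ℝ} {K : ℝ≥0∞} (hW : WeakBound W b K)
    (hw : ∀ x, ‖w x‖ₑ = ‖W x‖ₑ ^ (1 / 2 : ℝ)) : WeakBound w (b / 2) (K ^ (1 / 2 : ℝ)) := by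
  intro τ hτ
  simp_rw [hw]
  rw [rearr_rpow (by norm_num)]
  refine (ENNReal.rpow_le_rpow (hW τ hτ) (by norm_num)).trans (le_of_eq ?_)
  rw [ENNReal.mul_rpow_of_nonneg _ _ (by norm_num), ENNReal.ofReal_rpow_of_pos (by positivity),
    ← Real.rpow_mul hτ.le]
  congr 3
  ring

lemma MemWeakZero.exists_approx {q : ℝ} (hq : 0 < q) {W : E d → ℂ} (hW : MemWeakZero q W)
    {ε : ℝ≥0∞} (hε : 0 < ε) : ∃ (φ : E d → ℂ) (M : ℝ≥0) (R : ℝ), Continuous φ ∧ 1 ≤ R ∧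
      (∀ x, ‖φ x‖ₑ ≤ M) ∧ (∀ x, R < ‖x‖ → φ x = 0) ∧
      WeakBound (fun x ↦ W x - φ x) (1 / q) ε := by
  obtain ⟨φ, hφ, hφc, hlt⟩ := hW.2 ε hε
  obtain ⟨M, hM⟩ := hφ.continuous.bounded_above_of_compact_support hφc
  obtain ⟨R, hR⟩ := hφc.isCompact.isBounded.subset_closedBall 0
  refine ⟨φ, M.toNNReal, max 1 R, hφ.continuous, le_max_left _ _, fun x ↦ ?_, fun x hx ↦ ?_,
    fun τ hτ ↦ ?_⟩
  · rw [← ofReal_norm]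
    exact ENNReal.ofReal_le_ofReal (hM x)
  · by_contra h0
    have := hR (subset_tsupport φ h0)
    rw [mem_closedBall_zero_iff] at this
    exact absurd (this.trans (le_max_right 1 R)) (not_le.2 hx)
  · refine (rearr_le_weakNorm hq _ hτ).trans ?_
    gcongr

lemma WeakBound.add {W₁ W₂ : E d → ℂ} {b : ℝ} {K₁ K₂ : ℝ≥0∞} (h₁ : WeakBound W₁ b K₁)
    (h₂ : WeakBound W₂ b K₂) :
    WeakBound (fun x ↦ W₁ x + W₂ x) b (ENNReal.ofReal (2 ^ b) * (K₁ + K₂)) := by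
  intro τ hτ
  have e : ENNReal.ofReal τ = ENNReal.ofReal (τ / 2) + ENNReal.ofReal (τ / 2) := by
    rw [← ENNReal.ofReal_add (by positivity) (by positivity), add_halves]
  have e2 : (τ / 2) ^ (-b) = 2 ^ b * τ ^ (-b) := by
    rw [Real.div_rpow hτ.le (by norm_num), Real.rpow_neg (by norm_num : (0 : ℝ) ≤ 2)]
    simp [mul_comm]
  calc rearr volume (fun x ↦ ‖W₁ x + W₂ x‖ₑ) (ENNReal.ofReal τ)
      ≤ rearr volume ((fun x ↦ ‖W₁ x‖ₑ) + fun x ↦ ‖W₂ x‖ₑ) (ENNReal.ofReal τ) :=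
        rearr_mono (Filter.Eventually.of_forall fun x ↦ enorm_add_le _ _) _
    _ ≤ _ := by
        rw [e]
        exact rearr_add_le _ _ _ _
    _ ≤ K₁ * ENNReal.ofReal ((τ / 2) ^ (-b)) + K₂ * ENNReal.ofReal ((τ / 2) ^ (-b)) :=
        add_le_add (h₁ _ (by positivity)) (h₂ _ (by positivity))
    _ = _ := by
        rw [e2, ENNReal.ofReal_mul (by positivity)]
        ring

/-- V is within weak distance 1 of a bounded function with bounded support. -/
lemma MemWeakZero.exists_weakBound {q : ℝ} (hq : 0 < q) {W : E d → ℂ} (hW : MemWeakZero q W) :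
    ∃ K : ℝ≥0, WeakBound W (1 / q) K := by
  obtain ⟨φ, M, R, -, -, hM, hs, hweak⟩ := hW.exists_approx hq one_pos
  obtain ⟨K, hK'⟩ := weakBound_of_support d M R (b := 1 / q) (by positivity)
  have hK := hK' φ hM hs
  refine ⟨(2 ^ (1 / q) : ℝ).toNNReal * (1 + K), ?_⟩
  have h := hweak.add hK
  simpa [ENNReal.ofReal] using h

end Weak

/-! ### Functions in `X^*` and in `X` -/

section Embeddings

variable {d m : ℕ} {c : ℝ}

/-- The range of the exponents `q = 1 / (2c)` of admissible potentials. -/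
structure Exponents (d m : ℕ) (c : ℝ) : Prop where
  two_le : 2 ≤ d
  one_le : 1 ≤ m
  lt_half : c < 1 / 2
  lower : 1 / ((d : ℝ) + 1) ≤ c
  upper : c ≤ m / d

lemma theta_pos (hm : 1 ≤ m) : 0 < theta m d := by
  have h1 : (1 : ℝ) ≤ m := by exact_mod_cast hm
  have h2 : (d : ℝ) / (d + 1) < 1 := (div_lt_one (by positivity)).2 (by linarith)
  unfold theta
  linarith

lemma one_div_pd' (hd : 2 ≤ d) : 1 / pd' d = 1 / 2 - 1 / ((d : ℝ) + 1) := by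
  have : (2 : ℝ) ≤ d := by exact_mod_cast hd
  have h1 : (d : ℝ) - 1 ≠ 0 := by linarith
  unfold pd'
  field_simp
  ring

lemma one_div_pd : 1 / pd d = 1 / 2 + 1 / ((d : ℝ) + 1) := by
  unfold pd
  field_simp
  ring

lemma one_div_succ_lt (hd : 2 ≤ d) : 1 / ((d : ℝ) + 1) < 1 / 2 := by
  have : (2 : ℝ) ≤ d := by exact_mod_cast hd
  exact one_div_lt_one_div_of_lt (by norm_num) (by linarith)

lemma Exponents.pos (h : Exponents d m c) : 0 < c :=
  lt_of_lt_of_le (by positivity) h.lower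

/-- Equivalent to c ≤ m/d, because θ/d = m/d - 1/(d+1): the upper bound on c says exactly that
S_{-θ} can produce the gain κ. -/
lemma Exponents.sub_le (h : Exponents d m c) : c - 1 / ((d : ℝ) + 1) ≤ theta m d / d := by
  have hd : (2 : ℝ) ≤ d := by exact_mod_cast h.two_le
  have : theta m d / d = m / d - 1 / ((d : ℝ) + 1) := by
    unfold theta
    field_simp
  rw [this]
  linarith [h.upper]

lemma rpow_half_le {A B : ℝ≥0∞} {C : ℝ≥0} (h : A ≤ C * B) :
    A ^ (1 / 2 : ℝ) ≤ (NNReal.sqrt C : ℝ≥0) * B ^ (1 / 2 : ℝ) := by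
  refine (ENNReal.rpow_le_rpow h (by norm_num)).trans (le_of_eq ?_)
  rw [ENNReal.mul_rpow_of_nonneg _ _ (by norm_num), NNReal.sqrt_eq_rpow,
    ENNReal.coe_rpow_of_nonneg _ (by norm_num)]

lemma lorentzNorm_lt_top_of_distNorm {p : ℝ} (hp : 0 < p) {T : 𝓢'(E d, ℂ)} {G : E d → ℂ}
    (hG : IsFun T G) (h : distNorm (lorentzNorm p 2) T < ∞) :
    lor volume (1 / p) (fun x ↦ ‖G x‖ₑ) < ∞ := by
  rwa [distNorm_eq (fun _ _ ↦ lorentzNorm_congr hp) hG, lorentzNorm_lt_top_iff hp] at h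

/-- The embedding of X^* into L^{1/(1/2-c),2}: u = S_{-θ}S_θ u, with gain κ = c - 1/(d+1) from
1/p_d'. -/
lemma exists_fun_of_normXStar (h : Exponents d m c) : ∃ C : ℝ≥0, ∀ u : 𝓢'(E d, ℂ),
    normXStar m u < ∞ → ∃ G : E d → ℂ, IsFun (S (theta m d) u) G ∧
      lor volume (1 / pd' d) (fun x ↦ ‖G x‖ₑ) < ∞ ∧
      IsFun u (fun x ↦ ∫ y, G (y + x) ∂besselMeasure d (theta m d)) ∧
      ∀ f, IsFun u f →
        lor volume (1 / 2 - c) (fun x ↦ ‖f x‖ₑ) ^ (1 / 2 : ℝ) ≤ C * normXStar m u := by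
  have hd := h.two_le
  have hlt := one_div_succ_lt hd
  have hinv : (0 : ℝ) < 1 / ((d : ℝ) + 1) := by positivity
  have hp := pd'_pos hd
  have hθ := theta_pos (d := d) h.one_le
  obtain ⟨C, hC⟩ := lor_bessel_le (d := d) (by omega) hθ (sub_nonneg.2 h.lower) h.sub_le
    (a := 1 / pd' d) (by rw [one_div_pd' hd]; linarith [h.lt_half])
    (by rw [one_div_pd' hd]; linarith)
  refine ⟨NNReal.sqrt (C * (pd' d / 2).toNNReal), fun u hu ↦ ?_⟩
  obtain ⟨G, hG, -⟩ := distNorm_lt_top.1 (normXStar_lt_top.1 hu).1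
  have hGl := lorentzNorm_lt_top_of_distNorm hp hG (normXStar_lt_top.1 hu).1
  have htame : Tame G := tame_of_lor (by rw [one_div_pd' hd]; linarith)
    (by rw [one_div_pd' hd]; linarith) hG.1 hGl
  have hfun := htame.isFun_S_neg hθ hG
  rw [S_S, neg_add_cancel, S_zero] at hfun
  refine ⟨G, hG, hGl, hfun, fun f hf ↦ ?_⟩
  have h1 : lor volume (1 / 2 - c) (fun x ↦ ‖f x‖ₑ) ≤
      (C * (pd' d / 2).toNNReal : ℝ≥0) * normXStar m u ^ 2 := by
    have e : lor volume (1 / 2 - c) (fun x ↦ ‖f x‖ₑ) =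
        lor volume (1 / pd' d - (c - 1 / ((d : ℝ) + 1)))
          (fun x ↦ ‖∫ y, G (y + x) ∂besselMeasure d (theta m d)‖ₑ) := by
      rw [one_div_pd' hd, show (1 : ℝ) / 2 - 1 / ((d : ℝ) + 1) - (c - 1 / ((d : ℝ) + 1)) =
        1 / 2 - c by ring]
      refine lor_congr ?_ _
      filter_upwards [hf.ae_eq hfun] with x hx
      rw [hx]
    rw [e]
    refine (hC G hG.1 hGl).2.trans ?_
    rw [ENNReal.coe_mul, mul_assoc, lor_le_lorentzNorm hp]
    gcongr
    · exact le_rfl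
    · rw [← distNorm_eq (fun _ _ ↦ lorentzNorm_congr hp) hG]
      exact le_max_left _ _
  refine (rpow_half_le h1).trans (le_of_eq ?_)
  rw [← ENNReal.rpow_natCast, ← ENNReal.rpow_mul]
  simp

/-- The dual embedding of L^{1/(1/2+c),2} into X: the same gain κ leads from 1/2 + c to 1/p_d, and
the decomposition T = T + 0 is admissible. The bound for the convolution of |k| is kept for a later
use of Fubini. -/
lemma exists_normX_le (h : Exponents d m c) : ∃ C : ℝ≥0, ∀ k : E d → ℂ,
    AEStronglyMeasurable k volume → lor volume (1 / 2 + c) (fun x ↦ ‖k x‖ₑ) < ∞ →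
      lor volume (1 / pd d)
        (fun x ↦ ∫⁻ y, ‖k (y + x)‖ₑ ∂besselMeasure d (theta m d)) < ∞ ∧
      (∃ T : 𝓢'(E d, ℂ), IsFun T k) ∧ ∀ T : 𝓢'(E d, ℂ), IsFun T k →
        IsFun (S (-theta m d) T) (fun x ↦ ∫ y, k (y + x) ∂besselMeasure d (theta m d)) ∧
        normX m T ≤ C * lor volume (1 / 2 + c) (fun x ↦ ‖k x‖ₑ) ^ (1 / 2 : ℝ) := by
  have hd := h.two_le
  have hlt := one_div_succ_lt hd
  have hinv : (0 : ℝ) < 1 / ((d : ℝ) + 1) := by positivity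
  have hp := pd_pos d
  have hθ := theta_pos (d := d) h.one_le
  have hc := h.pos
  have hc2 := h.lt_half
  have he : (1 : ℝ) / 2 + c - (c - 1 / ((d : ℝ) + 1)) = 1 / pd d := by
    rw [one_div_pd]
    ring
  obtain ⟨C, hC⟩ := lor_bessel_le (d := d) (by omega) hθ (sub_nonneg.2 h.lower) h.sub_le
    (a := 1 / 2 + c) (by linarith) (by linarith)
  rw [he] at hC
  refine ⟨NNReal.sqrt ((2 / pd d).toNNReal * C), fun k hk hkl ↦ ?_⟩
  have htame : Tame k := tame_of_lor (by linarith) (by linarith) hk hkl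
  refine ⟨lt_of_le_of_lt (hC k hk hkl).1 (ENNReal.mul_lt_top (by simp) hkl), htame.exists_isFun,
    fun T hT ↦ ?_⟩
  have hfun := htame.isFun_S_neg hθ hT
  refine ⟨hfun, ?_⟩
  have h0 : distNorm normB (S (-(m : ℝ)) (0 : 𝓢'(E d, ℂ))) = 0 := by
    rw [map_zero]
    exact le_antisymm ((iInf₂_le 0 isFun_zero).trans (by simp [normB])) zero_le
  calc normX m T ≤ distNorm (lorentzNorm (pd d) 2) (S (-theta m d) T) +
        distNorm normB (S (-(m : ℝ)) (0 : 𝓢'(E d, ℂ))) :=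
        iInf_le_of_le T (iInf_le_of_le 0 (iInf_le _ (add_zero T).symm))
    _ = distNorm (lorentzNorm (pd d) 2) (S (-theta m d) T) := by rw [h0, add_zero]
    _ ≤ _ := iInf₂_le _ hfun
    _ ≤ _ := by
      rw [lorentzNorm_eq hp]
      refine rpow_half_le ?_
      rw [ENNReal.coe_mul, mul_assoc]
      gcongr
      · exact le_rfl
      · exact (hC k hk hkl).2

end Embeddings

/-! ### The duality of `X` and `X^*` on functions -/

section Pairing

variable {d m : ℕ} {c : ℝ} {hd : 2 ≤ d}

/-- T has the canonical decomposition T + 0, with first component K = S_{-θ}T. An arbitrary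
decomposition differs from it by moving T₂ between the two summands, and `integral_mul_conj_eq`
shows that this leaves the pairing unchanged. -/
theorem isPairing_of_isFun (h : Exponents d m c) {T : X d m} {g : XStar d m hd} {k f : E d → ℂ}
    (hT : IsFun (T : 𝓢'(E d, ℂ)) k) (hk : lor volume (1 / 2 + c) (fun x ↦ ‖k x‖ₑ) < ∞)
    (hg : IsFun (g : 𝓢'(E d, ℂ)) f) : IsPairing T g (∫ x, k x * conj (f x)) := by
  intro T₁ T₂ F₁ F₂ G₁ G₂ hsum hF₁ hF₁l hF₂ hF₂B hG₁ hG₂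
  have hlt := one_div_succ_lt hd
  have hinv : (0 : ℝ) < 1 / ((d : ℝ) + 1) := by positivity
  have hθ := theta_pos (d := d) h.one_le
  have := isProbabilityMeasure_besselMeasure (d := d) hθ
  have hgX := normXStar_lt_top.1 g.2
  have hconj : 1 - 1 / pd d = 1 / pd' d := by
    rw [one_div_pd, one_div_pd' hd]
    ring
  have ha : 0 < 1 / pd d := by rw [one_div_pd]; linarith
  have ha1 : 1 / pd d < 1 := by rw [one_div_pd]; linarith
  have hG₁l : lor volume (1 - 1 / pd d) (fun x ↦ ‖G₁ x‖ₑ) < ∞ := by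
    rw [hconj]
    exact lorentzNorm_lt_top_of_distNorm (pd'_pos hd) hG₁ hgX.1
  have hG₂B : normBStar G₂ < ∞ := by
    have := hgX.2
    rwa [distNorm_eq (fun _ _ ↦ normBStar_congr) hG₂] at this
  obtain ⟨C, hC⟩ := exists_normX_le h
  obtain ⟨hKl, -, hT'⟩ := hC k hT.1 hk
  have hK := (hT' _ hT).1
  set K : E d → ℂ := fun x ↦ ∫ y, k (y + x) ∂besselMeasure d (theta m d) with hKdef
  have hKl' : lor volume (1 / pd d) (fun x ↦ ‖K x‖ₑ) < ∞ :=
    lt_of_le_of_lt (lor_mono (Filter.Eventually.of_forall fun x ↦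
      enorm_integral_le_lintegral_enorm _) _) hKl
  rw [lorentzNorm_lt_top_iff (pd_pos d)] at hF₁l
  have hG₁c : AEStronglyMeasurable (fun x ↦ conj (G₁ x)) volume :=
    Complex.continuous_conj.comp_aestronglyMeasurable hG₁.1
  have hint : ∀ {P : E d → ℝ≥0∞}, AEMeasurable P volume → lor volume (1 / pd d) P < ∞ →
      ∫⁻ x, P x * ‖conj (G₁ x)‖ₑ < ∞ := by
    intro P hP hPl
    refine lt_of_le_of_lt (lintegral_mul_le_lor hP hG₁c.enorm (1 / pd d)) ?_
    rw [lor_conj]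
    exact ENNReal.mul_lt_top ENNReal.ofNat_lt_top (ENNReal.mul_lt_top
      (ENNReal.rpow_lt_top_of_nonneg (by norm_num) hPl.ne)
      (ENNReal.rpow_lt_top_of_nonneg (by norm_num) hG₁l.ne))
  have hint' : ∀ {P : E d → ℂ}, AEStronglyMeasurable P volume →
      lor volume (1 / pd d) (fun x ↦ ‖P x‖ₑ) < ∞ → Integrable fun x ↦ P x * conj (G₁ x) := by
    intro P hP hPl
    refine ⟨hP.mul hG₁c, ?_⟩
    rw [HasFiniteIntegral]
    simp_rw [enorm_mul]
    exact hint hP.enorm hPl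
  -- As a difference of K and F₁, the function S_{-θ}T₂ lies in L^{p_d,2} although T₂ was only known
  -- to come from S_m(B).
  have hH : IsFun (S (-theta m d) T₂) (K + (-1 : ℂ) • F₁) := by
    have e : S (-theta m d) T₂ = S (-theta m d) (T : 𝓢'(E d, ℂ)) +
        (-1 : ℂ) • S (-theta m d) T₁ := by
      rw [hsum, map_add]
      module
    rw [e]
    exact hK.add (hF₁.smul (-1))
  have hHl : lor volume (1 / pd d) (fun x ↦ ‖(K + (-1 : ℂ) • F₁) x‖ₑ) < ∞ := by
    refine lt_of_le_of_lt (lor_mono (Filter.Eventually.of_forall fun x ↦ ?_) _)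
      (lt_of_le_of_lt (lor_add_le (1 / pd d) (fun x ↦ ‖K x‖ₑ) fun x ↦ ‖F₁ x‖ₑ)
        (ENNReal.mul_lt_top (ENNReal.mul_lt_top (by simp) (by simp))
          (ENNReal.add_lt_top.2 ⟨hKl', hF₁l⟩)))
    refine (enorm_add_le (K x) (((-1 : ℂ) • F₁) x)).trans (le_of_eq ?_)
    simp
  have hβ : 0 < (d : ℝ) / (d + 1) := by
    have : (2 : ℝ) ≤ d := by exact_mod_cast hd
    positivity
  have hs1 : -((d : ℝ) / (d + 1)) + -theta m d = -m := by
    unfold theta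
    ring
  have hs2 : (d : ℝ) / (d + 1) + theta m d = m := by
    unfold theta
    ring
  -- Since β + θ = m, S_{-β} takes S_{-θ}T₂ to F₂ and S_β takes S_θ g to G₂.
  have hdual := integral_mul_conj_eq (β := (d : ℝ) / (d + 1)) (F := F₂) (G₂ := G₂) hβ ha ha1 hH hHl
    (by rwa [S_S, hs1]) hF₂B hG₁ hG₁l (by rwa [S_S, hs2]) hG₂B
  rw [← hdual]
  have e1 : ∫ x, (K + (-1 : ℂ) • F₁) x * conj (G₁ x) =
      (∫ x, K x * conj (G₁ x)) - ∫ x, F₁ x * conj (G₁ x) := by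
    rw [← integral_sub (hint' hK.1 hKl') (hint' hF₁.1 hF₁l)]
    refine integral_congr_ae (Filter.Eventually.of_forall fun x ↦ ?_)
    simp
    ring
  rw [e1, add_sub_cancel]
  have hqm := quasiMeasurePreserving_add (d := d) (besselMeasure d (theta m d))
  have hkm : AEMeasurable (fun x ↦ ∫⁻ y, ‖k (y + x)‖ₑ ∂besselMeasure d (theta m d)) volume :=
    ((hT.1.comp_quasiMeasurePreserving hqm).prod_swap.enorm).lintegral_prod_right'
  -- The remaining S_{-θ} moves from k to G₁, where it gives back g.
  rw [integral_conv_mul (map_neg_besselMeasure hθ) hT.1 hG₁c (hint hkm hKl)]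
  have hG₁tame : Tame G₁ := tame_of_lor (by linarith) (by linarith) hG₁.1 hG₁l
  have hfun := hG₁tame.isFun_S_neg hθ hG₁
  rw [S_S, neg_add_cancel, S_zero] at hfun
  refine integral_congr_ae ?_
  filter_upwards [hg.ae_eq hfun] with x hx
  rw [hx, ← integral_conj]

end Pairing

/-! ### Multiplication operators on `X^*` -/

section Multiplication

variable {d m : ℕ} {c : ℝ} {hd : 2 ≤ d}

lemma exists_isFun_of_XStar (h : Exponents d m c) (u : XStar d m hd) :
    ∃ f, IsFun (u : 𝓢'(E d, ℂ)) f := by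
  obtain ⟨C, hC⟩ := exists_fun_of_normXStar h
  obtain ⟨G, -, -, hf, -⟩ := hC u u.2
  exact ⟨_, hf⟩

lemma exists_sqrt_lor_mul_le (h : Exponents d m c) (b : ℝ) : ∃ C : ℝ≥0, ∀ (W : E d → ℂ) (K : ℝ≥0∞),
    WeakBound W b K → ∀ (u : 𝓢'(E d, ℂ)) (f : E d → ℂ), normXStar m u < ∞ → IsFun u f →
      lor volume (1 / 2 - c + b) (fun x ↦ ‖W x * f x‖ₑ) ^ (1 / 2 : ℝ) ≤
        C * (K * normXStar m u) := by
  obtain ⟨C, hC⟩ := exists_fun_of_normXStar h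
  refine ⟨(2 ^ (1 / 2 - c + b) : ℝ).toNNReal * C, fun W K hW u f hu hf ↦ ?_⟩
  obtain ⟨-, -, -, -, hf'⟩ := hC u hu
  refine (hW.sqrt_lor_mul_le (1 / 2 - c) f).trans ?_
  rw [ENNReal.coe_mul, mul_assoc, mul_left_comm (C : ℝ≥0∞)]
  gcongr
  · exact le_rfl
  · exact hf' f hf

/-- The image is determined by the a.e. class of its function, so chosen representatives already
give a linear map. -/
lemma exists_linearMap_of_isFun (hex : ∀ u : XStar d m hd, ∃ f, IsFun (u : 𝓢'(E d, ℂ)) f)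
    {W : E d → ℂ} (hW : ∀ (u : XStar d m hd) f, IsFun (u : 𝓢'(E d, ℂ)) f →
      ∃ T : X d m, IsFun (T : 𝓢'(E d, ℂ)) fun x ↦ W x * f x) :
    ∃ M : XStar d m hd →ₗ[ℂ] X d m, ∀ (u : XStar d m hd) f, IsFun (u : 𝓢'(E d, ℂ)) f →
      IsFun (M u : 𝓢'(E d, ℂ)) fun x ↦ W x * f x := by
  choose r hr using hex
  choose T hT using fun u ↦ hW u _ (hr u)
  have key : ∀ (u : XStar d m hd) f, IsFun (u : 𝓢'(E d, ℂ)) f →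
      IsFun (T u : 𝓢'(E d, ℂ)) fun x ↦ W x * f x := by
    intro u f hf
    refine (hT u).congr ?_
    filter_upwards [(hr u).ae_eq hf] with x hx
    rw [hx]
  refine ⟨⟨⟨T, fun u v ↦ Subtype.ext ?_⟩, fun a u ↦ Subtype.ext ?_⟩, key⟩
  · refine (key (u + v) _ ((hr u).add (hr v))).dist_ext (((hT u).add (hT v)).congr ?_)
    exact Filter.Eventually.of_forall fun x ↦ (mul_add _ _ _).symm
  · refine (key (a • u) _ ((hr u).smul a)).dist_ext (((hT u).smul a).congr ?_)
    exact Filter.Eventually.of_forall fun x ↦ mul_left_comm _ _ _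

lemma exists_linearMap_L2 (hex : ∀ u : XStar d m hd, ∃ f, IsFun (u : 𝓢'(E d, ℂ)) f)
    {w : E d → ℂ} (hw : ∀ (u : XStar d m hd) f, IsFun (u : 𝓢'(E d, ℂ)) f →
      MemLp (fun x ↦ w x * f x) 2 volume) :
    ∃ A : XStar d m hd →ₗ[ℂ] L2 d, ∀ (u : XStar d m hd) f, IsFun (u : 𝓢'(E d, ℂ)) f →
      A u =ᵐ[volume] fun x ↦ w x * f x := by
  choose r hr using hex
  set A : XStar d m hd → L2 d := fun u ↦ (hw u _ (hr u)).toLp _ with hA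
  have key : ∀ (u : XStar d m hd) f, IsFun (u : 𝓢'(E d, ℂ)) f →
      A u =ᵐ[volume] fun x ↦ w x * f x := by
    intro u f hf
    refine (MemLp.coeFn_toLp _).trans ?_
    filter_upwards [(hr u).ae_eq hf] with x hx
    rw [hx]
  refine ⟨⟨⟨A, fun u v ↦ Lp.ext ?_⟩, fun a u ↦ Lp.ext ?_⟩, key⟩
  · filter_upwards [key (u + v) _ ((hr u).add (hr v)), key u _ (hr u), key v _ (hr v),
      Lp.coeFn_add (A u) (A v)] with x h1 h2 h3 h4
    rw [h1, h4, Pi.add_apply, Pi.add_apply, h2, h3, mul_add]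
  · filter_upwards [key (a • u) _ ((hr u).smul a), key u _ (hr u),
      Lp.coeFn_smul a (A u)] with x h1 h2 h3
    simp only [RingHom.id_apply]
    rw [h1, h3, Pi.smul_apply, Pi.smul_apply, h2, smul_eq_mul, smul_eq_mul]
    ring

lemma mu_nonneg (N γ : ℝ) (hγ : 0 < γ) (x : E d) : 0 ≤ mu N γ x := by
  unfold mu
  positivity

lemma mu_le {N γ R : ℝ} (hN : 0 ≤ N) (hγ : 0 < γ) {x : E d} (hx : ‖x‖ ≤ R) :
    mu N γ x ≤ (1 + R ^ 2) ^ N := by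
  have h1 : 1 ≤ (1 + γ * ‖x‖ ^ 2) ^ N := Real.one_le_rpow (by
    have : 0 ≤ γ * ‖x‖ ^ 2 := by positivity
    linarith) hN
  refine (div_le_self (by positivity) h1).trans ?_
  gcongr

/-- μVu = (V - φ)(μu) + (φμ)(u 1_{|x| ≤ R}). The first term goes from 1/2 - c to 1/2 + c with a
small constant; the second goes from L² to 1/2 + c, since φμ lies in L^{1/c,∞}. -/
lemma weighted_of_approx (h : Exponents d m c) {V : E d → ℝ}
    (hV : ∀ ε : ℝ≥0∞, 0 < ε → ∃ (φ : E d → ℂ) (M : ℝ≥0) (R : ℝ), Continuous φ ∧ 1 ≤ R ∧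
      (∀ x, ‖φ x‖ₑ ≤ M) ∧ (∀ x, R < ‖x‖ → φ x = 0) ∧
      WeakBound (fun x ↦ (V x : ℂ) - φ x) (2 * c) ε)
    {Op : XStar d m hd → X d m} (hOp : ∀ (u : XStar d m hd) f, IsFun (u : 𝓢'(E d, ℂ)) f →
      IsFun (Op u : 𝓢'(E d, ℂ)) fun x ↦ (V x : ℂ) * f x)
    (ε N : ℝ) (hε : 0 < ε) (hN : 0 ≤ N) : ∃ A R : ℝ, 1 ≤ A ∧ 1 ≤ R ∧
    ∀ (u : XStar d m hd) (γ : ℝ), 0 < γ → γ ≤ 1 →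
      normX m (mulMu N γ (Op u : 𝓢'(E d, ℂ))) ≤
        ENNReal.ofReal ε * normXStar m (mulMu N γ (u : 𝓢'(E d, ℂ))) +
        ENNReal.ofReal A *
          distNorm (fun f ↦ eLpNorm f 2 (volume.restrict {x | ‖x‖ ≤ R})) (u : 𝓢'(E d, ℂ)) := by
  obtain ⟨C₁, hC₁⟩ := exists_sqrt_lor_mul_le h (2 * c)
  obtain ⟨C₂, hC₂⟩ := exists_normX_le h
  have hexp : 1 / 2 - c + 2 * c = 1 / 2 + c := by ring
  rw [hexp] at hC₁
  set D : ℝ≥0∞ := (ENNReal.ofReal (2 ^ (2 * (1 / 2 + c))) * 2) ^ (1 / 2 : ℝ) with hD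
  have hDt : D ≠ ∞ := ENNReal.rpow_ne_top_of_nonneg (by norm_num)
    (ENNReal.mul_ne_top ENNReal.ofReal_ne_top ENNReal.ofNat_ne_top)
  set Q : ℝ≥0∞ := C₂ * (D * C₁) with hQ
  have hQt : Q + 1 ≠ ∞ := by finiteness
  -- Q collects the constants in front of the small term; Q + 1 avoids a division by zero.
  set η : ℝ≥0∞ := ENNReal.ofReal ε / (Q + 1) with hη
  have hη0 : 0 < η := ENNReal.div_pos (by simpa using hε) hQt
  have hηQ : Q * η ≤ ENNReal.ofReal ε := by
    calc Q * η ≤ (Q + 1) * η := by gcongr; exact le_self_add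
      _ = ENNReal.ofReal ε := ENNReal.mul_div_cancel (by simp) hQt
  obtain ⟨φ, M, R, hφ, hR, hM, hs, hweak⟩ := hV η hη0
  -- On the ball μ_{N,γ} ≤ (1 + R²)^N, so K does not depend on γ.
  obtain ⟨K, hK⟩ := weakBound_of_support d (M * ((1 + R ^ 2) ^ N : ℝ).toNNReal) R h.pos.le
  set P : ℝ≥0∞ := C₂ * (D * (ENNReal.ofReal (2 ^ (1 / 2 + c)) * K)) with hP
  have hPt : P ≠ ∞ := by finiteness
  refine ⟨max 1 P.toReal, R, le_max_left _ _, hR, fun u γ hγ _ ↦ ?_⟩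
  obtain ⟨f, hf⟩ := exists_isFun_of_XStar h u
  -- The product μu need not be known to lie in X^*; if it does not, the right side is infinite
  -- because ε > 0.
  by_cases hfin : normXStar m (mulMu N γ (u : 𝓢'(E d, ℂ))) < ∞
  swap
  · rw [not_lt, top_le_iff] at hfin
    rw [hfin, ENNReal.mul_top (by simpa using hε), top_add]
    exact le_top
  rw [distNorm_eq (fun _ _ h ↦ eLpNorm_congr_ae (ae_restrict_of_ae h)) hf]
  have hμf := hf.mulMu N hγ
  have hT := (hOp u f hf).mulMu N hγ
  have hball : MeasurableSet {x : E d | ‖x‖ ≤ R} :=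
    measurableSet_le measurable_norm measurable_const
  set f₁ : E d → ℂ := {x : E d | ‖x‖ ≤ R}.indicator f with hf₁
  have hf₁m : AEStronglyMeasurable f₁ volume := hf.1.indicator hball
  have hsplit : ∀ x, (mu N γ x : ℂ) * ((V x : ℂ) * f x) =
      ((V x : ℂ) - φ x) * ((mu N γ x : ℂ) * f x) + (φ x * (mu N γ x : ℂ)) * f₁ x := by
    intro x
    by_cases hx : ‖x‖ ≤ R
    · rw [hf₁, indicator_of_mem (by exact hx)]
      ring
    · rw [hs x (not_le.1 hx)]
      ring
  simp_rw [hsplit] at hT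
  have hw : WeakBound (fun x ↦ φ x * (mu N γ x : ℂ)) c K := by
    refine hK _ (fun x ↦ ?_) fun x hx ↦ by rw [hs x hx, zero_mul]
    by_cases hx : ‖x‖ ≤ R
    · rw [enorm_mul, ENNReal.coe_mul]
      gcongr
      · exact hM x
      · rw [← ofReal_norm, Complex.norm_real, Real.norm_of_nonneg (mu_nonneg N γ hγ x)]
        exact ENNReal.ofReal_le_ofReal (mu_le hN hγ hx)
    · rw [hs x (not_le.1 hx)]
      simp
  have b1 := hC₁ _ _ hweak _ _ hfin hμf
  have b2 := hw.sqrt_lor_mul_le (1 / 2) f₁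
  rw [← eLpNorm_two_eq_lor hf₁m, hf₁, eLpNorm_indicator_eq_eLpNorm_restrict hball] at b2
  have b3 := sqrt_lor_add_le (1 / 2 + c)
    (fun x ↦ ((V x : ℂ) - φ x) * ((mu N γ x : ℂ) * f x))
    (fun x ↦ (φ x * (mu N γ x : ℂ)) * f₁ x)
  set e₂ := eLpNorm f 2 (volume.restrict {x : E d | ‖x‖ ≤ R}) with he₂
  by_cases he : e₂ = ∞
  · rw [he, ENNReal.mul_top (by
      simp only [ne_eq, ENNReal.ofReal_eq_zero, not_le]
      exact lt_of_lt_of_le one_pos (le_max_left _ _)), add_top]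
    exact le_top
  have b4 := b3.trans (mul_le_mul_right (add_le_add b1 b2) D)
  have hl : lor volume (1 / 2 + c) (fun x ↦ ‖((V x : ℂ) - φ x) * ((mu N γ x : ℂ) * f x) +
      (φ x * (mu N γ x : ℂ)) * f₁ x‖ₑ) < ∞ := by
    rw [← ENNReal.rpow_lt_top_iff_of_pos (y := 1 / 2) (by norm_num)]
    have hηt : η ≠ ∞ := ENNReal.div_ne_top ENNReal.ofReal_ne_top (by simp)
    have := hfin.ne
    exact lt_of_le_of_lt b4 (by finiteness)
  refine (((hC₂ _ hT.1 hl).2.2 _ hT).2.trans (mul_le_mul_right b4 _)).trans ?_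
  calc _ = Q * η * normXStar m (mulMu N γ (u : 𝓢'(E d, ℂ))) + P * e₂ := by
        rw [hQ, hP]
        ring
    _ ≤ _ := by
        gcongr
        calc P = ENNReal.ofReal P.toReal := (ENNReal.ofReal_toReal hPt).symm
          _ ≤ _ := ENNReal.ofReal_le_ofReal (le_max_right _ _)

end Multiplication

/-! ### Potentials are admissible -/

section Admissible

variable {d m : ℕ} {c : ℝ} {hd : 2 ≤ d}

/-- Multiplication by a function in L^{1/c,∞} raises the exponent 1/2 - c to 1/2, and L^{2,2} is L².
-/
lemma exists_factor (h : Exponents d m c) {w : E d → ℂ} (hw : AEStronglyMeasurable w volume)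
    {K : ℝ≥0∞} (hKt : K ≠ ∞) (hK : WeakBound w c K) :
    ∃ A : XStar d m hd →ₗ[ℂ] L2 d, (∃ C : ℝ≥0, ∀ u, ‖A u‖ₑ ≤ C * normXStar m (u : 𝓢'(E d, ℂ))) ∧
      ∀ (u : XStar d m hd) f, IsFun (u : 𝓢'(E d, ℂ)) f → A u =ᵐ[volume] fun x ↦ w x * f x := by
  obtain ⟨C, hC⟩ := exists_sqrt_lor_mul_le h c
  rw [sub_add_cancel] at hC
  have hle : ∀ (u : XStar d m hd) f, IsFun (u : 𝓢'(E d, ℂ)) f →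
      eLpNorm (fun x ↦ w x * f x) 2 volume ≤ C * (K * normXStar m (u : 𝓢'(E d, ℂ))) :=
    fun u f hf ↦ by
      rw [eLpNorm_two_eq_lor (f := fun x ↦ w x * f x) (hw.mul hf.1)]
      exact hC w K hK u f u.2 hf
  obtain ⟨A, hA⟩ := exists_linearMap_L2 (hd := hd) (exists_isFun_of_XStar h) (w := w)
    fun u f hf ↦ ⟨hw.mul hf.1, lt_of_le_of_lt (hle u f hf) (ENNReal.mul_lt_top (by simp)
      (ENNReal.mul_lt_top hKt.lt_top u.2))⟩
  refine ⟨A, ⟨C * K.toNNReal, fun u ↦ ?_⟩, hA⟩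
  obtain ⟨f, hf⟩ := exists_isFun_of_XStar h u
  rw [ENNReal.coe_mul, ENNReal.coe_toNNReal hKt, mul_assoc, Lp.enorm_def,
    eLpNorm_congr_ae (hA u f hf)]
  exact hle u f hf

theorem isAdmissiblePotential_of_weakBound (h : Exponents d m c) {V : E d → ℝ}
    (hVm : AEStronglyMeasurable (fun x ↦ (V x : ℂ)) volume) {K : ℝ≥0}
    (hK : WeakBound (fun x ↦ (V x : ℂ)) (2 * c) K)
    (hV : ∀ ε : ℝ≥0∞, 0 < ε → ∃ (φ : E d → ℂ) (M : ℝ≥0) (R : ℝ), Continuous φ ∧ 1 ≤ R ∧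
      (∀ x, ‖φ x‖ₑ ≤ M) ∧ (∀ x, R < ‖x‖ → φ x = 0) ∧
      WeakBound (fun x ↦ (V x : ℂ) - φ x) (2 * c) ε) :
    IsAdmissiblePotential m hd V := by
  obtain ⟨C₁, hC₁⟩ := exists_sqrt_lor_mul_le h (2 * c)
  rw [show 1 / 2 - c + 2 * c = 1 / 2 + c by ring] at hC₁
  obtain ⟨C₂, hC₂⟩ := exists_normX_le h
  have hl : ∀ (u : XStar d m hd) f, IsFun (u : 𝓢'(E d, ℂ)) f →
      lor volume (1 / 2 + c) (fun x ↦ ‖(V x : ℂ) * f x‖ₑ) < ∞ := fun u f hf ↦ by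
    rw [← ENNReal.rpow_lt_top_iff_of_pos (y := 1 / 2) (by norm_num)]
    have hu : normXStar m (u : 𝓢'(E d, ℂ)) < ∞ := u.2
    refine lt_of_le_of_lt (hC₁ _ _ hK u f hu hf) ?_
    finiteness
  have hT : ∀ (u : XStar d m hd) f, IsFun (u : 𝓢'(E d, ℂ)) f → ∀ T : 𝓢'(E d, ℂ),
      IsFun T (fun x ↦ (V x : ℂ) * f x) →
      normX m T ≤ (C₂ * C₁ * K : ℝ≥0) * normXStar m (u : 𝓢'(E d, ℂ)) := fun u f hf T hT ↦ by
    refine ((hC₂ _ hT.1 (hl u f hf)).2.2 T hT).2.trans ?_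
    rw [ENNReal.coe_mul, ENNReal.coe_mul, mul_assoc, mul_assoc]
    gcongr
    exact hC₁ _ _ hK u f u.2 hf
  have hex := exists_isFun_of_XStar (hd := hd) h
  obtain ⟨M, hM⟩ := exists_linearMap_of_isFun hex (W := fun x ↦ (V x : ℂ)) fun u f hf ↦ by
    obtain ⟨T, hT'⟩ := (hC₂ _ (hVm.mul hf.1) (hl u f hf)).2.1
    have hu : normXStar m (u : 𝓢'(E d, ℂ)) < ∞ := u.2
    exact ⟨⟨T, lt_of_le_of_lt (hT u f hf T hT') (by finiteness)⟩, hT'⟩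
  have hpair : ∀ (u g : XStar d m hd) f k, IsFun (u : 𝓢'(E d, ℂ)) f → IsFun (g : 𝓢'(E d, ℂ)) k →
      IsPairing (M u) g (∫ x, (V x : ℂ) * f x * conj (k x)) := fun u g f k hf hk ↦
    isPairing_of_isFun h (hM u f hf) (hl u f hf) hk
  refine ⟨M, fun u ↦ ?_, ⟨C₂ * C₁ * K, fun u ↦ ?_⟩, fun φ ψ ↦ ?_, weighted_of_approx h hV hM, ?_⟩
  · obtain ⟨f, hf⟩ := hex u
    exact ⟨f, hf, hM u f hf⟩
  · obtain ⟨f, hf⟩ := hex u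
    exact hT u f hf _ (hM u f hf)
  · refine ⟨_, hpair (ofSchwartz m hd φ) (ofSchwartz m hd ψ) φ ψ (isFun_schwartz φ)
      (isFun_schwartz ψ), ?_⟩
    convert! hpair (ofSchwartz m hd ψ) (ofSchwartz m hd φ) ψ φ (isFun_schwartz ψ)
      (isFun_schwartz φ) using 1
    rw [← integral_conj]
    refine integral_congr_ae (Filter.Eventually.of_forall fun x ↦ ?_)
    simp only [map_mul, Complex.conj_ofReal, Complex.conj_conj]
    ring
  · set w : E d → ℂ := fun x ↦ ((Real.sqrt |V x| : ℝ) : ℂ) with hw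
    -- The signed square root of V. Division by zero gives 0, so |v| = |V|^{1/2} and v w = V also
    -- hold where V vanishes.
    set v : E d → ℂ := fun x ↦ ((V x / Real.sqrt |V x| : ℝ) : ℂ) with hv
    have hVr : AEMeasurable V volume := by
      have := Complex.measurable_re.comp_aemeasurable hVm.aemeasurable
      simpa [Function.comp_def] using this
    have hwm : AEStronglyMeasurable w volume :=
      (Complex.measurable_ofReal.comp_aemeasurable
        (Real.continuous_sqrt.measurable.comp_aemeasurable hVr.abs)).aestronglyMeasurable
    have hvm : AEStronglyMeasurable v volume :=
      (Complex.measurable_ofReal.comp_aemeasurable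
        (hVr.div (Real.continuous_sqrt.measurable.comp_aemeasurable hVr.abs))).aestronglyMeasurable
    have hsqrt : ∀ x, ENNReal.ofReal (Real.sqrt |V x|) = ‖(V x : ℂ)‖ₑ ^ (1 / 2 : ℝ) := fun x ↦ by
      rw [Real.sqrt_eq_rpow, ← ENNReal.ofReal_rpow_of_nonneg (abs_nonneg _) (by norm_num),
        ← ofReal_norm, Complex.norm_real, Real.norm_eq_abs]
    have hwK : WeakBound w c (K ^ (1 / 2 : ℝ)) := by
      have := hK.sqrt (w := w) fun x ↦ by
        rw [← hsqrt, ← ofReal_norm, hw, Complex.norm_real, Real.norm_of_nonneg (Real.sqrt_nonneg _)]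
      rwa [mul_div_cancel_left₀ c two_ne_zero] at this
    have hvK : WeakBound v c (K ^ (1 / 2 : ℝ)) := by
      have := hK.sqrt (w := v) fun x ↦ by
        rw [← hsqrt, ← ofReal_norm, hv, Complex.norm_real, norm_div,
          Real.norm_of_nonneg (Real.sqrt_nonneg _), Real.norm_eq_abs, Real.div_sqrt]
      rwa [mul_div_cancel_left₀ c two_ne_zero] at this
    have hKt : (K : ℝ≥0∞) ^ (1 / 2 : ℝ) ≠ ∞ := by finiteness
    obtain ⟨A, ⟨CA, hCA⟩, hA⟩ := exists_factor (hd := hd) h hwm hKt hwK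
    obtain ⟨B, ⟨CB, hCB⟩, hB⟩ := exists_factor (hd := hd) h hvm hKt hvK
    refine ⟨1, fun _ ↦ A, fun _ ↦ B, le_rfl, ⟨max CA CB, fun _ u ↦ ⟨?_, ?_⟩⟩, fun u g ↦ ?_⟩
    · refine (hCA u).trans ?_
      gcongr
      exact le_max_left _ _
    · refine (hCB u).trans ?_
      gcongr
      exact le_max_right _ _
    · obtain ⟨f, hf⟩ := hex u
      obtain ⟨k, hk⟩ := hex g
      convert! hpair u g f k hf hk using 1
      rw [Finset.univ_unique, Finset.sum_singleton, L2.inner_def]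
      refine integral_congr_ae ?_
      filter_upwards [hA g k hk, hB u f hf] with x h1 h2
      rw [h1, h2]
      have hvw : v x * w x = V x := by
        rw [hv, hw, ← Complex.ofReal_mul]
        congr 1
        by_cases h0 : V x = 0
        · simp [h0]
        · exact div_mul_cancel₀ _ (Real.sqrt_pos.2 (abs_pos.2 h0)).ne'
      have hwc : conj (w x) = w x := Complex.conj_ofReal _
      rw [← hvw, RCLike.inner_apply, map_mul, hwc]
      ring

end Admissible

end HighOrderSchrodinger

theorem mainTheorem4 (d m : ℕ) (hd : 2 ≤ d) (hm : 1 ≤ m) (q : ℝ) (hq : 1 < q)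
    (hq_lower : (d : ℝ) / (2 * m) ≤ q) (hq_upper : q ≤ ((d : ℝ) + 1) / 2)
    (V : HighOrderSchrodinger.E d → ℝ)
    (hV : HighOrderSchrodinger.MemWeakZero q (fun x ↦ (V x : ℂ))) :
    HighOrderSchrodinger.IsAdmissiblePotential m hd V := by
  have hq0 : 0 < q := by linarith
  have hd0 : (0 : ℝ) < d := by
    have : (2 : ℝ) ≤ d := by exact_mod_cast hd
    linarith
  have hm0 : (0 : ℝ) < m := by exact_mod_cast hm
  -- With c = 1/(2q), the bounds q > 1, q ≤ (d+1)/2 and q ≥ d/(2m) give, in this order, c < 1/2, c ≥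
  -- 1/(d+1) and c ≤ m/d.
  have h : HighOrderSchrodinger.Exponents d m (1 / (2 * q)) := by
    refine ⟨hd, hm, ?_, ?_, ?_⟩
    · exact one_div_lt_one_div_of_lt (by norm_num) (by linarith)
    · exact one_div_le_one_div_of_le (by linarith) (by linarith)
    · rw [div_le_iff₀ (by positivity)] at hq_lower
      rw [div_le_div_iff₀ (by positivity) hd0]
      linarith
  have e : 1 / q = 2 * (1 / (2 * q)) := by
    field_simp
  obtain ⟨K, hK⟩ := hV.exists_weakBound hq0
  rw [e] at hK
  refine HighOrderSchrodinger.isAdmissiblePotential_of_weakBound h hV.1 hK fun ε hε ↦ ?_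
  rw [← e]
  exact hV.exists_approx hq0 hε
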